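/- **Setting.** A stream $x_1,x_2,\dots$ of elements of $\{1,\dots,u\}$ arrives one element at a time; the window $W$ at time $n\ge 1$ consists of the last $\min(n,N)$ elements, where $N\ge 2$. Let $n_i(W)$ be the number of occurrences of $i$ in $W$ and $L_2(W)=(\sum_i n_i(W)^2)^{1/2}$. A randomized streaming algorithm draws a uniformly random seed once and then updates its state on each arrival; its memory is the number of words (integers) that describe seed and state, and probabilities are over the seed. **Algorithm Freq$(\gamma,\epsilon,\delta)$** (with an absolute constant $\kappa$ in the sizes below). 1. It keeps a smooth histogram for $L_2$ with parameters $\alpha=\epsilon/2$, $\beta=\alpha^2/2$: a list $A_1,A_2,\dots$ of buckets, i.e. suffixes of the stream, the oldest first. Each bucket has its size and an AMS sketch for $L_2$: $\lceil\kappa\log(2N/\delta)\rceil$ rows, each averaging $\lceil\kappa/\epsilon^2\rceil$ squared sums of 4-wise independent random signs, with the same signs for all buckets; $L_2$ is estimated by the median of the rows. Every arrival is appended to all buckets and starts a new one. Then, for each remaining bucket $A$ in turn, the buckets strictly between $A$ and the last bucket $B$ that passes the test $\hat L_2(B)\ge(1-\beta)\hat L_2(A)$ (decided by the majority of the rows)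 are deleted, and $A_1$ is deleted as long as $A_2$ contains the window. Buckets with more than $4N^2$ elements, and the oldest of more than $\lceil\kappa\epsilon^{-2}\log N\rceil$ buckets, are dropped. 2. On each bucket it runs CountSketch of Charikar, Chen and Farach-Colton with $k=\lfloor\gamma^{-2}\rfloor+1$ candidates, $\lceil\kappa\log(2N/\delta)\rceil$ rows of pairwise independent hash functions and signs, and $b$ cells per row, $b$ being the least power of two that is at least $256/(\gamma^2\epsilon'^2)$ with $\epsilon'=\epsilon/4$. 3. When queried, it outputs every candidate $q$ of $A_1$ whose estimated frequency exceeds $\frac{1}{1+\epsilon}\gamma\hat L_2$, where $\hat L_2$ is the estimate of $L_2(A_1)$. **Theorem.** (a) There are absolute constants $\kappa,c_0,\epsilon_0,C>0$ and $d\in\mathbb N$ such that for all $u$, $N\ge2$, $\gamma,\delta\in(0,1)$ and $0<\epsilon<\epsilon_0$, on every stream and at every time $n\ge1$, with probability at least $1-\delta$ the output of Freq$(\gamma,\epsilon,\delta)$ contains every element with $n_i(W)\ge(1+c_0\epsilon)\gamma L_2(W)$ and no element with $n_i(W)<(1-c\epsilon)\gamma L_2(W)$, where $c=c_0/\gamma$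 depends only on $\gamma$. Always (for every seed, stream and time) its memory has at most $$C\Big(\frac1{\gamma^2\epsilon^4}\log N\log\frac N\delta+\frac1{\epsilon^4}\log N\log\frac1\epsilon\Big)$$ words, each of absolute value at most $(2Nu/(\gamma\epsilon))^d$. (b) There are a polynomial $p$ and $d\in\mathbb N$ such that for all $u$, $N\ge2$ and $\gamma,\epsilon,\delta\in(0,1)$ some randomized streaming algorithm has the following properties. On every stream and at every time $n\ge1$, with probability at least $1-\delta$ it outputs every element with $n_i(W)>\gamma L_2(W)$ and no element with $n_i(W)<(1-\epsilon)\gamma L_2(W)$. Always its memory has at most $p(1/\epsilon,1/\gamma,\log N,\log(1/\delta))$ words, each of absolute value at most $(2Nu/(\gamma\epsilon))^d$. -/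

import Mathlib

namespace SlidingWindow

/-! ### Streams, windows, frequencies -/

/-- Frequency of `i` in the segment of the stream made of the elements with index in `[a, n)`. -/
def freq {u : ℕ} (x : ℕ → Fin u) (a n : ℕ) (i : Fin u) : ℕ :=
  ((Finset.Ico a n).filter (fun j => x j = i)).card

/-- Frequency of `i` in the window, i.e. among the last `N` of the first `n` elements of the stream
(among all of them if `n < N`). -/
def winFreq {u : ℕ} (N : ℕ) (x : ℕ → Fin u) (n : ℕ) (i : Fin u) : ℕ :=
  freq x (n - N) n i

/-- The second frequency norm of the window. -/
noncomputable def winL2 {u : ℕ} (N : ℕ) (x : ℕ → Fin u) (n : ℕ) : ℝ :=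
  Real.sqrt (∑ i, (winFreq N x n i : ℝ) ^ 2)

/-! ### Randomized streaming algorithms -/

/-- A randomized one-pass algorithm over the universe `Fin u`. A uniformly random seed is drawn
before the stream starts and stays in memory; the memory content is the list of integers (words)
`seedWords ω ++ stateWords s`, which determines the seed and the state. -/
structure StreamAlgorithm (u : ℕ) where
  Seed : Type
  seedFintype : Fintype Seed
  seedNonempty : Nonempty Seed
  State : Type
  init : State
  step : Seed → State → Fin u → State
  report : Seed → State → Finset (Fin u)
  seedWords : Seed → List ℤ
  stateWords : State → List ℤ
  seedWords_injective : Function.Injective seedWords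
  stateWords_injective : Function.Injective stateWords

namespace StreamAlgorithm

variable {u : ℕ} (A : StreamAlgorithm u)

/-- State after the first `n` elements of the stream `x`, with seed `ω`. -/
def run (ω : A.Seed) (x : ℕ → Fin u) : ℕ → A.State
  | 0 => A.init
  | n + 1 => A.step ω (run ω x n) (x n)

/-- Output when queried after `n` elements. -/
def output (ω : A.Seed) (x : ℕ → Fin u) (n : ℕ) : Finset (Fin u) :=
  A.report ω (A.run ω x n)

/-- Memory content after `n` elements. -/
def memory (ω : A.Seed) (x : ℕ → Fin u) (n : ℕ) : List ℤ :=
  A.seedWords ω ++ A.stateWords (A.run ω x n)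

/-- Probability of an event over the uniformly random seed. -/
noncomputable def prob (p : A.Seed → Prop) : ℝ :=
  (Nat.card {ω : A.Seed // p ω} : ℝ) / (Nat.card A.Seed : ℝ)

/-- At every time (after at least one element), with probability at least `1 - δ`, the output
contains every element whose window frequency is at least `hi` times the window's `L₂` norm, and
no element whose window frequency is lower than `lo` times that norm. -/
def Separates (N : ℕ) (hi lo δ : ℝ) : Prop :=
  ∀ (x : ℕ → Fin u) (n : ℕ), 1 ≤ n →
    1 - δ ≤ A.prob (fun ω =>
      (∀ i, hi * winL2 N x n ≤ winFreq N x n i → i ∈ A.output ω x n) ∧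
      (∀ i, (winFreq N x n i : ℝ) < lo * winL2 N x n → i ∉ A.output ω x n))

/-- At every time, with probability at least `1 - δ`, the output is a `(γ, ε)`-approximation of the
`L₂`-frequent elements of the window: it contains every element with `n_i > γ L₂` and no element
with `n_i < (1 - ε) γ L₂`. -/
def ApproximatesFrequent (N : ℕ) (γ ε δ : ℝ) : Prop :=
  ∀ (x : ℕ → Fin u) (n : ℕ), 1 ≤ n →
    1 - δ ≤ A.prob (fun ω =>
      (∀ i, γ * winL2 N x n < winFreq N x n i → i ∈ A.output ω x n) ∧
      (∀ i, (winFreq N x n i : ℝ) < (1 - ε) * γ * winL2 N x n → i ∉ A.output ω x n))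

/-- Whatever the stream, the seed and the time, the memory has at most `M` words. -/
def UsesWords (M : ℝ) : Prop :=
  ∀ (ω : A.Seed) (x : ℕ → Fin u) (n : ℕ), ((A.memory ω x n).length : ℝ) ≤ M

/-- Whatever the stream, the seed and the time, every word in memory is at most `B` in absolute
value. -/
def WordsBoundedBy (B : ℝ) : Prop :=
  ∀ (ω : A.Seed) (x : ℕ → Fin u) (n : ℕ), ∀ w ∈ A.memory ω x n, |(w : ℝ)| ≤ B

end StreamAlgorithm

/-! ### Writing data as lists of words -/

/-- `c` is a prefix code: concatenations of code words can be decoded uniquely. -/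
def PrefixCode {α : Type*} (c : α → List ℤ) : Prop :=
  ∀ a b s s', c a ++ s = c b ++ s' → a = b ∧ s = s'

theorem PrefixCode.injective {α : Type*} {c : α → List ℤ} (h : PrefixCode c) :
    Function.Injective c := fun a b hab => (h a b [] [] (by simp [hab])).1

/-- Words of an array. -/
def arrayWords {α : Type*} (c : α → List ℤ) {n : ℕ} (f : Fin n → α) : List ℤ :=
  (List.ofFn fun i => c (f i)).flatten

theorem PrefixCode.array {α : Type*} {c : α → List ℤ} (h : PrefixCode c) (n : ℕ) :
    PrefixCode (arrayWords c (n := n)) := by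
  induction n with
  | zero =>
    intro a b s s' e
    exact ⟨Subsingleton.elim _ _, by simpa [arrayWords] using e⟩
  | succ n ih =>
    intro a b s s' e
    simp only [arrayWords, List.ofFn_succ, List.flatten_cons, List.append_assoc] at e
    obtain ⟨h0, e⟩ := h _ _ _ _ e
    obtain ⟨h1, e⟩ := ih (fun i => a i.succ) (fun i => b i.succ) _ _ e
    refine ⟨funext fun i => ?_, e⟩
    refine Fin.cases h0 (fun j => congrFun h1 j) i

theorem PrefixCode.prod {α β : Type*} {c : α → List ℤ} {d : β → List ℤ} (h : PrefixCode c)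
    (h' : PrefixCode d) : PrefixCode (fun p : α × β => c p.1 ++ d p.2) := by
  intro a b s s' e
  simp only [List.append_assoc] at e
  obtain ⟨h0, e⟩ := h _ _ _ _ e
  obtain ⟨h1, e⟩ := h' _ _ _ _ e
  exact ⟨Prod.ext h0 h1, e⟩

/-- Words of a list of variable length: its length, then its members. -/
def listWords {α : Type*} (c : α → List ℤ) (l : List α) : List ℤ :=
  (l.length : ℤ) :: l.flatMap c

theorem PrefixCode.list {α : Type*} {c : α → List ℤ} (h : PrefixCode c) :
    PrefixCode (listWords c) := by
  intro a b s s' e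
  simp only [listWords, List.cons_append, List.cons.injEq, Nat.cast_inj] at e
  obtain ⟨hl, e⟩ := e
  induction a generalizing b with
  | nil =>
    cases b with
    | nil => exact ⟨rfl, by simpa using e⟩
    | cons y b => simp at hl
  | cons x a ih =>
    cases b with
    | nil => simp at hl
    | cons y b =>
      simp only [List.flatMap_cons, List.append_assoc] at e
      obtain ⟨h0, e⟩ := h _ _ _ _ e
      obtain ⟨h1, e⟩ := ih b (by simpa using hl) e
      exact ⟨by rw [h0, h1], e⟩

theorem prefixCode_int : PrefixCode (fun z : ℤ => [z]) := by
  intro a b s s' e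
  simpa using e

theorem prefixCode_fin (n : ℕ) : PrefixCode (fun z : Fin n => [((z : ℕ) : ℤ)]) := by
  intro a b s s' e
  simpa [Fin.ext_iff] using e

/-! ### Hash functions -/

/-- `(m+1)`-bit words, read as the elements of the field with `2 ^ (m+1)` elements. -/
noncomputable def fieldEquiv (m : ℕ) : GaloisField 2 (m + 1) ≃ Fin (2 ^ (m + 1)) :=
  Finite.equivFinOfCardEq (GaloisField.card 2 (m + 1) (Nat.succ_ne_zero m))

/-- The polynomial with the `d` coefficients `a`, evaluated at the point `x < 2 ^ (m+1)`. For
uniformly random `a` this is a `d`-wise independent hash function. -/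
noncomputable def polyHash (m : ℕ) {d : ℕ} (a : Fin d → Fin (2 ^ (m + 1))) (x : ℕ) : ℕ :=
  fieldEquiv m (∑ j : Fin d, (fieldEquiv m).symm (a j) *
    ((fieldEquiv m).symm (Fin.ofNat (2 ^ (m + 1)) x)) ^ (j : ℕ))

/-- A hash function with values in `Fin (2 ^ e)` (used with `e ≤ m + 1`). -/
noncomputable def cellHash (m e : ℕ) {d : ℕ} (a : Fin d → Fin (2 ^ (m + 1))) (x : ℕ) :
    Fin (2 ^ e) :=
  Fin.ofNat (2 ^ e) (polyHash m a x)

/-- A hash function with values in `{1, -1}`. -/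
noncomputable def signHash (m : ℕ) {d : ℕ} (a : Fin d → Fin (2 ^ (m + 1))) (x : ℕ) : ℤ :=
  if polyHash m a x % 2 = 0 then 1 else -1

/-- Median of finitely many integers. -/
def median {r : ℕ} (f : Fin r → ℤ) : ℤ :=
  ((List.ofFn f).insertionSort (· ≤ ·)).getD (r / 2) 0

/-! ### Parameters -/

/-- Parameters of the algorithm: size `u` of the universe, window size `N`, the numbers `γ, ε, δ`,
and the absolute constant `κ` that multiplies the sizes given up to a constant factor. -/
structure Params where
  u : ℕ
  N : ℕ
  γ : ℝ
  ε : ℝ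
  δ : ℝ
  κ : ℝ

namespace Params

variable (P : Params)

/-- Number of independent repetitions for the failure probability `δ / 2`. -/
noncomputable def rows : ℕ := ⌈P.κ * Real.log (P.N / (P.δ / 2))⌉₊

/-- Precision `ε' = ε / 4` of CountSketch. -/
noncomputable def csEps : ℝ := P.ε / 4

/-- The number of cells `b` in a row of CountSketch is `2 ^ cellBits`, the least power of two that
is at least `256 / (γ² ε'²)`. -/
noncomputable def cellBits : ℕ := Nat.clog 2 ⌈256 / (P.γ ^ 2 * P.csEps ^ 2)⌉₊

/-- Length `k` of the list of candidates kept by CountSketch. -/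
noncomputable def listLen : ℕ := ⌊1 / P.γ ^ 2⌋₊ + 1

/-- Hash functions work with words of `hashBits + 1` bits. -/
noncomputable def hashBits : ℕ := max (Nat.clog 2 P.u) P.cellBits

/-- Number of averaged copies in the `L₂` sketch. -/
noncomputable def cols : ℕ := ⌈P.κ / P.ε ^ 2⌉₊

/-- The smooth histogram uses that `L₂` is `(α, α²/2)`-smooth, for `α = ε / 2`. -/
noncomputable def α : ℝ := P.ε / 2

noncomputable def β : ℝ := P.α ^ 2 / 2

/-- Maximal number of buckets of the histogram. -/
noncomputable def maxBuckets : ℕ := ⌈P.κ / P.ε ^ 2 * Real.log P.N⌉₊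

/-- Maximal size of a bucket: a bucket with `L₂` norm at most `2 L₂(W) ≤ 2 N` has at most `4 N²`
elements. -/
def maxSize : ℕ := 4 * P.N ^ 2

/-- A word of the seed. -/
abbrev Word : Type := Fin (2 ^ (P.hashBits + 1))

/-- Random choices: for each row of CountSketch a pairwise independent cell hash and a pairwise
independent sign hash; for each row and copy of the `L₂` sketch a 4-wise independent sign hash. -/
abbrev Seed : Type :=
  (Fin P.rows → (Fin 2 → P.Word) × (Fin 2 → P.Word)) ×
    (Fin P.rows → Fin P.cols → Fin 4 → P.Word)

end Params

/-! ### CountSketch (Charikar, Chen, Farach-Colton) -/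

/-- The table of counters of CountSketch. -/
abbrev CSTable (P : Params) : Type := Fin P.rows → Fin (2 ^ P.cellBits) → ℤ

/-- The list of candidates, each with its estimated frequency. -/
abbrev Candidates (P : Params) : Type := List (Fin P.u × ℤ)

noncomputable def csCell (P : Params) (ω : P.Seed) (r : Fin P.rows) (q : Fin P.u) :
    Fin (2 ^ P.cellBits) :=
  cellHash P.hashBits P.cellBits (ω.1 r).1 q

noncomputable def csSign (P : Params) (ω : P.Seed) (r : Fin P.rows) (q : Fin P.u) : ℤ :=
  signHash P.hashBits (ω.1 r).2 q

noncomputable def csAdd (P : Params) (ω : P.Seed) (T : CSTable P) (q : Fin P.u) : CSTable P :=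
  fun r c => if c = csCell P ω r q then T r c + csSign P ω r q else T r c

noncomputable def csEstimate (P : Params) (ω : P.Seed) (T : CSTable P) (q : Fin P.u) : ℤ :=
  median fun r => csSign P ω r q * T r (csCell P ω r q)

/-- Update of the candidates on arrival of `q`, whose frequency is currently estimated by `e`: if
`q` is a candidate its count is incremented; otherwise it is added if there is room, or replaces a
candidate of least count if that count is less than `e`. -/
noncomputable def candUpdate (P : Params) (H : Candidates P) (q : Fin P.u) (e : ℤ) :
    Candidates P :=
  if q ∈ H.map Prod.fst then H.map fun p => if p.1 = q then (p.1, p.2 + 1) else p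
  else if H.length < P.listLen then (q, e) :: H
  else match H.argmin Prod.snd with
    | none => H
    | some p => if p.2 < e then (q, e) :: H.erase p else H

/-! ### The `L₂` sketch (Alon, Matias, Szegedy) -/

/-- For every row and copy, the sum of the random signs of the elements. -/
abbrev L2Table (P : Params) : Type := Fin P.rows → Fin P.cols → ℤ

noncomputable def l2Add (P : Params) (ω : P.Seed) (Z : L2Table P) (q : Fin P.u) : L2Table P :=
  fun r c => Z r c + signHash P.hashBits (ω.2 r c) q

/-- Estimation of `L₂` by a single row. -/
noncomputable def l2Row (P : Params) (Z : L2Table P) (r : Fin P.rows) : ℝ :=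
  Real.sqrt (((∑ c, Z r c ^ 2 : ℤ) : ℝ) / P.cols)

/-- Estimation of `L₂`: the median of the rows. -/
noncomputable def l2Estimate (P : Params) (Z : L2Table P) : ℝ :=
  Real.sqrt ((median (fun r => ∑ c, Z r c ^ 2) : ℝ) / P.cols)

/-! ### The smooth histogram -/

/-- A bucket, i.e. a suffix of the stream. Only its size and its sketches are stored. -/
structure Bucket (P : Params) where
  size : ℕ
  cs : CSTable P
  cand : Candidates P
  l2 : L2Table P

/-- The empty bucket. -/
def Bucket.empty (P : Params) : Bucket P := ⟨0, fun _ _ => 0, [], fun _ _ => 0⟩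

/-- A new element is appended to the bucket. -/
noncomputable def Bucket.add {P : Params} (ω : P.Seed) (q : Fin P.u) (A : Bucket P) : Bucket P :=
  { size := A.size + 1
    cs := csAdd P ω A.cs q
    cand := candUpdate P A.cand q (csEstimate P ω (csAdd P ω A.cs q) q)
    l2 := l2Add P ω A.l2 q }

/-- The test `L₂(B) ≥ (1 - β) L₂(A)` of the histogram, decided by majority: each row compares its
own estimates for the two buckets. -/
def Close {P : Params} (A B : Bucket P) : Prop :=
  P.rows < 2 * Nat.card {r : Fin P.rows // (1 - P.β) * l2Row P A.l2 r ≤ l2Row P B.l2 r}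

open Classical in
/-- The part of the list from the last member with property `p` on (the whole list if there is no
such member). -/
noncomputable def skipTo {α : Type*} (p : α → Prop) : List α → List α
  | [] => []
  | y :: l => if ∃ z ∈ l, p z then skipTo p l else y :: l

theorem length_skipTo_le {α : Type*} (p : α → Prop) (l : List α) :
    (skipTo p l).length ≤ l.length := by
  induction l with
  | nil => simp [skipTo]
  | cons y l ih =>
    rw [skipTo]
    split_ifs
    · simp only [List.length_cons]; omega
    · exact le_rfl

/-- For every bucket `A` in turn (the oldest first), the buckets strictly between `A` and the last
bucket that is close to `A` are deleted. -/
noncomputable def prune {P : Params} : List (Bucket P) → List (Bucket P)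
  | [] => []
  | A :: l => A :: prune (skipTo (Close A) l)
termination_by l => l.length
decreasing_by
  have := length_skipTo_le (Close A) l
  simp only [List.length_cons]
  omega

/-- The first bucket is deleted as long as the second one still contains the window. -/
def expire {P : Params} : List (Bucket P) → List (Bucket P)
  | A :: B :: l => if P.N ≤ B.size then expire (B :: l) else A :: B :: l
  | l => l

/-- The buckets `A₁, A₂, …` are listed from the oldest to the newest. A new element is appended to
all of them and starts a new one; then close buckets are merged, expired ones are deleted, and the
oldest ones are dropped if they exceed the maximal size or the maximal number of buckets. -/
noncomputable def histStep (P : Params) (ω : P.Seed) (S : List (Bucket P)) (q : Fin P.u) :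
    List (Bucket P) :=
  let T := (expire (prune ((S ++ [Bucket.empty P]).map (Bucket.add ω q)))).filter
    fun A => A.size ≤ P.maxSize
  T.drop (T.length - P.maxBuckets)

open Classical in
/-- The candidates of the first bucket whose estimated frequency exceeds `γ L̂₂ / (1 + ε)`, where
`L̂₂` is the estimation of the `L₂` norm of the first bucket. -/
noncomputable def freqReport (P : Params) : List (Bucket P) → Finset (Fin P.u)
  | [] => ∅
  | A :: _ =>
    ((A.cand.filter fun p => 1 / (1 + P.ε) * P.γ * l2Estimate P A.l2 < (p.2 : ℝ)).map
      Prod.fst).toFinset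

/-! ### The algorithm as a `StreamAlgorithm` -/

/-- The words of a bucket: size, CountSketch table, candidates, `L₂` table. -/
noncomputable def bucketWords (P : Params) (A : Bucket P) : List ℤ :=
  [(A.size : ℤ)] ++ (arrayWords (arrayWords fun z => [z]) A.cs ++
    (listWords (fun p : Fin P.u × ℤ => [((p.1 : ℕ) : ℤ)] ++ [p.2]) A.cand ++
      arrayWords (arrayWords fun z => [z]) A.l2))

theorem prefixCode_bucket (P : Params) : PrefixCode (bucketWords P) := by
  intro A B s s' e
  obtain ⟨n, T, H, Z⟩ := A
  obtain ⟨n', T', H', Z'⟩ := B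
  have key := (prefixCode_int.prod (((prefixCode_int.array _).array _).prod
    (((prefixCode_fin P.u).prod prefixCode_int).list.prod
      ((prefixCode_int.array P.cols).array P.rows))))
    ((n : ℤ), T, H, Z) ((n' : ℤ), T', H', Z') s s' e
  simpa using key

/-- The words of a seed. -/
noncomputable def seedWords (P : Params) (ω : P.Seed) : List ℤ :=
  arrayWords (fun p : (Fin 2 → P.Word) × (Fin 2 → P.Word) =>
      arrayWords (fun z : P.Word => [((z : ℕ) : ℤ)]) p.1 ++
        arrayWords (fun z : P.Word => [((z : ℕ) : ℤ)]) p.2) ω.1 ++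
    arrayWords (arrayWords (arrayWords fun z : P.Word => [((z : ℕ) : ℤ)])) ω.2

theorem prefixCode_seed (P : Params) : PrefixCode (seedWords P) :=
  ((((prefixCode_fin _).array 2).prod ((prefixCode_fin _).array 2)).array P.rows).prod
    ((((prefixCode_fin _).array 4).array P.cols).array P.rows)

/-- The semi-smooth algorithm for frequent elements. -/
noncomputable def freqAlgorithm (P : Params) : StreamAlgorithm P.u where
  Seed := P.Seed
  seedFintype := inferInstance
  seedNonempty := inferInstance
  State := List (Bucket P)
  init := []
  step := histStep P
  report := fun _ => freqReport P
  seedWords := seedWords P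
  stateWords := listWords (bucketWords P)
  seedWords_injective := (prefixCode_seed P).injective
  stateWords_injective := (prefixCode_bucket P).list.injective

end SlidingWindow

/-!
Write `A` for the oldest bucket, `B` for its successor and `‖·‖` for the `L₂` norm of the frequency
vector. Unless `B` is one element shorter than `A`, the two passed the test at some time `s`.
Frequency vectors are nonnegative, so the part `e` of `A` that precedes `B` satisfies
`‖e‖² ≤ ‖A‖² - ‖B‖² ≤ 4 β ‖A‖²` at time `s`, and `‖e‖² ≤ 4 β ‖A‖²` survives later arrivals, which
only increase `‖A‖`. Since `B` is shorter than the window, the expired part of `A` lies in `e`; with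
`β = ε² / 8` its norm, and therefore each of its frequencies, is at most `3/4 ε ‖A‖`. An additive
error `O(ε) ‖A‖` in a frequency that is compared with `γ ‖A‖` is a relative error `O(ε / γ)`,
whence `c = c₀ / γ`.

Members two apart in the list fail the test, so that `‖·‖²` decreases by a factor `1 - β / 2` every
two buckets, from at most `(4 N² + 1)²` to at least `1`. So there are `O(ε⁻² log N)` buckets, and in
the last `N` steps none is dropped because of their number. Nor is one dropped for its size: if `W`
is the window then `‖A‖ ≤ 2 ‖W‖ ≤ 2 N`, and the size of `A` is at most `‖A‖²`.

Only segments that start `O(N²)` before the query matter, so the union bound for the sketches does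
not depend on the length of the stream. A row of the test compares two nested buckets with the same
signs; the difference of the two squared estimates is an estimate of the inner product
`⟨e, f_A + f_B⟩`, whose error is proportional to `‖e‖ ‖A‖` and not to `‖A‖²`. This is why `O(ε⁻²)`
columns resolve a relative difference of order `β = ε² / 8`.
-/

namespace SlidingWindow

section Probability

open Finset
open scoped BigOperators

variable {Ω Ω' ι : Type*} [Fintype Ω] [Fintype Ω']

open Classical in
/-- Probability of an event under the uniform distribution on a finite type, written as the
expectation of its indicator. -/
noncomputable def pr (p : Ω → Prop) : ℝ := 𝔼 ω, if p ω then (1 : ℝ) else 0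

theorem pr_eq_card_div_card (p : Ω → Prop) :
    pr p = (Nat.card {ω // p ω} : ℝ) / (Nat.card Ω : ℝ) := by
  classical
  rw [pr, Fintype.expect_eq_sum_div_card, Finset.sum_boole, Nat.card_eq_fintype_card,
    Nat.card_eq_fintype_card, Fintype.card_subtype]

theorem pr_nonneg (p : Ω → Prop) : 0 ≤ pr p :=
  Finset.expect_nonneg fun ω _ => by split_ifs <;> norm_num

theorem pr_mono {p q : Ω → Prop} (h : ∀ ω, p ω → q ω) : pr p ≤ pr q := by
  refine Finset.expect_le_expect fun ω _ => ?_
  by_cases hp : p ω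
  · simp [hp, h ω hp]
  · rw [if_neg hp]
    split_ifs <;> norm_num

theorem pr_or_le (p q : Ω → Prop) : pr (fun ω => p ω ∨ q ω) ≤ pr p + pr q := by
  rw [pr, pr, pr, ← Finset.expect_add_distrib]
  refine Finset.expect_le_expect fun ω _ => ?_
  by_cases hp : p ω <;> by_cases hq : q ω <;> simp [hp, hq]

theorem pr_exists_le (s : Finset ι) (p : ι → Ω → Prop) :
    pr (fun ω => ∃ i ∈ s, p i ω) ≤ ∑ i ∈ s, pr (p i) := by
  classical
  induction s using Finset.induction_on with
  | empty => simp [pr]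
  | insert a s ha ih =>
    simp only [Finset.mem_insert, exists_eq_or_imp, Finset.sum_insert ha]
    exact (pr_or_le _ _).trans (by gcongr)

theorem pr_not [Nonempty Ω] (p : Ω → Prop) : pr (fun ω => ¬ p ω) = 1 - pr p := by
  rw [eq_sub_iff_add_eq, pr, pr, ← Finset.expect_add_distrib,
    Finset.expect_congr rfl (g := fun _ => (1 : ℝ)), Fintype.expect_const]
  intro ω _
  by_cases hp : p ω <;> simp [hp]

theorem mul_pr_le_expect {p : Ω → Prop} {f : Ω → ℝ} {t : ℝ} (hf : ∀ ω, 0 ≤ f ω)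
    (h : ∀ ω, p ω → t ≤ f ω) : t * pr p ≤ 𝔼 ω, f ω := by
  rw [pr, Finset.mul_expect]
  refine Finset.expect_le_expect fun ω _ => ?_
  split_ifs with hp
  · simpa using h ω hp
  · simpa using hf ω

theorem expect_comp_fst [Nonempty Ω'] (f : Ω → ℝ) : 𝔼 ω : Ω × Ω', f ω.1 = 𝔼 ω, f ω := by
  rw [← Finset.univ_product_univ, Finset.expect_product]
  exact Finset.expect_congr rfl fun ω _ => Fintype.expect_const (f ω)

theorem expect_comp_snd [Nonempty Ω'] (f : Ω → ℝ) : 𝔼 ω : Ω' × Ω, f ω.2 = 𝔼 ω, f ω := by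
  rw [← Finset.univ_product_univ, Finset.expect_product]
  exact Fintype.expect_const (𝔼 ω, f ω)

theorem pr_comp_fst [Nonempty Ω'] (p : Ω → Prop) : pr (fun ω : Ω × Ω' => p ω.1) = pr p := by
  classical exact expect_comp_fst fun ω => if p ω then (1 : ℝ) else 0

theorem pr_comp_snd [Nonempty Ω'] (p : Ω → Prop) : pr (fun ω : Ω' × Ω => p ω.2) = pr p := by
  classical exact expect_comp_snd fun ω => if p ω then (1 : ℝ) else 0

variable [Fintype ι] [DecidableEq ι]

theorem expect_pi_prod (f : ι → Ω → ℝ) :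
    𝔼 ω : ι → Ω, ∏ i, f i (ω i) = ∏ i, 𝔼 a, f i a := by
  simp only [Fintype.expect_eq_sum_div_card, Finset.prod_div_distrib, Fintype.prod_sum,
    Fintype.card_fun, Finset.prod_const, Finset.card_univ, Nat.cast_pow]

theorem expect_pi_eval [Nonempty Ω] (i : ι) (f : Ω → ℝ) :
    𝔼 ω : ι → Ω, f (ω i) = 𝔼 a, f a := by
  have h := expect_pi_prod fun j => if j = i then f else 1
  rw [Fintype.prod_eq_single i fun j hj => by simp [hj]] at h
  simpa [ite_apply] using h

theorem expect_pi_eval_mul_eval [Nonempty Ω] {i j : ι} (hij : i ≠ j) (f g : Ω → ℝ) :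
    𝔼 ω : ι → Ω, f (ω i) * g (ω j) = (𝔼 a, f a) * 𝔼 a, g a := by
  have h := expect_pi_prod fun k => if k = i then f else if k = j then g else 1
  rw [Fintype.prod_eq_mul i j hij fun k hk => by simp [hk.1, hk.2]] at h
  simp only [if_pos, if_neg hij.symm] at h
  rw [← h]
  refine Finset.expect_congr rfl fun ω _ => ?_
  rw [Fintype.prod_eq_mul i j hij fun k hk => by simp [hk.1, hk.2]]
  simp only [if_pos, if_neg hij.symm]

theorem expect_sq_sum_pi_eval [Nonempty Ω] (f : ι → Ω → ℝ) (h0 : ∀ i, 𝔼 a, f i a = 0) :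
    𝔼 ω : ι → Ω, (∑ i, f i (ω i)) ^ 2 = ∑ i, 𝔼 a, f i a ^ 2 := by
  simp only [sq, Finset.sum_mul_sum, Finset.expect_sum_comm]
  refine Finset.sum_congr rfl fun i _ => ?_
  rw [Finset.sum_eq_single i _ (by simp), expect_pi_eval i fun a => f i a * f i a]
  intro j _ hj
  rw [expect_pi_eval_mul_eval hj.symm, h0, zero_mul]

theorem expect_sub_expect_sq_le [Nonempty Ω] (f : Ω → ℝ) :
    𝔼 ω, (f ω - 𝔼 a, f a) ^ 2 ≤ 𝔼 ω, f ω ^ 2 := by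
  have h : 𝔼 ω, (f ω - 𝔼 a, f a) ^ 2 = 𝔼 ω, f ω ^ 2 - (𝔼 a, f a) ^ 2 := by
    simp only [sub_sq, Finset.expect_add_distrib, Finset.expect_sub_distrib,
      Fintype.expect_const, mul_assoc, ← Finset.mul_expect, ← Finset.expect_mul]
    ring
  linarith [sq_nonneg (𝔼 a, f a)]

theorem sq_mul_pr_lt_abs_sum_sub_le [Nonempty Ω] (f : ι → Ω → ℝ) {t : ℝ} (ht : 0 ≤ t) :
    t ^ 2 * pr (fun ω : ι → Ω => t < |∑ i, f i (ω i) - ∑ i, 𝔼 a, f i a|) ≤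
      ∑ i, 𝔼 a, f i a ^ 2 := by
  calc t ^ 2 * pr (fun ω : ι → Ω => t < |∑ i, f i (ω i) - ∑ i, 𝔼 a, f i a|)
      ≤ 𝔼 ω : ι → Ω, (∑ i, (f i (ω i) - 𝔼 a, f i a)) ^ 2 := by
        refine mul_pr_le_expect (fun _ => sq_nonneg _) fun ω hω => ?_
        rw [Finset.sum_sub_distrib, ← sq_abs (_ - _)]
        gcongr
    _ = ∑ i, 𝔼 a, (f i a - 𝔼 b, f i b) ^ 2 :=
        expect_sq_sum_pi_eval (fun i a => f i a - 𝔼 b, f i b) fun i => by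
          rw [Finset.expect_sub_distrib, Fintype.expect_const, sub_self]
    _ ≤ ∑ i, 𝔼 a, f i a ^ 2 := Finset.sum_le_sum fun i _ => expect_sub_expect_sq_le (f i)

/-- Chernoff's method: the expectation of `c ^ (2 * #bad) = ∏ i, (1 + (c ^ 2 - 1) * 𝟙[i is bad])`
factors over the coordinates. -/
theorem pow_mul_pr_majority_le [Nonempty Ω] (bad : Ω → Prop) {c : ℝ} (hc : 1 ≤ c) :
    c ^ Fintype.card ι *
        pr (fun ω : ι → Ω => Fintype.card ι ≤ 2 * Nat.card {i // bad (ω i)}) ≤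
      (1 + (c ^ 2 - 1) * pr bad) ^ Fintype.card ι := by
  classical
  set weight : Ω → ℝ := fun a => 1 + (c ^ 2 - 1) * if bad a then 1 else 0
  have prod_weight (ω : ι → Ω) : ∏ i, weight (ω i) = c ^ (2 * Nat.card {i // bad (ω i)}) := by
    rw [Nat.card_eq_fintype_card, Fintype.card_subtype, pow_mul, ← Finset.prod_const,
      Finset.prod_filter]
    refine Finset.prod_congr rfl fun i _ => ?_
    simp only [weight]
    split_ifs <;> ring
  have expect_weight : 𝔼 a, weight a = 1 + (c ^ 2 - 1) * pr bad := by
    simp only [weight, Finset.expect_add_distrib, Fintype.expect_const, ← Finset.mul_expect]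
    congr
  calc _ ≤ 𝔼 ω : ι → Ω, ∏ i, weight (ω i) := by
        refine mul_pr_le_expect (fun ω => ?_) fun ω hω => ?_
        · rw [prod_weight]; positivity
        · rw [prod_weight]; gcongr
    _ = _ := by
        rw [expect_pi_prod fun _ => weight, Finset.prod_const, expect_weight, Finset.card_univ]

theorem pr_majority_le [Nonempty Ω] {bad : Ω → Prop} (h : pr bad ≤ 1 / 15) :
    pr (fun ω : ι → Ω => Fintype.card ι ≤ 2 * Nat.card {i // bad (ω i)}) ≤
      (1 / 2) ^ Fintype.card ι := by
  have chernoff := pow_mul_pr_majority_le (ι := ι) bad (c := 4) (by norm_num)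
  have hbad : (1 + (4 ^ 2 - 1) * pr bad) ^ Fintype.card ι ≤ 2 ^ Fintype.card ι := by
    have := pr_nonneg bad
    gcongr
    linarith
  have h4 : (4 : ℝ) ^ Fintype.card ι = 2 ^ Fintype.card ι * 2 ^ Fintype.card ι := by
    rw [← mul_pow]; norm_num
  rw [one_div, inv_pow, ← one_div, le_div_iff₀ (by positivity), mul_comm]
  refine le_of_mul_le_mul_left ?_ (by positivity : (0 : ℝ) < 2 ^ Fintype.card ι)
  rw [← mul_assoc, ← h4, mul_one]
  exact chernoff.trans hbad

end Probability

section Hash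

open Finset
open scoped BigOperators

theorem expect_comp_of_surjective {V W : Type*} [AddGroup V] [AddGroup W] [Fintype V] [Fintype W]
    (φ : V →+ W) (hφ : Function.Surjective φ) (H : W → ℝ) :
    𝔼 v, H (φ v) = 𝔼 w, H w := by
  classical
  have card_fiber (w : W) : #{v | φ v = w} = #{v | φ v = 0} :=
    AddMonoidHom.card_fiber_eq_of_mem_range φ (hφ w) (hφ 0)
  have sum_comp (F : W → ℝ) : ∑ v, F (φ v) = #{v | φ v = 0} * ∑ w, F w := by
    rw [Finset.sum_comp, Finset.image_univ_of_surjective hφ, Finset.mul_sum]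
    exact Finset.sum_congr rfl fun w _ => by rw [card_fiber w, nsmul_eq_mul]
  have card_eq : (Fintype.card V : ℝ) = #{v | φ v = 0} * Fintype.card W := by
    simpa using sum_comp fun _ => 1
  have card_ker_ne_zero : (#{v | φ v = 0} : ℝ) ≠ 0 :=
    Nat.cast_ne_zero.2 (Finset.card_pos.2 ⟨0, by simp⟩).ne'
  rw [Fintype.expect_eq_sum_div_card, Fintype.expect_eq_sum_div_card, sum_comp, card_eq,
    mul_div_mul_left _ _ card_ker_ne_zero]

theorem expect_comp_equiv {V W : Type*} [Fintype V] [Fintype W] (e : V ≃ W) (H : W → ℝ) :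
    𝔼 v, H (e v) = 𝔼 w, H w :=
  Fintype.expect_equiv e _ _ fun _ => rfl

variable {ι : Type*}

/-- Evaluation at the points `x` of the polynomials with `d` coefficients. -/
def polyEval {F : Type*} [Field F] (d : ℕ) (x : ι → F) : (Fin d → F) →+ (ι → F) where
  toFun a k := ∑ j, a j * x k ^ (j : ℕ)
  map_zero' := by ext; simp
  map_add' a b := by ext; simp [add_mul, Finset.sum_add_distrib]

variable [Fintype ι]

theorem polyEval_surjective {F : Type*} [Field F] {d : ℕ} (hd : Fintype.card ι ≤ d) {x : ι → F}
    (hx : Function.Injective x) : Function.Surjective (polyEval d x) := by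
  classical
  intro y
  have hdeg : Lagrange.interpolate Finset.univ x y ∈ Polynomial.degreeLT F d :=
    Polynomial.mem_degreeLT.2 <|
      (Lagrange.degree_interpolate_lt y hx.injOn).trans_le (by exact_mod_cast hd)
  refine ⟨Polynomial.degreeLTEquiv F d ⟨_, hdeg⟩, funext fun k => ?_⟩
  rw [← Lagrange.eval_interpolate_at_node y hx.injOn (Finset.mem_univ k),
    Polynomial.eval_eq_sum_degreeLTEquiv hdeg]
  rfl

variable [DecidableEq ι] {m d : ℕ} {x : ι → ℕ}

theorem expect_polyHash (hd : Fintype.card ι ≤ d) (hx : Function.Injective x)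
    (hlt : ∀ k, x k < 2 ^ (m + 1)) (G : (ι → Fin (2 ^ (m + 1))) → ℝ) :
    𝔼 a : Fin d → Fin (2 ^ (m + 1)), G (fun k => Fin.ofNat _ (polyHash m a (x k))) =
      𝔼 y, G y := by
  let point (k : ι) : GaloisField 2 (m + 1) :=
    (fieldEquiv m).symm (Fin.ofNat (2 ^ (m + 1)) (x k))
  have point_injective : Function.Injective point := by
    intro k l h
    have h := Fin.ext_iff.1 ((fieldEquiv m).symm.injective h)
    simp only [Fin.ofNat, Nat.mod_eq_of_lt (hlt _)] at h
    exact hx h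
  have : Fintype (GaloisField 2 (m + 1)) := Fintype.ofFinite _
  let H (y : ι → GaloisField 2 (m + 1)) : ℝ := G fun k => fieldEquiv m (y k)
  calc 𝔼 a : Fin d → Fin (2 ^ (m + 1)), G (fun k => Fin.ofNat _ (polyHash m a (x k)))
      = 𝔼 a : Fin d → Fin (2 ^ (m + 1)), H (polyEval d point fun j => (fieldEquiv m).symm (a j)) :=
        Finset.expect_congr rfl fun a _ => by
          simp only [H, polyHash, Fin.ofNat, Nat.mod_eq_of_lt (Fin.is_lt _)]
          rfl
    _ = 𝔼 b, H (polyEval d point b) :=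
        expect_comp_equiv (Equiv.arrowCongr (Equiv.refl _) (fieldEquiv m).symm) fun b =>
          H (polyEval d point b)
    _ = 𝔼 y, H y := expect_comp_of_surjective _ (polyEval_surjective hd point_injective) H
    _ = 𝔼 y, G y := expect_comp_equiv (Equiv.arrowCongr (Equiv.refl _) (fieldEquiv m)) G

/-- Reduction modulo a divisor `k` of `n`; being a homomorphism, it preserves uniformity. -/
def finReduce {n k : ℕ} [NeZero n] [NeZero k] (h : k ∣ n) : Fin n →+ Fin k where
  toFun y := Fin.ofNat k y
  map_zero' := by simp
  map_add' y z := by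
    ext
    simp [Fin.val_add, Nat.mod_mod_of_dvd _ h]

theorem expect_cellHash {e : ℕ} (he : e ≤ m + 1) (hd : Fintype.card ι ≤ d)
    (hx : Function.Injective x) (hlt : ∀ k, x k < 2 ^ (m + 1)) (G : (ι → Fin (2 ^ e)) → ℝ) :
    𝔼 a : Fin d → Fin (2 ^ (m + 1)), G (fun k => cellHash m e a (x k)) = 𝔼 c, G c := by
  let φ : (ι → Fin (2 ^ (m + 1))) →+ (ι → Fin (2 ^ e)) :=
    (finReduce (pow_dvd_pow 2 he)).compLeft ι
  have φ_surjective : Function.Surjective φ := fun c =>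
    ⟨fun k => Fin.ofNat _ (c k : ℕ), funext fun k => Fin.ext (by
      simp [φ, finReduce, Nat.mod_mod_of_dvd _ (pow_dvd_pow 2 he), Nat.mod_eq_of_lt])⟩
  rw [← expect_comp_of_surjective φ φ_surjective,
    ← expect_polyHash hd hx hlt fun y => G (φ y)]
  refine Finset.expect_congr rfl fun a _ => congrArg G (funext fun k => Fin.ext ?_)
  simp [φ, finReduce, cellHash, Nat.mod_mod_of_dvd _ (pow_dvd_pow 2 he)]

theorem pr_cellHash_eq_cellHash {e : ℕ} (he : e ≤ m + 1) (hd : 2 ≤ d) {i j : ℕ} (hij : i ≠ j)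
    (hi : i < 2 ^ (m + 1)) (hj : j < 2 ^ (m + 1)) :
    pr (fun a : Fin d → Fin (2 ^ (m + 1)) => cellHash m e a i = cellHash m e a j) =
      1 / 2 ^ e := by
  have h := expect_cellHash (x := ![i, j]) he (by simpa using hd)
    (by intro k l; fin_cases k <;> fin_cases l <;> simp [hij, hij.symm])
    (by intro k; fin_cases k <;> simp [hi, hj])
    (fun c => if c 0 = c 1 then (1 : ℝ) else 0)
  rw [← expect_comp_equiv (finTwoArrowEquiv (Fin (2 ^ e))).symm, ← Finset.univ_product_univ,
    Finset.expect_product] at h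
  convert h using 1
  · exact Finset.expect_congr rfl fun a _ => by congr
  · simp

theorem signHash_eq_ite (a : Fin d → Fin (2 ^ (m + 1))) (i : ℕ) :
    signHash m a i = if cellHash m 1 a i = 0 then 1 else -1 :=
  if_congr (by simp [cellHash, Fin.ext_iff]) rfl rfl

end Hash

section RandomSigns

open Finset
open scoped BigOperators symmDiff Matrix

variable {Ω ι : Type*} [Fintype Ω]

/-- Random signs `s ω i ∈ {1, -1}`, at most `k` distinct of which always have a product of mean
zero. This is the consequence of `k`-wise independence on which the moments of the sketches
depend. -/
structure UncorrelatedSigns (k : ℕ) (s : Ω → ι → ℝ) : Prop where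
  mul_self : ∀ ω i, s ω i * s ω i = 1
  expect_prod : ∀ T : Finset ι, T.Nonempty → #T ≤ k → 𝔼 ω, ∏ i ∈ T, s ω i = 0

namespace UncorrelatedSigns

variable {k : ℕ} {s : Ω → ι → ℝ}

theorem prod_mul_prod [DecidableEq ι] (hs : UncorrelatedSigns k s) (ω : Ω) (S T : Finset ι) :
    (∏ i ∈ S, s ω i) * ∏ i ∈ T, s ω i = ∏ i ∈ S ∆ T, s ω i := by
  have inter : (∏ i ∈ S ∩ T, s ω i) * ∏ i ∈ S ∩ T, s ω i = 1 := by
    rw [← Finset.prod_mul_distrib]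
    exact Finset.prod_eq_one fun i _ => hs.mul_self ω i
  have union : (∏ i ∈ S ∆ T, s ω i) * ∏ i ∈ S ∩ T, s ω i = ∏ i ∈ S ∪ T, s ω i := by
    rw [← Finset.prod_union (s₁ := S ∆ T) (s₂ := S ∩ T) (disjoint_symmDiff_inf S T)]
    exact congrArg (fun U => ∏ i ∈ U, s ω i) (symmDiff_sup_inf S T)
  rw [← Finset.prod_union_inter, ← union, mul_assoc, inter, mul_one]

variable [Nonempty Ω]

theorem expect_prod_mul_prod [DecidableEq ι] (hs : UncorrelatedSigns k s) {S T : Finset ι}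
    (h : #(S ∆ T) ≤ k) :
    𝔼 ω, (∏ i ∈ S, s ω i) * ∏ i ∈ T, s ω i = if S = T then 1 else 0 := by
  simp only [hs.prod_mul_prod]
  split_ifs with hST
  · subst hST
    simp
  · exact hs.expect_prod _ (Finset.symmDiff_nonempty.2 hST) h

theorem expect_mul [DecidableEq ι] (hs : UncorrelatedSigns k s) (hk : 2 ≤ k) (i j : ι) :
    𝔼 ω, s ω i * s ω j = if i = j then 1 else 0 := by
  have hcard : #({i} ∆ {j} : Finset ι) ≤ k := by
    refine (Finset.card_le_card symmDiff_le_sup).trans ((Finset.card_union_le _ _).trans ?_)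
    simpa using hk
  simpa using hs.expect_prod_mul_prod hcard

theorem expect_mul_four [DecidableEq ι] (hs : UncorrelatedSigns k s) (hk : 4 ≤ k) (i j p q : ι) :
    𝔼 ω, s ω i * s ω j * (s ω p * s ω q) =
      (if i = j then if p = q then 1 else 0 else 0) +
        (if i = p then if j = q then 1 else 0 else 0) +
        (if i = q then if j = p then 1 else 0 else 0) -
        2 * (if i = j then if j = p then if p = q then 1 else 0 else 0 else 0) := by
  have pair (ω : Ω) (a b : ι) : s ω a * s ω b = ∏ c ∈ {a} ∆ {b}, s ω c := by
    simpa using hs.prod_mul_prod ω {a} {b}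
  have card_pair (a b : ι) : #({a} ∆ {b} : Finset ι) ≤ 2 :=
    (Finset.card_le_card symmDiff_le_sup).trans ((Finset.card_union_le _ _).trans (by simp))
  have hcard : #(({i} ∆ {j}) ∆ ({p} ∆ {q}) : Finset ι) ≤ k :=
    (Finset.card_le_card symmDiff_le_sup).trans <| (Finset.card_union_le _ _).trans <|
      (add_le_add (card_pair i j) (card_pair p q)).trans hk
  have pair_eq_pair : ({i} ∆ {j} : Finset ι) = {p} ∆ {q} ↔
      i = j ∧ p = q ∨ i = p ∧ j = q ∨ i = q ∧ j = p := by
    simp only [Finset.ext_iff, Finset.mem_symmDiff, Finset.mem_singleton]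
    refine ⟨fun h => ?_, by grind⟩
    have := h i
    have := h j
    have := h p
    grind
  simp only [pair, hs.expect_prod_mul_prod hcard, pair_eq_pair]
  grind

variable [Fintype ι]

theorem expect_dotProduct_mul_dotProduct (hs : UncorrelatedSigns k s) (hk : 2 ≤ k)
    (f g : ι → ℝ) : 𝔼 ω, (f ⬝ᵥ s ω) * (g ⬝ᵥ s ω) = f ⬝ᵥ g := by
  classical
  have expand (ω : Ω) : (f ⬝ᵥ s ω) * (g ⬝ᵥ s ω) =
      ∑ i, ∑ j, f i * g j * (s ω i * s ω j) := by
    simp only [dotProduct, Finset.sum_mul_sum]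
    exact Finset.sum_congr rfl fun i _ => Finset.sum_congr rfl fun j _ => by ring
  simp only [expand, Finset.expect_sum_comm, ← Finset.mul_expect, hs.expect_mul hk, mul_ite,
    mul_one, mul_zero, Finset.sum_ite_eq, Finset.mem_univ, if_true]
  rfl

theorem expect_sq_dotProduct_mul_dotProduct (hs : UncorrelatedSigns k s) (hk : 4 ≤ k)
    (f g : ι → ℝ) :
    𝔼 ω, ((f ⬝ᵥ s ω) * (g ⬝ᵥ s ω)) ^ 2 =
      (f ⬝ᵥ f) * (g ⬝ᵥ g) + 2 * (f ⬝ᵥ g) ^ 2 - 2 * ∑ i, (f i * g i) ^ 2 := by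
  classical
  have expand (ω : Ω) : ((f ⬝ᵥ s ω) * (g ⬝ᵥ s ω)) ^ 2 =
      ∑ i, ∑ j, ∑ p, ∑ q, f i * f j * (g p * g q) * (s ω i * s ω j * (s ω p * s ω q)) := by
    rw [mul_pow, sq, sq, dotProduct, dotProduct, Finset.sum_mul_sum, Finset.sum_mul_sum]
    simp only [Finset.sum_mul]
    simp only [Finset.mul_sum]
    refine Finset.sum_congr rfl fun i _ => Finset.sum_congr rfl fun j _ =>
      Finset.sum_congr rfl fun p _ => Finset.sum_congr rfl fun q _ => by ring
  simp only [expand, Finset.expect_sum_comm, ← Finset.mul_expect, hs.expect_mul_four hk, mul_add,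
    mul_sub, Finset.sum_add_distrib, Finset.sum_sub_distrib]
  simp only [mul_ite, mul_zero, mul_one, Finset.sum_ite_irrel, Finset.sum_const_zero,
    Finset.sum_ite_eq, Finset.mem_univ, if_true]
  have h₁ : ∑ i, ∑ p, f i * f i * (g p * g p) = (f ⬝ᵥ f) * (g ⬝ᵥ g) := by
    rw [dotProduct, dotProduct, Finset.sum_mul_sum]
  have h₂ : ∑ i, ∑ j, f i * f j * (g i * g j) = (f ⬝ᵥ g) ^ 2 := by
    rw [dotProduct, sq, Finset.sum_mul_sum]
    exact Finset.sum_congr rfl fun i _ => Finset.sum_congr rfl fun j _ => by ring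
  have h₃ : ∑ i, ∑ j, f i * f j * (g j * g i) = (f ⬝ᵥ g) ^ 2 := by
    rw [← h₂]
    exact Finset.sum_congr rfl fun i _ => Finset.sum_congr rfl fun j _ => by ring
  have h₄ : ∑ i, f i * f i * (g i * g i) * 2 = 2 * ∑ i, (f i * g i) ^ 2 := by
    rw [Finset.mul_sum]
    exact Finset.sum_congr rfl fun i _ => by ring
  rw [h₁, h₂, h₃, h₄]
  ring

theorem expect_sq_dotProduct_mul_dotProduct_le (hs : UncorrelatedSigns k s) (hk : 4 ≤ k)
    (f g : ι → ℝ) :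
    𝔼 ω, ((f ⬝ᵥ s ω) * (g ⬝ᵥ s ω)) ^ 2 ≤ 3 * ((f ⬝ᵥ f) * (g ⬝ᵥ g)) := by
  have cauchy_schwarz : (f ⬝ᵥ g) ^ 2 ≤ (f ⬝ᵥ f) * (g ⬝ᵥ g) := by
    simpa only [dotProduct, sq] using Finset.sum_mul_sq_le_sq_mul_sq Finset.univ f g
  have : 0 ≤ ∑ i, (f i * g i) ^ 2 := Finset.sum_nonneg fun _ _ => sq_nonneg _
  rw [hs.expect_sq_dotProduct_mul_dotProduct hk]
  linarith

end UncorrelatedSigns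

section HashSign

variable {u m d : ℕ}

/-- The signs given to the elements of the universe by the hash function `signHash`. -/
noncomputable def hashSign (m : ℕ) (a : Fin d → Fin (2 ^ (m + 1))) (i : Fin u) : ℝ :=
  signHash m a i

theorem uncorrelatedSigns_hashSign (hu : u ≤ 2 ^ (m + 1)) :
    UncorrelatedSigns d (hashSign (u := u) (d := d) m) where
  mul_self a i := by
    rw [hashSign, signHash]
    split_ifs <;> norm_num
  expect_prod T hT hTd := by
    let sign (c : Fin (2 ^ 1)) : ℝ := if c = 0 then 1 else -1
    have expect_sign : 𝔼 c, sign c = 0 := by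
      rw [Fintype.expect_eq_sum_div_card, show ∑ c, sign c = sign 0 + sign 1 from
        Fin.sum_univ_two sign]
      simp [sign]
    have hashSign_eq (a : Fin d → Fin (2 ^ (m + 1))) (i : Fin u) :
        hashSign m a i = sign (cellHash m 1 a i) := by
      rw [hashSign, signHash_eq_ite]
      simp only [sign]
      split_ifs <;> simp
    calc 𝔼 a : Fin d → Fin (2 ^ (m + 1)), ∏ i ∈ T, hashSign m a i
        = 𝔼 a : Fin d → Fin (2 ^ (m + 1)), ∏ i : T, sign (cellHash m 1 a (i : Fin u)) :=
          Finset.expect_congr rfl fun a _ => by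
            simp only [hashSign_eq]
            exact (Finset.prod_coe_sort T fun i => sign (cellHash m 1 a i)).symm
      _ = 𝔼 c : T → Fin (2 ^ 1), ∏ i, sign (c i) :=
          expect_cellHash (x := fun i : T => ((i : Fin u) : ℕ)) (by omega) (by simpa using hTd)
            (Fin.val_injective.comp Subtype.val_injective)
            (fun i => (i : Fin u).is_lt.trans_le hu) fun c => ∏ i, sign (c i)
      _ = ∏ _i : T, 𝔼 c, sign c := expect_pi_prod fun _ => sign
      _ = 0 := by
          rw [Finset.prod_const, expect_sign, zero_pow]
          simpa using hT.ne_empty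

end HashSign

section CountSketchRow

variable {Ω' β : Type*} [Fintype Ω'] [Nonempty Ω] [Fintype ι] [DecidableEq β] {k : ℕ}

/-- Estimate of `f q` by a row of CountSketch with cell hash `h` and signs `s`: the counter of the
cell of `q` is the signed sum of the frequencies of the elements of that cell. -/
def rowEstimate (h : ι → β) (s f : ι → ℝ) (q : ι) : ℝ :=
  s q * ((fun j => if h j = h q then f j else 0) ⬝ᵥ s)

theorem sq_rowEstimate_sub [DecidableEq ι] (h : ι → β) {s : ι → ℝ} (hs : ∀ i, s i * s i = 1)
    (f : ι → ℝ) (q : ι) :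
    (rowEstimate h s f q - f q) ^ 2 =
      ((fun j => if j ≠ q ∧ h j = h q then f j else 0) ⬝ᵥ s) ^ 2 := by
  have split : (fun j => if h j = h q then f j else 0) ⬝ᵥ s =
      (fun j => if j ≠ q ∧ h j = h q then f j else 0) ⬝ᵥ s + f q * s q := by
    rw [← single_dotProduct, ← add_dotProduct]
    congr 1
    ext j
    by_cases hj : j = q
    · subst hj
      simp
    · simp [hj]
  rw [rowEstimate, split]
  linear_combination ((fun j => if j ≠ q ∧ h j = h q then f j else 0) ⬝ᵥ s) ^ 2 * hs q +
    (2 * f q * s q * ((fun j => if j ≠ q ∧ h j = h q then f j else 0) ⬝ᵥ s) +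
      f q ^ 2 * (s q * s q - 1)) * hs q

theorem expect_sq_rowEstimate_sub_le {h : Ω' → ι → β} {s : Ω → ι → ℝ}
    (hs : UncorrelatedSigns k s) (hk : 2 ≤ k) {q : ι} {p : ℝ} (hp : 0 ≤ p)
    (hcoll : ∀ j, j ≠ q → pr (fun ω => h ω j = h ω q) ≤ p) (f : ι → ℝ) :
    𝔼 ω : Ω' × Ω, (rowEstimate (h ω.1) (s ω.2) f q - f q) ^ 2 ≤ p * (f ⬝ᵥ f) := by
  classical
  calc 𝔼 ω : Ω' × Ω, (rowEstimate (h ω.1) (s ω.2) f q - f q) ^ 2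
      = 𝔼 ω', ∑ j, (if j ≠ q ∧ h ω' j = h ω' q then f j else 0) ^ 2 := by
        rw [← Finset.univ_product_univ, Finset.expect_product]
        refine Finset.expect_congr rfl fun ω' _ => ?_
        simp only [sq_rowEstimate_sub _ (hs.mul_self _)]
        simp only [sq]
        exact hs.expect_dotProduct_mul_dotProduct hk _ _
    _ = ∑ j, 𝔼 ω', (if j ≠ q ∧ h ω' j = h ω' q then f j else 0) ^ 2 :=
        Finset.expect_sum_comm ..
    _ ≤ ∑ j, p * (f j * f j) := Finset.sum_le_sum fun j _ => ?_
    _ = p * (f ⬝ᵥ f) := by rw [dotProduct, Finset.mul_sum]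
  by_cases hj : j = q
  · have : 0 ≤ p * (f j * f j) := mul_nonneg hp (mul_self_nonneg _)
    simpa [hj] using this
  · calc 𝔼 ω', (if j ≠ q ∧ h ω' j = h ω' q then f j else 0) ^ 2
        = pr (fun ω' => h ω' j = h ω' q) * (f j * f j) := by
          rw [pr, Finset.expect_mul]
          exact Finset.expect_congr rfl fun ω' _ => by simp [hj, sq]
      _ ≤ p * (f j * f j) := by
          gcongr
          · exact mul_self_nonneg _
          · exact hcoll j hj

end CountSketchRow

end RandomSigns

section Median

theorem insertionSort_ofFn {r : ℕ} (f : Fin r → ℤ) :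
    (List.ofFn f).insertionSort (· ≤ ·) = List.ofFn (f ∘ Tuple.sort f) :=
  ((List.perm_insertionSort _ _).trans ((Tuple.sort f).ofFn_comp_perm f).symm).eq_of_sortedLE
    (List.sortedLE_insertionSort) (Tuple.monotone_sort f).sortedLE_ofFn

theorem median_eq_apply_sort {r : ℕ} (f : Fin r → ℤ) (hr : 0 < r) :
    median f = f (Tuple.sort f ⟨r / 2, by omega⟩) := by
  rw [median, insertionSort_ofFn, List.getD_eq_getElem _ _ (by simp; omega), List.getElem_ofFn]
  rfl

theorem median_mem_of_ordConnected {r : ℕ} (f : Fin r → ℤ) {s : Set ℤ} (hs : s.OrdConnected)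
    (h : 2 * Nat.card {i // f i ∉ s} < r) : median f ∈ s := by
  classical
  let g := f ∘ Tuple.sort f
  have g_mono : Monotone g := Tuple.monotone_sort f
  let k : Fin r := ⟨r / 2, by omega⟩
  have card_notMem : Nat.card {i // f i ∉ s} = (Finset.univ.filter fun i => g i ∉ s).card := by
    rw [← Fintype.card_subtype, ← Nat.card_eq_fintype_card]
    exact (Nat.card_congr ((Tuple.sort f).subtypeEquiv fun i => Iff.rfl)).symm
  rw [median_eq_apply_sort f (by omega)]
  by_contra hk
  -- All values on one side of the middle position are outside of `s`.
  have one_side : (∀ i ≤ k, g i ∉ s) ∨ ∀ j ≥ k, g j ∉ s := by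
    by_contra! hcon
    obtain ⟨⟨i, hik, hi⟩, j, hkj, hj⟩ := hcon
    exact hk (hs.out hi hj ⟨g_mono hik, g_mono hkj⟩)
  rcases one_side with hside | hside
  · have := Finset.card_le_card (s := Finset.Iic k) (t := Finset.univ.filter fun i => g i ∉ s)
      fun i hi => by simpa using hside i (Finset.mem_Iic.1 hi)
    rw [Fin.card_Iic] at this
    simp only [k] at this
    omega
  · have := Finset.card_le_card (s := Finset.Ici k) (t := Finset.univ.filter fun i => g i ∉ s)
      fun i hi => by simpa using hside i (Finset.mem_Ici.1 hi)
    rw [Fin.card_Ici] at this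
    simp only [k] at this
    omega

theorem abs_median_le {r : ℕ} (f : Fin r → ℤ) {B : ℤ} (hB : 0 ≤ B) (h : ∀ i, |f i| ≤ B) :
    |median f| ≤ B := by
  rcases Nat.eq_zero_or_pos r with rfl | hr
  · simpa [median] using hB
  · rw [median_eq_apply_sort f hr]
    exact h _

end Median

section Segments

open scoped Matrix

variable {u : ℕ} (x : ℕ → Fin u) {a b t : ℕ}

theorem freq_succ (h : a ≤ t) : freq x a (t + 1) = freq x a t + Pi.single (x t) 1 := by
  ext i
  rw [freq, ← Finset.insert_Ico_right_eq_Ico_add_one h, Finset.filter_insert]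
  by_cases hi : x t = i
  · rw [if_pos hi, Finset.card_insert_of_notMem (by simp), ← hi, Pi.add_apply, Pi.single_eq_same]
    rfl
  · rw [if_neg hi, Pi.add_apply, Pi.single_eq_of_ne (Ne.symm hi)]
    rfl

theorem freq_self (a : ℕ) : freq x a a = 0 := by
  ext i
  simp [freq]

theorem freq_add (hab : a ≤ b) (hbt : b ≤ t) (i : Fin u) :
    freq x a t i = freq x a b i + freq x b t i := by
  rw [freq, freq, freq, ← Finset.Ico_union_Ico_eq_Ico hab hbt, Finset.filter_union,
    Finset.card_union_of_disjoint]
  exact Finset.disjoint_filter_filter (Finset.Ico_disjoint_Ico_consecutive a b t)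

theorem sum_freq (a t : ℕ) : ∑ i, freq x a t i = t - a := by
  have := Finset.card_eq_sum_card_fiberwise (f := x) (s := Finset.Ico a t) (t := Finset.univ)
    (fun _ _ => Finset.mem_univ _)
  rw [Nat.card_Ico] at this
  exact this.symm

/-- The frequency vector of the segment `[a, t)` of a stream. -/
def freqVec (a t : ℕ) (i : Fin u) : ℝ := freq x a t i

/-- The second frequency moment `L₂²` of the segment `[a, t)` of a stream. -/
def segF2 (a t : ℕ) : ℝ := freqVec x a t ⬝ᵥ freqVec x a t

theorem freqVec_nonneg (a t : ℕ) : 0 ≤ freqVec x a t := fun _ => Nat.cast_nonneg _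

theorem freqVec_succ (h : a ≤ t) :
    freqVec x a (t + 1) = freqVec x a t + Pi.single (x t) 1 := by
  ext i
  simp [freqVec, freq_succ x h, Pi.single_apply, apply_ite Nat.cast]

theorem freqVec_self (a : ℕ) : freqVec x a a = 0 := by
  ext i
  simp [freqVec, freq_self]

theorem freqVec_add (hab : a ≤ b) (hbt : b ≤ t) :
    freqVec x a t = freqVec x a b + freqVec x b t := by
  ext i
  simp [freqVec, freq_add x hab hbt]

theorem segF2_nonneg (a t : ℕ) : 0 ≤ segF2 x a t :=
  dotProduct_nonneg_of_nonneg (freqVec_nonneg x a t) (freqVec_nonneg x a t)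

theorem length_le_segF2 (a t : ℕ) : ((t - a : ℕ) : ℝ) ≤ segF2 x a t := by
  rw [← sum_freq x, Nat.cast_sum]
  refine Finset.sum_le_sum fun i _ => ?_
  rw [freqVec]
  exact_mod_cast Nat.le_mul_self (freq x a t i)

theorem segF2_pos (h : a < t) : 0 < segF2 x a t := by
  refine lt_of_lt_of_le ?_ (length_le_segF2 x a t)
  exact_mod_cast Nat.sub_pos_of_lt h

theorem segF2_le_length_sq (a t : ℕ) : segF2 x a t ≤ ((t - a : ℕ) : ℝ) ^ 2 := by
  have length_eq : ((t - a : ℕ) : ℝ) = ∑ i, freqVec x a t i := by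
    rw [← sum_freq x, Nat.cast_sum]
    rfl
  rw [length_eq]
  simpa only [segF2, dotProduct, sq] using
    Finset.sum_sq_le_sq_sum_of_nonneg fun i (_ : i ∈ Finset.univ) => freqVec_nonneg x a t i

theorem segF2_add (hab : a ≤ b) (hbt : b ≤ t) :
    segF2 x a t = segF2 x a b + segF2 x b t + 2 * (freqVec x a b ⬝ᵥ freqVec x b t) := by
  simp only [segF2, freqVec_add x hab hbt, add_dotProduct, dotProduct_add]
  rw [dotProduct_comm (freqVec x b t) (freqVec x a b)]
  ring

theorem segF2_add_le (hab : a ≤ b) (hbt : b ≤ t) :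
    segF2 x a b + segF2 x b t ≤ segF2 x a t := by
  have : 0 ≤ freqVec x a b ⬝ᵥ freqVec x b t :=
    dotProduct_nonneg_of_nonneg (freqVec_nonneg x a b) (freqVec_nonneg x b t)
  linarith [segF2_add x hab hbt]

theorem segF2_mono_right (hab : a ≤ b) (hbt : b ≤ t) : segF2 x a b ≤ segF2 x a t := by
  linarith [segF2_add_le x hab hbt, segF2_nonneg x b t]

theorem segF2_mono_left (hab : a ≤ b) (hbt : b ≤ t) : segF2 x b t ≤ segF2 x a t := by
  linarith [segF2_add_le x hab hbt, segF2_nonneg x a b]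

theorem sqrt_segF2_le_add (hab : a ≤ b) (hbt : b ≤ t) :
    √(segF2 x a t) ≤ √(segF2 x a b) + √(segF2 x b t) := by
  have h1 := segF2_nonneg x a b
  have h2 := segF2_nonneg x b t
  have cauchy_schwarz : freqVec x a b ⬝ᵥ freqVec x b t ≤ √(segF2 x a b) * √(segF2 x b t) := by
    rw [← Real.sqrt_mul h1]
    refine Real.le_sqrt_of_sq_le ?_
    simpa only [segF2, dotProduct, sq] using
      Finset.sum_mul_sq_le_sq_mul_sq Finset.univ (freqVec x a b) (freqVec x b t)
  rw [Real.sqrt_le_left (by positivity), segF2_add x hab hbt, add_sq, Real.sq_sqrt h1,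
    Real.sq_sqrt h2]
  linarith

theorem freqVec_le_sqrt_segF2 (a t : ℕ) (i : Fin u) : freqVec x a t i ≤ √(segF2 x a t) := by
  refine Real.le_sqrt_of_sq_le ?_
  rw [sq]
  exact Finset.single_le_sum (f := fun i => freqVec x a t i * freqVec x a t i)
    (fun _ _ => mul_self_nonneg _) (Finset.mem_univ i)

end Segments

section BucketAt

open scoped Matrix

variable {P : Params} (ω : P.Seed) (x : ℕ → Fin P.u) {a t : ℕ}

/-- The bucket of the segment `[a, t)` of the stream. -/
noncomputable def bucketAt (a : ℕ) : ℕ → Bucket P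
  | 0 => Bucket.empty P
  | t + 1 => if a ≤ t then Bucket.add ω (x t) (bucketAt a t) else Bucket.empty P

theorem bucketAt_succ (h : a ≤ t) :
    bucketAt ω x a (t + 1) = Bucket.add ω (x t) (bucketAt ω x a t) := by
  rw [bucketAt, if_pos h]

theorem bucketAt_of_le (h : t ≤ a) : bucketAt ω x a t = Bucket.empty P := by
  cases t with
  | zero => rfl
  | succ t => rw [bucketAt, if_neg (by omega)]

theorem bucketAt_induction (a : ℕ) (p : ℕ → Bucket P → Prop) (h0 : p a (Bucket.empty P))
    (hs : ∀ t, a ≤ t → p t (bucketAt ω x a t) → p (t + 1) (Bucket.add ω (x t) (bucketAt ω x a t)))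
    (h : a ≤ t) : p t (bucketAt ω x a t) := by
  induction t, h using Nat.le_induction with
  | base => rwa [bucketAt_of_le ω x le_rfl]
  | succ t h ih => rw [bucketAt_succ ω x h]; exact hs t h ih

theorem bucketAt_size (a t : ℕ) : (bucketAt ω x a t).size = t - a := by
  rcases le_total t a with h | h
  · rw [bucketAt_of_le ω x h, Nat.sub_eq_zero_of_le h]
    rfl
  · refine bucketAt_induction ω x a (fun t A => A.size = t - a) (by simp [Bucket.empty]) ?_ h
    intro t ht ih
    simp only [Bucket.add, ih]
    omega

theorem bucketAt_l2 (h : a ≤ t) (r : Fin P.rows) (c : Fin P.cols) :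
    (((bucketAt ω x a t).l2 r c : ℤ) : ℝ) = freqVec x a t ⬝ᵥ hashSign P.hashBits (ω.2 r c) := by
  refine bucketAt_induction ω x a
    (fun t A => ((A.l2 r c : ℤ) : ℝ) = freqVec x a t ⬝ᵥ hashSign P.hashBits (ω.2 r c)) ?_ ?_ h
  · simp [Bucket.empty, freqVec_self]
  · intro t ht ih
    simp only [Bucket.add, l2Add, Int.cast_add, ih, freqVec_succ x ht, add_dotProduct,
      single_dotProduct, one_mul]
    rfl

theorem bucketAt_cs (h : a ≤ t) (r : Fin P.rows) (c : Fin (2 ^ P.cellBits)) :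
    (((bucketAt ω x a t).cs r c : ℤ) : ℝ) =
      (fun j => if csCell P ω r j = c then freqVec x a t j else 0) ⬝ᵥ
        hashSign P.hashBits (ω.1 r).2 := by
  refine bucketAt_induction ω x a (fun t A => ((A.cs r c : ℤ) : ℝ) =
    (fun j => if csCell P ω r j = c then freqVec x a t j else 0) ⬝ᵥ
      hashSign P.hashBits (ω.1 r).2) ?_ ?_ h
  · simp [Bucket.empty, freqVec_self, dotProduct]
  · intro t ht ih
    have restrict_succ : (fun j => if csCell P ω r j = c then freqVec x a (t + 1) j else 0) =
        (fun j => if csCell P ω r j = c then freqVec x a t j else 0) +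
          Pi.single (x t) (if csCell P ω r (x t) = c then 1 else 0) := by
      ext j
      by_cases hj : j = x t
      · subst hj
        simp [freqVec_succ x ht, ite_add_ite]
      · simp [freqVec_succ x ht, hj]
    rw [restrict_succ, add_dotProduct, single_dotProduct, ← ih]
    by_cases hc : c = csCell P ω r (x t)
    · simp [Bucket.add, csAdd, hc, csSign, hashSign]
    · simp [Bucket.add, csAdd, hc, Ne.symm hc]

theorem csSign_mul_bucketAt_cs (h : a ≤ t) (r : Fin P.rows) (q : Fin P.u) :
    ((csSign P ω r q * (bucketAt ω x a t).cs r (csCell P ω r q) : ℤ) : ℝ) =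
      rowEstimate (csCell P ω r) (hashSign P.hashBits (ω.1 r).2) (freqVec x a t) q := by
  rw [Int.cast_mul, bucketAt_cs ω x h]
  rfl

end BucketAt

section Candidates

variable {ι : Type*}

/-- Relation between a list of at most `k` candidates with counts and the true frequencies `n`, up
to the error `η`: the counts are accurate, and if an occurring element is missing then the list is
full and no count is less than the frequency of that element by more than `η`. -/
structure CandInv (k : ℕ) (H : List (ι × ℤ)) (n : ι → ℕ) (η : ℝ) : Prop where
  nodup : (H.map Prod.fst).Nodup
  length_le : H.length ≤ k
  accurate : ∀ p ∈ H, |(p.2 : ℝ) - n p.1| ≤ η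
  missing : ∀ i, i ∉ H.map Prod.fst → 0 < n i → H.length = k ∧ ∀ p ∈ H, (n i : ℝ) - η ≤ p.2

namespace CandInv

variable {k : ℕ} {H : List (ι × ℤ)} {n : ι → ℕ} {η : ℝ} {q : ι} {e : ℤ}

theorem nil (k : ℕ) (η : ℝ) : CandInv k ([] : List (ι × ℤ)) 0 η :=
  ⟨by simp, by simp, by simp, by simp⟩

theorem mem_of_le [Fintype ι] {T : ℝ} (h : CandInv k H n η) (hη : 0 ≤ η) (hT : 0 < T)
    (hsum : ∑ i, (n i : ℝ) ^ 2 < k * T ^ 2) (hq : T + 2 * η ≤ n q) : q ∈ H.map Prod.fst := by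
  classical
  by_contra hmem
  have hpos : 0 < n q := by
    rw [← Nat.cast_pos (α := ℝ)]
    linarith
  obtain ⟨hlen, hall⟩ := h.missing q hmem hpos
  have card_candidates : (H.map Prod.fst).toFinset.card = k := by
    rw [List.toFinset_card_of_nodup h.nodup, List.length_map, hlen]
  have frequent : ∀ i ∈ (H.map Prod.fst).toFinset, T ^ 2 ≤ (n i : ℝ) ^ 2 := by
    intro i hi
    obtain ⟨p, hp, rfl⟩ := List.mem_map.1 (List.mem_toFinset.1 hi)
    have := hall p hp
    have := (abs_le.1 (h.accurate p hp)).2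
    gcongr
    linarith
  refine hsum.not_ge ?_
  calc k * T ^ 2 = (H.map Prod.fst).toFinset.card • T ^ 2 := by rw [card_candidates, nsmul_eq_mul]
    _ ≤ ∑ i ∈ (H.map Prod.fst).toFinset, (n i : ℝ) ^ 2 := Finset.card_nsmul_le_sum _ _ _ frequent
    _ ≤ ∑ i, (n i : ℝ) ^ 2 := Finset.sum_le_univ_sum_of_nonneg fun i => sq_nonneg _

variable [DecidableEq ι]

theorem increment (h : CandInv k H n η) (hq : q ∈ H.map Prod.fst) :
    CandInv k (H.map fun p => if p.1 = q then (p.1, p.2 + 1) else p) (n + Pi.single q 1) η := by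
  have map_fst : (H.map fun p => if p.1 = q then (p.1, p.2 + 1) else p).map Prod.fst =
      H.map Prod.fst := by
    rw [List.map_map]
    refine List.map_congr_left fun p _ => ?_
    simp only [Function.comp_apply]
    split_ifs <;> rfl
  refine ⟨by rw [map_fst]; exact h.nodup, by simpa using h.length_le, ?_, ?_⟩
  · intro p hp
    obtain ⟨p', hp', rfl⟩ := List.mem_map.1 hp
    have := h.accurate p' hp'
    by_cases hp'q : p'.1 = q
    · subst hp'q
      simpa using this
    · simpa [hp'q] using this
  · intro i hi hpos
    rw [map_fst] at hi
    have hiq : i ≠ q := fun e => hi (e ▸ hq)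
    simp only [Pi.add_apply, Pi.single_eq_of_ne hiq, add_zero] at hpos ⊢
    obtain ⟨hlen, hall⟩ := h.missing i hi hpos
    refine ⟨by simpa using hlen, fun p hp => ?_⟩
    obtain ⟨p', hp', rfl⟩ := List.mem_map.1 hp
    refine (hall p' hp').trans ?_
    split_ifs <;> simp

theorem accurate_add_single (h : CandInv k H n η) (hq : q ∉ H.map Prod.fst) {p : ι × ℤ}
    (hp : p ∈ H) : |(p.2 : ℝ) - (n + Pi.single q 1 : ι → ℕ) p.1| ≤ η := by
  have hpq : p.1 ≠ q := fun e => hq (e ▸ List.mem_map_of_mem hp)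
  simpa [hpq] using h.accurate p hp

theorem cons (h : CandInv k H n η) (hq : q ∉ H.map Prod.fst) (hlen : H.length < k)
    (he : |(e : ℝ) - (n q + 1)| ≤ η) : CandInv k ((q, e) :: H) (n + Pi.single q 1) η := by
  refine ⟨List.nodup_cons.2 ⟨hq, h.nodup⟩, by simpa using hlen, ?_, ?_⟩
  · rintro p (_ | ⟨_, hp⟩)
    · simpa using he
    · exact h.accurate_add_single hq hp
  · intro i hi hpos
    simp only [List.map_cons, List.mem_cons, not_or] at hi
    simp only [Pi.add_apply, Pi.single_eq_of_ne hi.1, add_zero] at hpos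
    exact absurd (h.missing i hi.2 hpos).1 hlen.ne

theorem cons_erase (h : CandInv k H n η) (hq : q ∉ H.map Prod.fst) (hlen : H.length = k)
    {p : ι × ℤ} (hp : p ∈ H) (hmin : ∀ p' ∈ H, p.2 ≤ p'.2) (hlt : p.2 < e)
    (he : |(e : ℝ) - (n q + 1)| ≤ η) :
    CandInv k ((q, e) :: H.erase p) (n + Pi.single q 1) η := by
  have length_eq : ((q, e) :: H.erase p).length = k := by
    have := List.length_pos_of_mem hp
    rw [List.length_cons, List.length_erase_of_mem hp]
    omega
  refine ⟨List.nodup_cons.2 ⟨fun hm => hq ?_, h.nodup.sublist (List.erase_sublist.map _)⟩,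
    length_eq.le, ?_, ?_⟩
  · exact (List.erase_sublist.map Prod.fst).subset hm
  · rintro p' (_ | ⟨_, hp'⟩)
    · simpa using he
    · exact h.accurate_add_single hq (List.mem_of_mem_erase hp')
  · intro i hi hpos
    simp only [List.map_cons, List.mem_cons, not_or] at hi
    simp only [Pi.add_apply, Pi.single_eq_of_ne hi.1, add_zero] at hpos ⊢
    have le_min : (n i : ℝ) - η ≤ p.2 := by
      by_cases hiH : i ∈ H.map Prod.fst
      · obtain ⟨p', hp', rfl⟩ := List.mem_map.1 hiH
        have erased : p' = p := by
          by_contra hne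
          exact hi.2 (List.mem_map_of_mem ((List.mem_erase_of_ne hne).2 hp'))
        rw [erased]
        linarith [(abs_le.1 (h.accurate p hp)).1]
      · exact (h.missing i hiH hpos).2 p hp
    refine ⟨length_eq, ?_⟩
    rintro p' (_ | ⟨_, hp'⟩)
    · exact le_min.trans (by exact_mod_cast hlt.le)
    · exact le_min.trans (by exact_mod_cast hmin p' (List.mem_of_mem_erase hp'))

theorem add_single (h : CandInv k H n η) (hq : q ∉ H.map Prod.fst) (hlen : H.length = k)
    (hle : ∀ p ∈ H, e ≤ p.2) (he : |(e : ℝ) - (n q + 1)| ≤ η) :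
    CandInv k H (n + Pi.single q 1) η := by
  refine ⟨h.nodup, h.length_le, fun p hp => h.accurate_add_single hq hp, fun i hi hpos => ?_⟩
  by_cases hiq : i = q
  · subst hiq
    refine ⟨hlen, fun p hp => ?_⟩
    have : (e : ℝ) ≤ p.2 := by exact_mod_cast hle p hp
    simp only [Pi.add_apply, Pi.single_eq_same, Nat.cast_add, Nat.cast_one]
    linarith [(abs_le.1 he).1]
  · simp only [Pi.add_apply, Pi.single_eq_of_ne hiq, add_zero] at hpos ⊢
    exact h.missing i hi hpos

end CandInv

variable {P : Params}

theorem length_candUpdate_le {H : Candidates P} (h : H.length ≤ P.listLen) (q : Fin P.u) (e : ℤ) :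
    (candUpdate P H q e).length ≤ P.listLen := by
  rw [candUpdate]
  split_ifs with hq hlen
  · simpa using h
  · simpa using hlen
  · split
    · exact h
    · rename_i p hp
      split_ifs
      · have hp := List.argmin_mem hp
        have := List.length_pos_of_mem hp
        rw [List.length_cons, List.length_erase_of_mem hp]
        omega
      · exact h

theorem CandInv.candUpdate {H : Candidates P} {n : Fin P.u → ℕ} {η : ℝ} {q : Fin P.u} {e : ℤ}
    (h : CandInv P.listLen H n η) (he : |(e : ℝ) - (n q + 1)| ≤ η) :
    CandInv P.listLen (candUpdate P H q e) (n + Pi.single q 1) η := by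
  rw [SlidingWindow.candUpdate]
  split_ifs with hq hlen
  · exact h.increment hq
  · exact h.cons hq hlen he
  · have hfull : H.length = P.listLen := h.length_le.antisymm (not_lt.1 hlen)
    split
    · rename_i hnone
      have hpos : 0 < P.listLen := Nat.succ_pos _
      rw [List.argmin_eq_none.1 hnone] at hfull
      exact absurd hfull hpos.ne
    · rename_i p hp
      have hmin : ∀ p' ∈ H, p.2 ≤ p'.2 := fun p' hp' => List.le_of_mem_argmin hp' hp
      split_ifs with hlt
      · exact h.cons_erase hq hfull (List.argmin_mem hp) hmin hlt he
      · exact h.add_single hq hfull (fun p' hp' => (not_lt.1 hlt).trans (hmin p' hp')) he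

theorem candInv_bucketAt (ω : P.Seed) (x : ℕ → Fin P.u) {a t : ℕ} (hat : a ≤ t) {η : ℝ}
    (he : ∀ s, a ≤ s → s < t →
      |(csEstimate P ω (bucketAt ω x a (s + 1)).cs (x s) : ℝ) - freq x a (s + 1) (x s)| ≤ η) :
    CandInv P.listLen (bucketAt ω x a t).cand (freq x a t) η := by
  refine bucketAt_induction ω x a (fun s A => s ≤ t → CandInv P.listLen A.cand (freq x a s) η)
    (fun _ => ?_) ?_ hat le_rfl
  · rw [freq_self]
    exact CandInv.nil _ η
  · intro s hs ih hst
    have := he s hs (by omega)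
    rw [bucketAt_succ ω x hs, freq_succ x hs] at this
    rw [freq_succ x hs]
    simp only [Pi.add_apply, Pi.single_eq_same, Nat.cast_add, Nat.cast_one] at this ⊢
    exact (ih (by omega)).candUpdate this

end Candidates

section Merging

variable {α β : Type*}

theorem getLast?_of_suffix {l l' : List α} (h : l' <:+ l) (hne : l' ≠ []) :
    l'.getLast? = l.getLast? := by
  obtain ⟨s, rfl⟩ := h
  rw [List.getLast?_append_of_ne_nil _ hne]

theorem filter_suffix {r : α → α → Prop} {l : List α} (hl : l.Pairwise r) {p : α → Bool}
    (hp : ∀ a b, r a b → p a → p b) : l.filter p <:+ l := by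
  induction hl with
  | nil => exact List.suffix_rfl
  | @cons a l ha _ ih =>
    by_cases hpa : p a
    · rw [List.filter_eq_self.2 (List.forall_mem_cons.2 ⟨hpa, fun b hb => hp a b (ha b hb) hpa⟩)]
    · rw [List.filter_cons_of_neg hpa]
      exact ih.trans (List.suffix_cons a l)

theorem skipTo_suffix (p : α → Prop) (l : List α) : skipTo p l <:+ l := by
  induction l with
  | nil => exact List.suffix_rfl
  | cons y l ih =>
    rw [skipTo]
    split_ifs
    · exact ih.trans (List.suffix_cons y l)
    · exact List.suffix_rfl

theorem skipTo_map (f : α → β) (p : β → Prop) (l : List α) :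
    skipTo p (l.map f) = (skipTo (p ∘ f) l).map f := by
  induction l with
  | nil => rfl
  | cons y l ih =>
    have exists_mem_map : (∃ z ∈ l.map f, p z) ↔ ∃ a ∈ l, p (f a) := by simp
    rw [List.map_cons, skipTo, skipTo]
    by_cases h : ∃ a ∈ l, p (f a)
    · rw [if_pos (exists_mem_map.2 h), ih]
      exact congrArg (List.map f) (if_pos h).symm
    · rw [if_neg (mt exists_mem_map.1 h), ← List.map_cons]
      exact congrArg (List.map f) (if_neg h).symm

theorem skipTo_ne_nil (p : α → Prop) {l : List α} (h : l ≠ []) : skipTo p l ≠ [] := by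
  induction l with
  | nil => exact absurd rfl h
  | cons y l ih =>
    rw [skipTo]
    split_ifs with hp
    · obtain ⟨z, hz, -⟩ := hp
      exact ih (List.ne_nil_of_mem hz)
    · exact List.cons_ne_nil y l

theorem not_of_mem_tail_skipTo (p : α → Prop) (l : List α) : ∀ z ∈ (skipTo p l).tail, ¬ p z := by
  induction l with
  | nil => simp [skipTo]
  | cons y l ih =>
    rw [skipTo]
    split_ifs with h
    · exact ih
    · exact fun z hz hp => h ⟨z, hz, hp⟩

theorem of_mem_head?_skipTo {p : α → Prop} {l : List α} (h : ∃ z ∈ l, p z) :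
    ∀ y ∈ (skipTo p l).head?, p y := by
  induction l with
  | nil => simp at h
  | cons z l ih =>
    rw [skipTo]
    split_ifs with hl
    · exact ih hl
    · simpa [hl] using h

theorem skipTo_eq_self {p : α → Prop} {l : List α} (h : ¬ ∃ z ∈ l, p z) : skipTo p l = l := by
  cases l with
  | nil => rfl
  | cons y l => rw [skipTo, if_neg fun ⟨z, hz, hp⟩ => h ⟨z, List.mem_cons_of_mem y hz, hp⟩]

theorem mem_head?_or_of_mem_head?_skipTo (p : α → Prop) (l : List α) :
    ∀ y ∈ (skipTo p l).head?, y ∈ l.head? ∨ p y := by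
  by_cases h : ∃ z ∈ l, p z
  · exact fun y hy => Or.inr (of_mem_head?_skipTo h y hy)
  · rw [skipTo_eq_self h]
    exact fun y hy => Or.inl hy

/-- The procedure `prune` for an arbitrary relation in place of the test `Close`: for every member
`a` in turn, the members strictly between `a` and the last one related to `a` are deleted. -/
noncomputable def pruneBy (R : α → α → Prop) : List α → List α
  | [] => []
  | a :: l => a :: pruneBy R (skipTo (R a) l)
termination_by l => l.length
decreasing_by exact Nat.lt_succ_of_le (length_skipTo_le (R a) l)

theorem prune_map {P : Params} (f : α → Bucket P) (l : List α) :
    prune (l.map f) = (pruneBy (Function.onFun Close f) l).map f := by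
  induction l using pruneBy.induct (Function.onFun Close f) with
  | case1 => simp [prune, pruneBy]
  | case2 a l ih =>
    rw [List.map_cons, prune, skipTo_map, pruneBy, List.map_cons, ← ih]
    rfl

variable (R : α → α → Prop) (l : List α)

theorem pruneBy_sublist : (pruneBy R l).Sublist l := by
  induction l using pruneBy.induct R with
  | case1 => simp [pruneBy]
  | case2 a l ih =>
    rw [pruneBy]
    exact (ih.trans (skipTo_suffix _ l).sublist).cons_cons a

theorem head?_pruneBy : (pruneBy R l).head? = l.head? := by
  cases l <;> simp [pruneBy]

theorem getLast?_pruneBy : (pruneBy R l).getLast? = l.getLast? := by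
  induction l using pruneBy.induct R with
  | case1 => simp [pruneBy]
  | case2 a l ih =>
    rw [pruneBy, List.getLast?_cons, List.getLast?_cons, ih]
    rcases eq_or_ne l [] with rfl | hl
    · rfl
    · rw [getLast?_of_suffix (skipTo_suffix _ l) (skipTo_ne_nil _ hl)]

variable {R l} in
theorem isChain_pruneBy {S : α → α → Prop} (h : l.IsChain S) :
    (pruneBy R l).IsChain fun a b => S a b ∨ R a b := by
  induction l using pruneBy.induct R with
  | case1 => simp [pruneBy]
  | case2 a l ih =>
    rw [List.isChain_cons] at h
    rw [pruneBy, List.isChain_cons, head?_pruneBy]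
    exact ⟨fun y hy => (mem_head?_or_of_mem_head?_skipTo _ l y hy).imp_left (h.1 y),
      ih (h.2.suffix (skipTo_suffix _ l))⟩

theorem not_rel_getElem_pruneBy (i : ℕ) (hi : i + 2 < (pruneBy R l).length) :
    ¬ R (pruneBy R l)[i] (pruneBy R l)[i + 2] := by
  induction l using pruneBy.induct R generalizing i with
  | case1 => simp [pruneBy] at hi
  | case2 a l ih =>
    simp only [pruneBy, List.length_cons] at hi ⊢
    cases i with
    | zero =>
      refine not_of_mem_tail_skipTo (R a) l _ ((pruneBy_sublist R _).tail.subset ?_)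
      rw [← List.drop_one, List.mem_drop_iff_getElem]
      exact ⟨0, by omega, rfl⟩
    | succ i => exact ih i (by omega)

end Merging

section Expiry

variable {α : Type*}

/-- The procedure `expire` for an arbitrary size function: the first member is deleted as long as
the second one has size at least `N`. -/
def expireBy (size : α → ℕ) (N : ℕ) : List α → List α
  | a :: b :: l => if N ≤ size b then expireBy size N (b :: l) else a :: b :: l
  | l => l

theorem expire_map {P : Params} (f : α → Bucket P) (l : List α) :
    expire (l.map f) = (expireBy (fun a => (f a).size) P.N l).map f := by
  induction l using expireBy.induct (fun a => (f a).size) P.N with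
  | case1 a b l h ih => simpa [expire, expireBy, h] using ih
  | case2 a b l h => simp [expire, expireBy, h]
  | case3 l hl =>
    rcases l with _ | ⟨a, _ | ⟨b, l⟩⟩
    · rfl
    · rfl
    · exact absurd rfl (hl a b l)

variable (size : α → ℕ) (N : ℕ) (l : List α)

theorem expireBy_suffix : expireBy size N l <:+ l := by
  fun_induction expireBy size N l with
  | case1 a _ _ _ ih => exact ih.trans (List.suffix_cons a _)
  | case2 | case3 => exact List.suffix_rfl

variable {l} in
theorem expireBy_ne_nil (h : l ≠ []) : expireBy size N l ≠ [] := by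
  fun_induction expireBy size N l with
  | case1 _ b l _ ih => exact ih (List.cons_ne_nil b l)
  | case2 | case3 => exact h

theorem mem_head?_or_le_of_mem_head?_expireBy :
    ∀ a ∈ (expireBy size N l).head?, a ∈ l.head? ∨ N ≤ size a := by
  fun_induction expireBy size N l with
  | case1 a b l hb ih =>
    intro c hc
    refine Or.inr ((ih c hc).elim (fun hcb => ?_) id)
    obtain rfl : b = c := by simpa using hcb
    exact hb
  | case2 | case3 => exact fun c hc => Or.inl hc

theorem lt_of_mem_head?_tail_expireBy : ∀ b ∈ (expireBy size N l).tail.head?, size b < N := by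
  fun_induction expireBy size N l with
  | case1 _ _ _ _ ih => exact ih
  | case2 a b l hb => simpa using hb
  | case3 l hl =>
    rcases l with _ | ⟨a, _ | ⟨b, l⟩⟩
    · simp
    · simp
    · exact absurd rfl (hl a b l)

end Expiry

section Histogram

variable {P : Params} (ω : P.Seed) (x : ℕ → Fin P.u)

/-- Buckets `a < b` that are neighbours in the list at time `t`: either no bucket between them has
ever been deleted, or the two passed the test at some time up to `t`. -/
def Link (t a b : ℕ) : Prop :=
  b = a + 1 ∨ ∃ s ≤ t, b < s ∧ Close (bucketAt ω x a s) (bucketAt ω x b s)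

/-- The list `l` of the starts of the buckets at time `t`: all buckets have size at most `M`, and
all but the first have size less than `K`. -/
structure HistInv (t M K : ℕ) (l : List ℕ) : Prop where
  sorted : l.Pairwise (· < ·)
  linked : l.IsChain (Link ω x t)
  last : ∀ a ∈ l.getLast?, a + 1 = t
  ne_nil : 0 < t → l ≠ []
  lt : ∀ a ∈ l, a < t
  size_le : ∀ a ∈ l, t - a ≤ M
  tail_lt : ∀ b ∈ l.tail, t - b < K

/-- The starts of the buckets left by `prune` and `expire` when the element `x t` arrives at the
histogram whose buckets start at `l`. -/
noncomputable def mergedStarts (t : ℕ) (l : List ℕ) : List ℕ :=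
  expireBy (t + 1 - ·) P.N (pruneBy (Function.onFun Close (bucketAt ω x · (t + 1))) (l ++ [t]))

/-- The starts of the buckets left at time `t` when the oldest ones are dropped because of their
size or number. -/
noncomputable def trimStarts (P : Params) (t : ℕ) (l : List ℕ) : List ℕ :=
  let T := l.filter fun a => t - a ≤ P.maxSize
  T.drop (T.length - P.maxBuckets)

/-- The starts of the buckets at time `t`. -/
noncomputable def bucketStarts : ℕ → List ℕ
  | 0 => []
  | t + 1 => trimStarts P (t + 1) (mergedStarts ω x t (bucketStarts t))

variable {ω x} {t M K : ℕ} {l : List ℕ}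

theorem Link.succ {a b : ℕ} (h : Link ω x t a b) : Link ω x (t + 1) a b :=
  h.imp_right fun ⟨s, hst, hbs, hc⟩ => ⟨s, by omega, hbs, hc⟩

namespace HistInv

theorem nil (M K : ℕ) : HistInv ω x 0 M K [] :=
  ⟨by simp, by simp, by simp, by simp, by simp, by simp, by simp⟩

theorem suffix (h : HistInv ω x t M K l) {m : List ℕ} (hm : m <:+ l) (hne : m ≠ []) :
    HistInv ω x t M K m where
  sorted := h.sorted.sublist hm.sublist
  linked := h.linked.suffix hm
  last := by rw [getLast?_of_suffix hm hne]; exact h.last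
  ne_nil := fun _ => hne
  lt := fun a ha => h.lt a (hm.mem ha)
  size_le := fun a ha => h.size_le a (hm.mem ha)
  tail_lt := fun b hb => h.tail_lt b (hm.sublist.tail.subset hb)

theorem append (h : HistInv ω x t M K l) (hK : 0 < K) :
    HistInv ω x (t + 1) (M + 1) (K + 1) (l ++ [t]) where
  sorted := by
    simp only [List.pairwise_append, List.mem_singleton, forall_eq]
    exact ⟨h.sorted, List.pairwise_singleton _ t, h.lt⟩
  linked := by
    rw [List.isChain_append]
    refine ⟨h.linked.imp fun _ _ => Link.succ, List.isChain_singleton t, fun a ha b hb => ?_⟩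
    obtain rfl : t = b := by simpa using hb
    exact Or.inl (h.last a ha).symm
  last := by simp
  ne_nil := by simp
  lt := by
    simp only [List.mem_append, List.mem_singleton]
    rintro a (ha | rfl)
    · exact (h.lt a ha).trans (Nat.lt_succ_self t)
    · exact Nat.lt_succ_self a
  size_le := by
    simp only [List.mem_append, List.mem_singleton]
    rintro a (ha | rfl)
    · have := h.size_le a ha
      omega
    · omega
  tail_lt := by
    intro b hb
    cases l with
    | nil => simp at hb
    | cons a l =>
      rcases List.mem_append.1 hb with hb | hb
      · have := h.tail_lt b hb
        omega
      · obtain rfl := List.mem_singleton.1 hb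
        omega

theorem pruneBy (h : HistInv ω x t M K l) :
    HistInv ω x t M K (pruneBy (Function.onFun Close (bucketAt ω x · t)) l) where
  sorted := h.sorted.sublist (pruneBy_sublist _ l)
  linked := by
    refine List.IsChain.imp_of_mem_imp ?_ (isChain_pruneBy h.linked)
    rintro a b - hb (hlink | hclose)
    · exact hlink
    · exact Or.inr ⟨t, le_rfl, h.lt b ((pruneBy_sublist _ l).subset hb), hclose⟩
  last := by rw [getLast?_pruneBy]; exact h.last
  ne_nil := fun ht => by
    rw [ne_eq, ← List.head?_eq_none_iff, head?_pruneBy, List.head?_eq_none_iff]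
    exact h.ne_nil ht
  lt := fun a ha => h.lt a ((pruneBy_sublist _ l).subset ha)
  size_le := fun a ha => h.size_le a ((pruneBy_sublist _ l).subset ha)
  tail_lt := fun b hb => h.tail_lt b ((pruneBy_sublist _ l).tail.subset hb)

theorem expireBy (h : HistInv ω x t M K l) (ht : 0 < t) (N : ℕ) :
    HistInv ω x t M N (expireBy (t - ·) N l) :=
  have hsuffix := h.suffix (expireBy_suffix (t - ·) N l) (expireBy_ne_nil _ N (h.ne_nil ht))
  { hsuffix with
    tail_lt := by
      have hhead := lt_of_mem_head?_tail_expireBy (t - ·) N l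
      have hsorted := hsuffix.sorted.sublist (List.tail_sublist _)
      intro b hb
      cases htail : (SlidingWindow.expireBy (t - ·) N l).tail with
      | nil => simp [htail] at hb
      | cons c m =>
        rw [htail] at hb hhead hsorted
        have hc : t - c < N := hhead c rfl
        rcases List.mem_cons.1 hb with rfl | hb
        · exact hc
        · have := List.rel_of_pairwise_cons hsorted hb
          omega }

theorem mergedStarts (h : HistInv ω x t M K l) (hK : 0 < K) :
    HistInv ω x (t + 1) (M + 1) P.N (mergedStarts ω x t l) :=
  (h.append hK).pruneBy.expireBy t.succ_pos P.N

theorem trimStarts (h : HistInv ω x t M K l) (ht : 0 < t) (hM : 1 ≤ P.maxSize)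
    (hB : 1 ≤ P.maxBuckets) : HistInv ω x t P.maxSize K (trimStarts P t l) := by
  have hne := h.ne_nil ht
  have filter_suffix : l.filter (fun a => t - a ≤ P.maxSize) <:+ l :=
    filter_suffix h.sorted fun a b hab ha => by simp only [decide_eq_true_eq] at ha ⊢; omega
  have filter_ne_nil : l.filter (fun a => t - a ≤ P.maxSize) ≠ [] := by
    have hlast := h.last _ (List.getLast?_eq_some_getLast hne)
    refine List.ne_nil_of_mem (List.mem_filter.2 ⟨List.getLast_mem hne, ?_⟩)
    simp only [decide_eq_true_eq]
    omega
  have trim_ne_nil : SlidingWindow.trimStarts P t l ≠ [] := by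
    have := List.length_pos_iff.2 filter_ne_nil
    rw [SlidingWindow.trimStarts, ← List.length_pos_iff, List.length_drop]
    omega
  refine { h.suffix ((List.drop_suffix _ _).trans filter_suffix) trim_ne_nil with
    size_le := fun a ha => ?_ }
  simpa using (List.mem_filter.1 (List.mem_of_mem_drop ha)).2

end HistInv

theorem histStep_map (h : ∀ a ∈ l, a ≤ t) :
    histStep P ω (l.map (bucketAt ω x · t)) (x t) =
      (trimStarts P (t + 1) (mergedStarts ω x t l)).map (bucketAt ω x · (t + 1)) := by
  have arrival : (l.map (bucketAt ω x · t) ++ [Bucket.empty P]).map (Bucket.add ω (x t)) =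
      (l ++ [t]).map (bucketAt ω x · (t + 1)) := by
    rw [List.map_append, List.map_append, List.map_map]
    congr 1
    · exact List.map_congr_left fun a ha => (bucketAt_succ ω x (h a ha)).symm
    · simp [bucketAt_succ ω x le_rfl, bucketAt_of_le ω x le_rfl]
  have merged : expire (prune ((l ++ [t]).map (bucketAt ω x · (t + 1)))) =
      (mergedStarts ω x t l).map (bucketAt ω x · (t + 1)) := by
    simp only [prune_map, expire_map, bucketAt_size]
    rfl
  simp only [histStep, arrival, merged, trimStarts, List.filter_map, List.map_drop,
    List.length_map, Function.comp_def, bucketAt_size]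

theorem one_le_maxSize (hN : 0 < P.N) : 1 ≤ P.maxSize :=
  Nat.succ_le_of_lt (by rw [Params.maxSize]; positivity)

theorem histInv_bucketStarts (hN : 0 < P.N) (hB : 1 ≤ P.maxBuckets) (t : ℕ) :
    HistInv ω x t P.maxSize P.N (bucketStarts ω x t) := by
  induction t with
  | zero => exact HistInv.nil P.maxSize P.N
  | succ t ih => exact (ih.mergedStarts hN).trimStarts t.succ_pos (one_le_maxSize hN) hB

theorem run_freqAlgorithm (hN : 0 < P.N) (hB : 1 ≤ P.maxBuckets) (t : ℕ) :
    (freqAlgorithm P).run ω x t = (bucketStarts ω x t).map (bucketAt ω x · t) := by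
  induction t with
  | zero => rfl
  | succ t ih =>
    rw [bucketStarts, ← histStep_map fun a ha => ((histInv_bucketStarts hN hB t).lt a ha).le, ← ih]
    rfl

theorem mem_head?_or_of_mem_head?_mergedStarts (t : ℕ) (l : List ℕ) :
    ∀ a ∈ (mergedStarts ω x t l).head?, a ∈ (l ++ [t]).head? ∨ P.N ≤ t + 1 - a := by
  intro a ha
  simpa only [head?_pruneBy] using mem_head?_or_le_of_mem_head?_expireBy _ _ _ a ha

theorem not_close_getElem_mergedStarts (t : ℕ) (l : List ℕ) (i : ℕ)
    (hi : i + 2 < (mergedStarts ω x t l).length) :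
    ¬ Close (bucketAt ω x (mergedStarts ω x t l)[i] (t + 1))
      (bucketAt ω x (mergedStarts ω x t l)[i + 2] (t + 1)) := by
  have hsuffix : mergedStarts ω x t l <:+ _ := expireBy_suffix _ _ _
  have hlen := hsuffix.length_le
  rw [hsuffix.getElem (by omega), hsuffix.getElem hi]
  have h_far := not_rel_getElem_pruneBy (Function.onFun Close (bucketAt ω x · (t + 1))) (l ++ [t])
  exact h_far _ (by omega)

end Histogram

section Parameters

/-- The parameters for which the algorithm is analysed. -/
structure Params.Valid (P : Params) : Prop where
  two_le_N : 2 ≤ P.N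
  γ_pos : 0 < P.γ
  γ_lt : P.γ < 1
  ε_pos : 0 < P.ε
  ε_lt : P.ε < 1 / 8
  δ_pos : 0 < P.δ
  δ_lt : P.δ < 1
  le_κ : 10 ^ 5 ≤ P.κ

variable {P : Params}

theorem β_eq (P : Params) : P.β = P.ε ^ 2 / 8 := by
  rw [Params.β, Params.α]
  ring

theorem β_nonneg (P : Params) : 0 ≤ P.β := by
  rw [β_eq]
  positivity

theorem half_lt_log {n : ℕ} (hn : 2 ≤ n) : 1 / 2 < Real.log n := by
  have : Real.log 2 ≤ Real.log n := Real.log_le_log (by norm_num) (by exact_mod_cast hn)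
  linarith [Real.log_two_gt_d9]

theorem one_le_maxBuckets (hP : P.Valid) : 1 ≤ P.maxBuckets := by
  have hlog := half_lt_log hP.two_le_N
  have hκ := hP.le_κ
  have hε := hP.ε_pos
  exact Nat.succ_le_of_lt (Nat.ceil_pos.2 (mul_pos (div_pos (by linarith) (by positivity))
    (by linarith)))

theorem maxSize_add_one_le (hN : 2 ≤ P.N) : (P.maxSize + 1 : ℝ) ≤ (P.N : ℝ) ^ 5 := by
  have hN' : (2 : ℝ) ≤ P.N := by exact_mod_cast hN
  have : (2 : ℝ) ^ 2 ≤ (P.N : ℝ) ^ 2 := by gcongr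
  have : (2 : ℝ) ^ 3 ≤ (P.N : ℝ) ^ 3 := by gcongr
  calc (P.maxSize + 1 : ℝ) = 4 * (P.N : ℝ) ^ 2 + 1 := by simp [Params.maxSize]
    _ ≤ 2 ^ 3 * (P.N : ℝ) ^ 2 := by linarith
    _ ≤ (P.N : ℝ) ^ 3 * (P.N : ℝ) ^ 2 := by gcongr
    _ = (P.N : ℝ) ^ 5 := by ring

theorem two_mul_add_two_le_maxBuckets (hP : P.Valid) {j : ℕ}
    (h : P.β / 2 * j ≤ 10 * Real.log P.N) : 2 * j + 2 ≤ P.maxBuckets := by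
  have hlog := half_lt_log hP.two_le_N
  have hε := hP.ε_pos
  have hε1 : P.ε ^ 2 < 1 := by nlinarith [hP.ε_lt]
  have hκ : 10 ^ 5 * Real.log P.N ≤ P.κ * Real.log P.N := by
    gcongr
    exact hP.le_κ
  rw [β_eq] at h
  have : (2 * j + 2 : ℝ) ≤ P.κ / P.ε ^ 2 * Real.log P.N := by
    rw [div_mul_eq_mul_div, le_div_iff₀ (by positivity)]
    linarith
  exact_mod_cast this.trans (Nat.le_ceil _)

end Parameters

section Decay

theorem le_pow_mul_getElem_zero {α : Type*} {f : α → ℝ} {l : List α} {q : ℝ} (hq : 0 ≤ q)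
    (h : ∀ i (hi : i + 2 < l.length), f l[i + 2] ≤ q * f l[i]) (j : ℕ) (hj : 2 * j < l.length) :
    f l[2 * j] ≤ q ^ j * f l[0] := by
  induction j with
  | zero => simp
  | succ j ih =>
    calc f l[2 * j + 2] ≤ q * f l[2 * j] := h (2 * j) hj
      _ ≤ q * (q ^ j * f l[0]) := mul_le_mul_of_nonneg_left (ih (by omega)) hq
      _ = q ^ (j + 1) * f l[0] := by ring

theorem mul_le_log_of_one_le_pow_mul {c B : ℝ} {j : ℕ} (hc : c ≤ 1) (hB : 0 < B)
    (h : 1 ≤ (1 - c) ^ j * B) : c * j ≤ Real.log B := by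
  have : (1 - c) ^ j ≤ Real.exp (-(c * j)) := by
    calc (1 - c) ^ j ≤ Real.exp (-c) ^ j :=
          pow_le_pow_left₀ (by linarith) (Real.one_sub_le_exp_neg c) j
      _ = Real.exp (-(c * j)) := by rw [← Real.exp_nat_mul]; ring_nf
  have : 1 ≤ Real.exp (-(c * j) + Real.log B) := by
    rw [Real.exp_add, Real.exp_log hB]
    exact h.trans (mul_le_mul_of_nonneg_right this hB.le)
  linarith [Real.one_le_exp_iff.1 this]

end Decay

section Correctness

variable {P : Params}

/-- All sketches that matter for the answer at time `n` are accurate: those of the segments that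
start less than about `8 N²` before `n`. -/
structure Accurate (ω : P.Seed) (x : ℕ → Fin P.u) (n : ℕ) : Prop where
  close_of : ∀ a b t, a < b → b < t → t ≤ n → n ≤ a + 8 * P.N ^ 2 →
    segF2 x a t - segF2 x b t ≤ P.β / 2 * segF2 x a t →
      Close (bucketAt ω x a t) (bucketAt ω x b t)
  of_close : ∀ a b t, a < b → b < t → t ≤ n → n ≤ a + 8 * P.N ^ 2 →
    Close (bucketAt ω x a t) (bucketAt ω x b t) →
      segF2 x a t - segF2 x b t ≤ 4 * P.β * segF2 x a t
  l2 : ∀ a, a < n → n ≤ a + 8 * P.N ^ 2 →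
    l2Estimate P (bucketAt ω x a n).l2 ∈
      Set.Icc ((1 - P.ε) * √(segF2 x a n)) ((1 + P.ε) * √(segF2 x a n))
  cs : ∀ a s, a ≤ s → s < n → n ≤ a + 8 * P.N ^ 2 →
    |(csEstimate P ω (bucketAt ω x a (s + 1)).cs (x s) : ℝ) - freq x a (s + 1) (x s)| ≤
      P.γ * P.ε / 8 * √(segF2 x a (s + 1))

variable {ω : P.Seed} {x : ℕ → Fin P.u} {n t M K : ℕ} {l : List ℕ}

theorem sqrt_expired_le (hε : 0 < P.ε) {a w : ℕ} (h : segF2 x a w ≤ 4 * P.β * segF2 x a t) :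
    √(segF2 x a w) ≤ 3 / 4 * P.ε * √(segF2 x a t) := by
  rw [Real.sqrt_le_left (by positivity), mul_pow, Real.sq_sqrt (segF2_nonneg x _ _)]
  refine h.trans ?_
  rw [β_eq]
  nlinarith [mul_nonneg (sq_nonneg P.ε) (segF2_nonneg x a t)]

theorem HistInv.segF2_expired_le (hN : 0 < P.N) (h : HistInv ω x t M P.N l)
    (hA : Accurate ω x n) (htn : t ≤ n) {a : ℕ} (ha : a ∈ l.head?) (haN : a ≤ t - P.N)
    (hna : n ≤ a + 8 * P.N ^ 2) :
    segF2 x a (t - P.N) ≤ 4 * P.β * segF2 x a t := by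
  rcases haN.eq_or_lt with rfl | hlt
  · rw [segF2, freqVec_self, zero_dotProduct]
    exact mul_nonneg (mul_nonneg (by norm_num) (β_nonneg P)) (segF2_nonneg x _ t)
  rcases l with _ | ⟨a', _ | ⟨b, l⟩⟩
  · simp at ha
  · obtain rfl : a' = a := by simpa using ha
    have := h.last a' rfl
    omega
  · obtain rfl : a' = a := by simpa using ha
    have hb := h.tail_lt b (by simp)
    have hbt := h.lt b (by simp)
    rcases (List.isChain_cons_cons.1 h.linked).1 with rfl | ⟨s, hst, hbs, hclose⟩
    · omega
    have hab : a' < b := by omega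
    calc segF2 x a' (t - P.N) ≤ segF2 x a' b := segF2_mono_right x haN (by omega)
      _ ≤ segF2 x a' s - segF2 x b s := by linarith [segF2_add_le x hab.le hbs.le]
      _ ≤ 4 * P.β * segF2 x a' s := hA.of_close a' b s hab hbs (hst.trans htn) hna hclose
      _ ≤ 4 * P.β * segF2 x a' t := mul_le_mul_of_nonneg_left
          (segF2_mono_right x (by omega) hst) (mul_nonneg (by norm_num) (β_nonneg P))

theorem HistInv.one_le_pow_mul (h : HistInv ω x t M K l) (hβ : P.β / 2 ≤ 1)
    (hl : 0 < l.length)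
    (hfar : ∀ i (hi : i + 2 < l.length),
      P.β / 2 * segF2 x l[i] t < segF2 x l[i] t - segF2 x l[i + 2] t) :
    (1 : ℝ) ≤ (1 - P.β / 2) ^ ((l.length - 1) / 2) * (M : ℝ) ^ 2 := by
  set j := (l.length - 1) / 2
  have hj : 2 * j < l.length := by omega
  have hdecay := le_pow_mul_getElem_zero (f := (segF2 x · t)) (sub_nonneg.2 hβ)
    (fun i hi => by linarith [hfar i hi]) j hj
  have hlt := h.lt _ (List.getElem_mem hj)
  calc (1 : ℝ) ≤ ((t - l[2 * j] : ℕ) : ℝ) := by exact_mod_cast (by omega : 1 ≤ t - l[2 * j])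
    _ ≤ segF2 x l[2 * j] t := length_le_segF2 x _ t
    _ ≤ (1 - P.β / 2 : ℝ) ^ j * segF2 x l[0] t := hdecay
    _ ≤ (1 - P.β / 2) ^ j * (M : ℝ) ^ 2 := by
      refine mul_le_mul_of_nonneg_left ((segF2_le_length_sq x _ t).trans ?_)
        (pow_nonneg (sub_nonneg.2 hβ) j)
      gcongr
      exact h.size_le _ (List.getElem_mem hl)

theorem length_mergedStarts_le (hP : P.Valid)
    (h : HistInv ω x (t + 1) (P.maxSize + 1) P.N (mergedStarts ω x t l)) (hA : Accurate ω x n)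
    (htn : t + 1 ≤ n) (hnt : n ≤ t + P.N) : (mergedStarts ω x t l).length ≤ P.maxBuckets := by
  have hN := hP.two_le_N
  have hN2 : 2 * P.N ≤ P.N ^ 2 := by nlinarith
  have hβ : P.β / 2 ≤ 1 := by
    rw [β_eq]
    nlinarith [hP.ε_lt, hP.ε_pos]
  have hpos := List.length_pos_iff.2 (h.ne_nil t.succ_pos)
  have hdecay := h.one_le_pow_mul hβ hpos fun i hi => by
    have hmem := List.getElem_mem (show i < (mergedStarts ω x t l).length by omega)
    have hsize := h.size_le _ hmem
    have := h.lt _ hmem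
    simp only [Params.maxSize] at hsize
    by_contra! hsmall
    exact not_close_getElem_mergedStarts t l i hi <|
      hA.close_of _ _ (t + 1) (List.pairwise_iff_getElem.1 h.sorted _ _ _ _ (by omega))
        (h.lt _ (List.getElem_mem _)) htn (by omega) hsmall
  have hlog := mul_le_log_of_one_le_pow_mul hβ (by positivity) hdecay
  have hsize : Real.log (((P.maxSize + 1 : ℕ) : ℝ) ^ 2) ≤ 10 * Real.log P.N := by
    rw [Real.log_pow, Nat.cast_add_one]
    have := Real.log_le_log (by positivity) (maxSize_add_one_le hN)
    rw [Real.log_pow] at this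
    push_cast at this ⊢
    linarith
  have := two_mul_add_two_le_maxBuckets hP (hlog.trans hsize)
  omega

theorem size_le_of_sqrt_expired_le {a w N : ℕ} {ε : ℝ} (hε : ε ≤ 1 / 8) (haw : a ≤ w)
    (hwt : w ≤ t) (hN : t - w ≤ N) (h : √(segF2 x a w) ≤ 3 / 4 * ε * √(segF2 x a t)) :
    t - a ≤ 4 * N ^ 2 := by
  have hwindow : √(segF2 x w t) ≤ N := by
    rw [Real.sqrt_le_left (by positivity)]
    exact (segF2_le_length_sq x w t).trans (by gcongr)
  have hle : √(segF2 x a t) ≤ 2 * N := by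
    nlinarith [sqrt_segF2_le_add x haw hwt, Real.sqrt_nonneg (segF2 x a t)]
  have hsize : ((t - a : ℕ) : ℝ) ≤ 4 * (N : ℝ) ^ 2 := by
    rw [Real.sqrt_le_left (by positivity), mul_pow] at hle
    linarith [length_le_segF2 x a t]
  exact_mod_cast hsize

theorem HistInv.size_le_of_accurate (hP : P.Valid)
    (h : HistInv ω x (t + 1) (P.maxSize + 1) P.N l) (hA : Accurate ω x n) (htn : t + 1 ≤ n)
    (hnt : n ≤ t + P.N) : ∀ a ∈ l, t + 1 - a ≤ P.maxSize := by
  have hN := hP.two_le_N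
  have hN2 : 2 * P.N ≤ P.N ^ 2 := by nlinarith
  have hM : P.maxSize = 4 * P.N ^ 2 := rfl
  intro a ha
  by_cases hhead : a ∈ l.head?
  · by_contra! hlarge
    have := h.size_le a ha
    have := h.lt a ha
    have hexpired := h.segF2_expired_le (by omega) hA htn hhead (by omega) (by omega)
    have := size_le_of_sqrt_expired_le hP.ε_lt.le (by omega) (Nat.sub_le _ _)
      (by omega : t + 1 - (t + 1 - P.N) ≤ P.N) (sqrt_expired_le hP.ε_pos hexpired)
    omega
  · cases l with
    | nil => simp at ha
    | cons b l =>
      have := h.tail_lt a ((List.mem_cons.1 ha).resolve_left fun hab => hhead (by simp [hab]))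
      omega

theorem trimStarts_eq_self (hsize : ∀ a ∈ l, t - a ≤ P.maxSize) (hlen : l.length ≤ P.maxBuckets) :
    trimStarts P t l = l := by
  have : l.filter (fun a => t - a ≤ P.maxSize) = l := by simpa using hsize
  rw [trimStarts, this, Nat.sub_eq_zero_of_le hlen, List.drop_zero]

theorem head_bucketStarts_le (hP : P.Valid) (hA : Accurate ω x n) (ht : n - P.N + 1 ≤ t)
    (htn : t ≤ n) : ∀ a ∈ (bucketStarts ω x t).head?, a ≤ n - P.N := by
  have hN : 0 < P.N := by have := hP.two_le_N; omega
  have hB := one_le_maxBuckets hP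
  induction t, ht using Nat.le_induction with
  | base =>
    intro a ha
    have := (histInv_bucketStarts hN hB _).lt a (List.mem_of_mem_head? ha)
    omega
  | succ t ht ih =>
    have hinv := histInv_bucketStarts (ω := ω) (x := x) hN hB t
    have hmerged := hinv.mergedStarts hN
    rw [bucketStarts, trimStarts_eq_self
      (hmerged.size_le_of_accurate hP hA htn (by omega))
      (length_mergedStarts_le hP hmerged hA htn (by omega))]
    intro a ha
    rcases mem_head?_or_of_mem_head?_mergedStarts t _ a ha with hold | hfull
    · rw [List.head?_append_of_ne_nil _ (hinv.ne_nil (by omega))] at hold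
      exact ih (by omega) a hold
    · omega

end Correctness

section Output

theorem threshold_mem_Icc {γ ε A L : ℝ} (hγ : 0 ≤ γ) (hε : 0 < ε) (hA : 0 ≤ A)
    (hL : L ∈ Set.Icc ((1 - ε) * A) ((1 + ε) * A)) :
    1 / (1 + ε) * γ * L ∈ Set.Icc ((1 - 2 * ε) * (γ * A)) (γ * A) := by
  have hγA := mul_nonneg hγ hA
  rw [one_div_mul_eq_div, div_mul_eq_mul_div, Set.mem_Icc, le_div_iff₀ (by linarith),
    div_le_iff₀ (by linarith)]
  constructor
  · nlinarith [mul_le_mul_of_nonneg_left hL.1 hγ, mul_nonneg (sq_nonneg ε) hγA]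
  · linarith [mul_le_mul_of_nonneg_left hL.2 hγ]

theorem heavy_of_heavy_window {γ ε A W w f : ℝ} (hγ : 0 ≤ γ) (hε : 0 ≤ ε) (hε1 : ε ≤ 1 / 8)
    (hA : 0 ≤ A) (hWA : (1 - 3 / 4 * ε) * A ≤ W) (hw : (1 + 4 * ε) * γ * W ≤ w) (hwf : w ≤ f) :
    (1 + 2 * ε) * (γ * A) ≤ f := by
  calc (1 + 2 * ε) * (γ * A) ≤ (1 + 4 * ε) * (1 - 3 / 4 * ε) * (γ * A) :=
        mul_le_mul_of_nonneg_right (by nlinarith) (mul_nonneg hγ hA)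
    _ = (1 + 4 * ε) * γ * ((1 - 3 / 4 * ε) * A) := by ring
    _ ≤ (1 + 4 * ε) * γ * W := by gcongr
    _ ≤ f := hw.trans hwf

theorem heavy_window_of_heavy {γ ε A W e w v : ℝ} (hγ : 0 < γ) (hγ1 : γ < 1) (hε : 0 < ε)
    (hA : 0 ≤ A) (hWA : W ≤ A) (hW : 0 ≤ W) (hw : 0 ≤ w) (he : e ≤ 3 / 4 * ε * A)
    (hv : v - (e + w) ≤ γ * ε / 8 * A) (hheavy : (1 - 2 * ε) * (γ * A) ≤ v) :
    (1 - 4 / γ * ε) * γ * W ≤ w := by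
  have hfactor : (1 - 4 / γ * ε) * γ = γ - 4 * ε := by field_simp
  have hγεA : γ * (ε * A) ≤ ε * A := mul_le_of_le_one_left (by positivity) hγ1.le
  rw [hfactor]
  rcases le_total γ (4 * ε) with hsmall | hlarge
  · exact (mul_nonpos_of_nonpos_of_nonneg (by linarith) hW).trans hw
  · calc (γ - 4 * ε) * W ≤ (γ - 4 * ε) * A :=
          mul_le_mul_of_nonneg_left hWA (by linarith)
      _ ≤ w := by nlinarith

variable {P : Params} {ω : P.Seed} {x : ℕ → Fin P.u} {n : ℕ}

theorem mem_freqReport {A : Bucket P} {L : List (Bucket P)} {i : Fin P.u} :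
    i ∈ freqReport P (A :: L) ↔
      ∃ v, (i, v) ∈ A.cand ∧ 1 / (1 + P.ε) * P.γ * l2Estimate P A.l2 < (v : ℝ) := by
  simp [freqReport]

theorem exists_output_eq_freqReport (hP : P.Valid) (hn : 1 ≤ n) (hA : Accurate ω x n) :
    ∃ a L, (freqAlgorithm P).output ω x n = freqReport P (bucketAt ω x a n :: L) ∧ a < n ∧
      a ≤ n - P.N ∧ n ≤ a + 8 * P.N ^ 2 ∧
      √(segF2 x a (n - P.N)) ≤ 3 / 4 * P.ε * √(segF2 x a n) := by
  have hN : 0 < P.N := by have := hP.two_le_N; omega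
  have hB := one_le_maxBuckets hP
  have hinv := histInv_bucketStarts (ω := ω) (x := x) hN hB n
  have hhead := head_bucketStarts_le hP hA (by omega) le_rfl
  obtain ⟨a, l, hal⟩ := List.exists_cons_of_ne_nil (hinv.ne_nil hn)
  rw [hal] at hinv hhead
  have hlt := hinv.lt a (by simp)
  have hwindow := hhead a rfl
  have hsize : n ≤ a + 8 * P.N ^ 2 := by
    have := hinv.size_le a (by simp)
    simp only [Params.maxSize] at this
    omega
  refine ⟨a, l.map (bucketAt ω x · n), ?_, hlt, hwindow, hsize,
    sqrt_expired_le hP.ε_pos (hinv.segF2_expired_le hN hA le_rfl rfl hwindow hsize)⟩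
  change freqReport P ((freqAlgorithm P).run ω x n) = _
  rw [run_freqAlgorithm hN hB, hal, List.map_cons]

theorem Accurate.candInv (hA : Accurate ω x n) (hγ : 0 ≤ P.γ) (hε : 0 ≤ P.ε) {a : ℕ} (han : a ≤ n)
    (hna : n ≤ a + 8 * P.N ^ 2) :
    CandInv P.listLen (bucketAt ω x a n).cand (freq x a n)
      (P.γ * P.ε / 8 * √(segF2 x a n)) := by
  refine candInv_bucketAt ω x han fun s has hsn => (hA.cs a s has hsn hna).trans ?_
  gcongr
  exact segF2_mono_right x (by omega) hsn

theorem listLen_mul_sq_gt (hγ : 0 < P.γ) {A : ℝ} (hA : 0 < A) :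
    A ^ 2 < P.listLen * (P.γ * A) ^ 2 := by
  have hlen : 1 / P.γ ^ 2 < (P.listLen : ℝ) := by
    rw [Params.listLen, Nat.cast_add_one]
    exact Nat.lt_floor_add_one _
  rw [div_lt_iff₀ (by positivity)] at hlen
  calc A ^ 2 = 1 * A ^ 2 := (one_mul _).symm
    _ < P.listLen * P.γ ^ 2 * A ^ 2 := by gcongr
    _ = P.listLen * (P.γ * A) ^ 2 := by ring

/-- Correctness of the answer at time `n`: the heavy elements are reported and the light ones are
not, with the tolerances `4 ε` and `4 ε / γ`. -/
def Correct (ω : P.Seed) (x : ℕ → Fin P.u) (n : ℕ) : Prop :=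
  (∀ i, (1 + 4 * P.ε) * P.γ * winL2 P.N x n ≤ winFreq P.N x n i →
    i ∈ (freqAlgorithm P).output ω x n) ∧
  (∀ i, (winFreq P.N x n i : ℝ) < (1 - 4 / P.γ * P.ε) * P.γ * winL2 P.N x n →
    i ∉ (freqAlgorithm P).output ω x n)

theorem Accurate.correct (hP : P.Valid) (hn : 1 ≤ n) (hA : Accurate ω x n) : Correct ω x n := by
  have hγ := hP.γ_pos
  have hε := hP.ε_pos
  obtain ⟨a, L, houtput, han, haw, hna, hexpired⟩ := exists_output_eq_freqReport hP hn hA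
  have hwn : n - P.N ≤ n := Nat.sub_le n P.N
  have hApos : 0 < √(segF2 x a n) := Real.sqrt_pos.2 (segF2_pos x han)
  have hγA : 0 < P.γ * √(segF2 x a n) := mul_pos hγ hApos
  have hthreshold := threshold_mem_Icc hγ.le hε hApos.le (hA.l2 a han hna)
  have hcand := hA.candInv hγ.le hε.le han.le hna
  have hfreq : ∀ i, (freq x a n i : ℝ) =
      freqVec x a (n - P.N) i + winFreq P.N x n i := fun i => by
    rw [freq_add x haw hwn, Nat.cast_add]
    rfl
  have hcandidates : ∑ i, (freq x a n i : ℝ) ^ 2 < P.listLen * (P.γ * √(segF2 x a n)) ^ 2 := by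
    convert listLen_mul_sq_gt hγ hApos using 1
    rw [Real.sq_sqrt (segF2_nonneg x a n)]
    simp only [segF2, dotProduct, freqVec, sq]
  have hwinL2 : winL2 P.N x n = √(segF2 x (n - P.N) n) := by
    simp only [winL2, segF2, dotProduct, ← sq]
    rfl
  rw [Correct, houtput, hwinL2]
  simp only [mem_freqReport]
  constructor
  · intro i hi
    have hheavy := heavy_of_heavy_window hγ.le hε.le hP.ε_lt.le hApos.le
      (by linarith [sqrt_segF2_le_add x haw hwn]) hi
      ((le_add_of_nonneg_left (freqVec_nonneg x a _ i)).trans (hfreq i).ge)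
    have hmem := hcand.mem_of_le (by positivity) hγA
      hcandidates (q := i) (by nlinarith)
    obtain ⟨⟨j, v⟩, hv, rfl⟩ := List.mem_map.1 hmem
    have hcount := (abs_le.1 (hcand.accurate _ hv)).1
    refine ⟨v, hv, hthreshold.2.trans_lt ?_⟩
    dsimp only at hheavy hcount
    nlinarith
  · rintro i hi ⟨v, hv, hlt⟩
    have hcount := (abs_le.1 (hcand.accurate _ hv)).2
    rw [hfreq i] at hcount
    exact hi.not_ge <| heavy_window_of_heavy hγ hP.γ_lt hε hApos.le
      (Real.sqrt_le_sqrt (segF2_mono_left x haw hwn)) (Real.sqrt_nonneg _) (Nat.cast_nonneg _)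
      ((freqVec_le_sqrt_segF2 x a _ i).trans hexpired) hcount (hthreshold.1.trans hlt.le)

end Output

section InnerEstimate

open Finset
open scoped BigOperators Matrix

variable {Ω ι κ : Type*} [Fintype Ω] [Fintype ι] [Fintype κ]

/-- The estimate of the inner product `f ⬝ᵥ g` by a row of the `L₂` sketch with the sign vectors
`s c`. It is bilinear in `(f, g)`, so the difference of the squared norms of two nested buckets is
estimated by an inner product. -/
noncomputable def innerEstimate (s : κ → ι → ℝ) (f g : ι → ℝ) : ℝ :=
  𝔼 c, (f ⬝ᵥ s c) * (g ⬝ᵥ s c)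

/-- The row with sign vectors `s` estimates `f ⬝ᵥ g` up to an error `η ‖f‖ ‖g‖`. -/
def InnerAccurate (η : ℝ) (s : κ → ι → ℝ) (f g : ι → ℝ) : Prop :=
  |innerEstimate s f g - f ⬝ᵥ g| ≤ η * √((f ⬝ᵥ f) * (g ⬝ᵥ g))

theorem dotProduct_self_nonneg (f : ι → ℝ) : 0 ≤ f ⬝ᵥ f := by
  simpa using dotProduct_self_star_nonneg f

theorem dotProduct_self_pos {f : ι → ℝ} (hf : f ≠ 0) : 0 < f ⬝ᵥ f := by
  simpa using Matrix.dotProduct_self_star_pos_iff.2 hf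

theorem innerEstimate_self_nonneg (s : κ → ι → ℝ) (f : ι → ℝ) : 0 ≤ innerEstimate s f f :=
  Finset.expect_nonneg fun _ _ => mul_self_nonneg _

theorem innerEstimate_add_self_sub (s : κ → ι → ℝ) (f g : ι → ℝ) :
    innerEstimate s (f + g) (f + g) - innerEstimate s g g = innerEstimate s f (f + g + g) := by
  simp only [innerEstimate, ← Finset.expect_sub_distrib, add_dotProduct]
  exact Finset.expect_congr rfl fun c _ => by ring

theorem InnerAccurate.abs_innerEstimate_self_sub_le {η : ℝ} {s : κ → ι → ℝ} {f : ι → ℝ}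
    (h : InnerAccurate η s f f) : |innerEstimate s f f - f ⬝ᵥ f| ≤ η * (f ⬝ᵥ f) := by
  rwa [InnerAccurate, Real.sqrt_mul_self (dotProduct_self_nonneg f)] at h

theorem innerAccurate_zero_left (η : ℝ) (s : κ → ι → ℝ) (g : ι → ℝ) : InnerAccurate η s 0 g := by
  simp [InnerAccurate, innerEstimate]

theorem innerAccurate_zero_right (η : ℝ) (s : κ → ι → ℝ) (f : ι → ℝ) : InnerAccurate η s f 0 := by
  simp [InnerAccurate, innerEstimate]

theorem pr_not_innerAccurate_le [DecidableEq κ] [Nonempty Ω] [Nonempty κ] {k : ℕ} {s : Ω → ι → ℝ}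
    (hs : UncorrelatedSigns k s) (hk : 4 ≤ k) {η : ℝ} (hη : 0 < η) (f g : ι → ℝ) :
    pr (fun ρ : κ → Ω => ¬ InnerAccurate η (s ∘ ρ) f g) ≤ 3 / (Fintype.card κ * η ^ 2) := by
  have hcard : (0 : ℝ) < Fintype.card κ := by exact_mod_cast Fintype.card_pos
  have hbound : 0 ≤ 3 / (Fintype.card κ * η ^ 2) := by positivity
  rcases eq_or_ne f 0 with rfl | hf
  · simpa [pr, innerAccurate_zero_left] using hbound
  rcases eq_or_ne g 0 with rfl | hg
  · simpa [pr, innerAccurate_zero_right] using hbound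
  have hfg : 0 < (f ⬝ᵥ f) * (g ⬝ᵥ g) := 
    mul_pos (dotProduct_self_pos hf) (dotProduct_self_pos hg)
  have chebyshev := sq_mul_pr_lt_abs_sum_sub_le
    (fun (_ : κ) (ω : Ω) => (f ⬝ᵥ s ω) * (g ⬝ᵥ s ω))
    (t := Fintype.card κ * (η * √((f ⬝ᵥ f) * (g ⬝ᵥ g)))) (by positivity)
  simp only [hs.expect_dotProduct_mul_dotProduct (by omega), Finset.sum_const, Finset.card_univ,
    nsmul_eq_mul] at chebyshev
  have hfails (ρ : κ → Ω) : (¬ InnerAccurate η (s ∘ ρ) f g) ↔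
      Fintype.card κ * (η * √((f ⬝ᵥ f) * (g ⬝ᵥ g))) <
        |∑ c, (f ⬝ᵥ s (ρ c)) * (g ⬝ᵥ s (ρ c)) - Fintype.card κ * (f ⬝ᵥ g)| := by
    rw [InnerAccurate, not_le, ← mul_lt_mul_iff_right₀ hcard, innerEstimate,
      Fintype.expect_eq_sum_div_card, ← abs_of_pos hcard, ← abs_mul, abs_of_pos hcard, mul_sub,
      mul_div_cancel₀ _ hcard.ne']
    rfl
  simp only [hfails]
  rw [le_div_iff₀ (by positivity)]
  refine le_of_mul_le_mul_right ?_ (mul_pos hcard hfg)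
  calc _ = (Fintype.card κ * (η * √((f ⬝ᵥ f) * (g ⬝ᵥ g)))) ^ 2 *
        pr (fun ρ : κ → Ω => Fintype.card κ * (η * √((f ⬝ᵥ f) * (g ⬝ᵥ g))) <
          |∑ c, (f ⬝ᵥ s (ρ c)) * (g ⬝ᵥ s (ρ c)) - Fintype.card κ * (f ⬝ᵥ g)|) := by
        rw [mul_pow, mul_pow, Real.sq_sqrt hfg.le]
        ring
    _ ≤ Fintype.card κ * (3 * ((f ⬝ᵥ f) * (g ⬝ᵥ g))) := chebyshev.trans <| by
        gcongr
        exact hs.expect_sq_dotProduct_mul_dotProduct_le hk f g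
    _ = 3 * (Fintype.card κ * ((f ⬝ᵥ f) * (g ⬝ᵥ g))) := by ring

theorem InnerAccurate.sq_difference_le {η : ℝ} {s : κ → ι → ℝ} {f g : ι → ℝ}
    (h : InnerAccurate η s f (f + g + g)) (hf : 0 ≤ f) (hg : 0 ≤ g) :
    (innerEstimate s (f + g) (f + g) - innerEstimate s g g -
        ((f + g) ⬝ᵥ (f + g) - g ⬝ᵥ g)) ^ 2 ≤
      4 * η ^ 2 * ((f + g) ⬝ᵥ (f + g) - g ⬝ᵥ g) * ((f + g) ⬝ᵥ (f + g)) := by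
  have hff := dotProduct_self_nonneg f
  have hfg : 0 ≤ f ⬝ᵥ g := dotProduct_nonneg_of_nonneg hf hg
  have hcomm : g ⬝ᵥ f = f ⬝ᵥ g := dotProduct_comm g f
  rw [innerEstimate_add_self_sub]
  have hD : (f + g) ⬝ᵥ (f + g) - g ⬝ᵥ g = f ⬝ᵥ (f + g + g) := by
    simp only [add_dotProduct, dotProduct_add, hcomm]
    ring
  have hle : f ⬝ᵥ f ≤ f ⬝ᵥ (f + g + g) := by
    simp only [dotProduct_add]
    linarith
  have hle4 : (f + g + g) ⬝ᵥ (f + g + g) ≤ 4 * ((f + g) ⬝ᵥ (f + g)) := by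
    simp only [add_dotProduct, dotProduct_add, hcomm]
    linarith [dotProduct_self_nonneg f]
  rw [hD, ← sq_abs]
  calc |innerEstimate s f (f + g + g) - f ⬝ᵥ (f + g + g)| ^ 2
      ≤ (η * √((f ⬝ᵥ f) * ((f + g + g) ⬝ᵥ (f + g + g)))) ^ 2 := pow_le_pow_left₀ (abs_nonneg _) h 2
    _ = η ^ 2 * ((f ⬝ᵥ f) * ((f + g + g) ⬝ᵥ (f + g + g))) := by
      rw [mul_pow, Real.sq_sqrt (mul_nonneg hff (dotProduct_self_nonneg _))]
    _ ≤ η ^ 2 * ((f ⬝ᵥ (f + g + g)) * (4 * ((f + g) ⬝ᵥ (f + g)))) := by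
      gcongr
      exacts [dotProduct_self_nonneg _, hff.trans hle]
    _ = 4 * η ^ 2 * (f ⬝ᵥ (f + g + g)) * ((f + g) ⬝ᵥ (f + g)) := by ring

theorem sq_one_sub_mul_le_of_difference_le {β F D S T : ℝ} (hβ : 0 ≤ β) (hβ1 : β ≤ 1 / 8)
    (hF : 0 ≤ F) (hS : |S - F| ≤ 1 / 4 * F) (hST : (S - T - D) ^ 2 ≤ β / 32 * D * F)
    (hD : D ≤ β / 2 * F) : (1 - β) ^ 2 * S ≤ T := by
  have hβF := mul_nonneg hβ hF
  have herr : |S - T - D| ≤ β * F / 8 := by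
    refine abs_le_of_sq_le_sq (hST.trans ?_) (by positivity)
    nlinarith
  have hS' : 3 / 4 * F ≤ S := by linarith [(abs_le.1 hS).1]
  have hdiff : S - T ≤ 5 / 8 * (β * F) := by linarith [(abs_le.1 herr).2]
  have hβS : 3 / 4 * (β * F) ≤ β * S := by nlinarith
  have : 0 ≤ (1 - β) * (β * S) := mul_nonneg (by linarith) (by linarith)
  linarith

theorem lt_sq_one_sub_mul_of_lt_difference {β F D S T : ℝ} (hβ : 0 ≤ β) (hF : 0 ≤ F)
    (hS : |S - F| ≤ 1 / 4 * F) (hST : (S - T - D) ^ 2 ≤ β / 32 * D * F)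
    (hD : 4 * β * F < D) : T < (1 - β) ^ 2 * S := by
  have hβF := mul_nonneg hβ hF
  have herr : |S - T - D| ≤ D / 8 := by
    refine abs_le_of_sq_le_sq (hST.trans ?_) (by linarith)
    nlinarith
  have hS' : S ≤ 5 / 4 * F := by linarith [(abs_le.1 hS).2]
  have hdiff : 7 / 8 * D ≤ S - T := by linarith [(abs_le.1 herr).1]
  have hβS : β * S ≤ 5 / 4 * (β * F) := by nlinarith
  have : 0 ≤ β ^ 2 * S := mul_nonneg (sq_nonneg β) (by linarith [(abs_le.1 hS).1])
  linarith

end InnerEstimate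

section Majority

variable {r : ℕ} {bad p : Fin r → Prop}

theorem two_mul_card_lt_of_imp (h : 2 * Nat.card {i // bad i} < r) (hp : ∀ i, p i → bad i) :
    2 * Nat.card {i // p i} < r :=
  (Nat.mul_le_mul_left 2 (Nat.card_le_card_of_injective (Subtype.map id hp)
    (Subtype.map_injective hp Function.injective_id))).trans_lt h

theorem lt_two_mul_card_of_or (h : 2 * Nat.card {i // bad i} < r) (hp : ∀ i, bad i ∨ p i) :
    r < 2 * Nat.card {i // p i} := by
  classical
  have hnot := two_mul_card_lt_of_imp h fun i hi => (hp i).resolve_right hi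
  have hcompl := Fintype.card_subtype_compl p
  have hle := Fintype.card_subtype_le p
  rw [Nat.card_eq_fintype_card] at hnot ⊢
  rw [Fintype.card_fin] at hcompl hle
  omega

end Majority

section Rows

open Finset
open scoped BigOperators

variable {P : Params}

theorem u_le_two_pow (P : Params) : P.u ≤ 2 ^ (P.hashBits + 1) :=
  (Nat.le_pow_clog (by norm_num) _).trans
    (Nat.pow_le_pow_right (by norm_num) ((le_max_left _ _).trans (Nat.le_succ _)))

theorem cellBits_le (P : Params) : P.cellBits ≤ P.hashBits + 1 :=
  (le_max_right _ _).trans (Nat.le_succ _)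

theorem le_two_pow_cellBits (P : Params) :
    256 / (P.γ ^ 2 * P.csEps ^ 2) ≤ (2 : ℝ) ^ P.cellBits := by
  have : ⌈256 / (P.γ ^ 2 * P.csEps ^ 2)⌉₊ ≤ 2 ^ P.cellBits := Nat.le_pow_clog (by norm_num) _
  exact (Nat.le_ceil _).trans (by exact_mod_cast this)

theorem cols_pos (hP : P.Valid) : 0 < P.cols := by
  have hκ := hP.le_κ
  have hε := hP.ε_pos
  exact Nat.ceil_pos.2 (div_pos (by linarith) (by positivity))

theorem le_cols_mul_sq (hP : P.Valid) : 10 ^ 5 ≤ P.cols * P.ε ^ 2 := by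
  have hε := hP.ε_pos
  rw [← div_le_iff₀ (by positivity)]
  refine le_trans ?_ (Nat.le_ceil _)
  gcongr
  exact hP.le_κ

/-- Random choices of a row of the `L₂` sketch. -/
abbrev L2Seed (P : Params) : Type := Fin P.cols → Fin 4 → P.Word

theorem pr_l2Row_not_innerAccurate_le (hP : P.Valid) (f g : Fin P.u → ℝ) :
    pr (fun ρ : L2Seed P => ¬ InnerAccurate (P.ε / 32) (hashSign P.hashBits ∘ ρ) f g) ≤
      1 / 32 := by
  have hε := hP.ε_pos
  have : Nonempty (Fin P.cols) := ⟨⟨0, cols_pos hP⟩⟩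
  refine (pr_not_innerAccurate_le (uncorrelatedSigns_hashSign (u_le_two_pow P)) le_rfl
    (by positivity) f g).trans ?_
  have hcols := le_cols_mul_sq hP
  rw [Fintype.card_fin, div_pow, div_le_iff₀ (by linarith)]
  linarith

variable (ω : P.Seed) (x : ℕ → Fin P.u)

theorem cast_sum_sq_l2_div_cols {a t : ℕ} (h : a ≤ t) (r : Fin P.rows) :
    ((∑ c, (bucketAt ω x a t).l2 r c ^ 2 : ℤ) : ℝ) / P.cols =
      innerEstimate (hashSign P.hashBits ∘ ω.2 r) (freqVec x a t) (freqVec x a t) := by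
  rw [innerEstimate, Fintype.expect_eq_sum_div_card, Fintype.card_fin]
  simp only [Int.cast_sum, Int.cast_mul, bucketAt_l2 ω x h, sq, Function.comp_apply]

/-- A row of the `L₂` sketch estimates the norm of the segment `[a, t)` and the difference of the
squared norms of `[a, t)` and `[b, t)` accurately enough to compare the two segments. -/
def TestAccurate (ρ : L2Seed P) (a b t : ℕ) : Prop :=
  InnerAccurate (P.ε / 32) (hashSign P.hashBits ∘ ρ) (freqVec x a t) (freqVec x a t) ∧
    InnerAccurate (P.ε / 32) (hashSign P.hashBits ∘ ρ) (freqVec x a b)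
      (freqVec x a b + freqVec x b t + freqVec x b t)

theorem pr_not_testAccurate_le (hP : P.Valid) (a b t : ℕ) :
    pr (fun ρ : L2Seed P => ¬ TestAccurate x ρ a b t) ≤ 1 / 15 := by
  simp only [TestAccurate, not_and_or]
  exact (pr_or_le _ _).trans <| (add_le_add (pr_l2Row_not_innerAccurate_le hP _ _)
    (pr_l2Row_not_innerAccurate_le hP _ _)).trans (by norm_num)

variable {x}

theorem TestAccurate.abs_sub_segF2_le (hP : P.Valid) {ρ : L2Seed P} {a b t : ℕ}
    (h : TestAccurate x ρ a b t) :
    |innerEstimate (hashSign P.hashBits ∘ ρ) (freqVec x a t) (freqVec x a t) - segF2 x a t| ≤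
      1 / 4 * segF2 x a t := by
  refine h.1.abs_innerEstimate_self_sub_le.trans ?_
  exact mul_le_mul_of_nonneg_right (by linarith [hP.ε_lt]) (segF2_nonneg x a t)

theorem TestAccurate.sq_difference_le {ρ : L2Seed P} {a b t : ℕ}
    (h : TestAccurate x ρ a b t) (hab : a ≤ b) (hbt : b ≤ t) :
    (innerEstimate (hashSign P.hashBits ∘ ρ) (freqVec x a t) (freqVec x a t) -
        innerEstimate (hashSign P.hashBits ∘ ρ) (freqVec x b t) (freqVec x b t) -
        (segF2 x a t - segF2 x b t)) ^ 2 ≤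
      P.β / 32 * (segF2 x a t - segF2 x b t) * segF2 x a t := by
  have := h.2.sq_difference_le (freqVec_nonneg x a b) (freqVec_nonneg x b t)
  rw [← freqVec_add x hab hbt] at this
  refine this.trans_eq ?_
  rw [β_eq, segF2, segF2]
  ring

variable {ω} (hP : P.Valid) {a b t : ℕ} {r : Fin P.rows}
include hP

theorem l2Row_le_l2Row_iff (hab : a ≤ b) (hbt : b ≤ t) :
    (1 - P.β) * l2Row P (bucketAt ω x a t).l2 r ≤ l2Row P (bucketAt ω x b t).l2 r ↔
      (1 - P.β) ^ 2 *
          innerEstimate (hashSign P.hashBits ∘ ω.2 r) (freqVec x a t) (freqVec x a t) ≤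
        innerEstimate (hashSign P.hashBits ∘ ω.2 r) (freqVec x b t) (freqVec x b t) := by
  have hβ : 0 ≤ 1 - P.β := by rw [β_eq]; nlinarith [hP.ε_pos, hP.ε_lt]
  rw [l2Row, l2Row, cast_sum_sq_l2_div_cols ω x (hab.trans hbt), cast_sum_sq_l2_div_cols ω x hbt,
    ← Real.sqrt_sq hβ, ← Real.sqrt_mul (sq_nonneg _), Real.sqrt_sq hβ,
    Real.sqrt_le_sqrt_iff (innerEstimate_self_nonneg _ _)]

theorem TestAccurate.l2Row_le_l2Row (h : TestAccurate x (ω.2 r) a b t) (hab : a ≤ b) (hbt : b ≤ t)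
    (hD : segF2 x a t - segF2 x b t ≤ P.β / 2 * segF2 x a t) :
    (1 - P.β) * l2Row P (bucketAt ω x a t).l2 r ≤ l2Row P (bucketAt ω x b t).l2 r := by
  rw [l2Row_le_l2Row_iff hP hab hbt]
  exact sq_one_sub_mul_le_of_difference_le (β_nonneg P)
    (by rw [β_eq]; nlinarith [hP.ε_pos, hP.ε_lt])
    (segF2_nonneg x a t) (h.abs_sub_segF2_le hP) (h.sq_difference_le hab hbt) hD

theorem TestAccurate.not_l2Row_le_l2Row (h : TestAccurate x (ω.2 r) a b t) (hab : a ≤ b)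
    (hbt : b ≤ t) (hD : 4 * P.β * segF2 x a t < segF2 x a t - segF2 x b t) :
    ¬ (1 - P.β) * l2Row P (bucketAt ω x a t).l2 r ≤ l2Row P (bucketAt ω x b t).l2 r := by
  rw [l2Row_le_l2Row_iff hP hab hbt, not_le]
  exact lt_sq_one_sub_mul_of_lt_difference (β_nonneg P) (segF2_nonneg x a t)
    (h.abs_sub_segF2_le hP) (h.sq_difference_le hab hbt) hD

theorem close_of_majority (hab : a ≤ b) (hbt : b ≤ t)
    (h : 2 * Nat.card {r // ¬ TestAccurate x (ω.2 r) a b t} < P.rows)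
    (hD : segF2 x a t - segF2 x b t ≤ P.β / 2 * segF2 x a t) :
    Close (bucketAt ω x a t) (bucketAt ω x b t) :=
  lt_two_mul_card_of_or h fun _ => or_iff_not_imp_left.2 fun hr =>
    (not_not.1 hr).l2Row_le_l2Row hP hab hbt hD

theorem difference_le_of_majority (hab : a ≤ b) (hbt : b ≤ t)
    (h : 2 * Nat.card {r // ¬ TestAccurate x (ω.2 r) a b t} < P.rows)
    (hC : Close (bucketAt ω x a t) (bucketAt ω x b t)) :
    segF2 x a t - segF2 x b t ≤ 4 * P.β * segF2 x a t := by
  by_contra! hD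
  exact hC.not_gt <| two_mul_card_lt_of_imp h fun _ hr hacc =>
    hacc.not_l2Row_le_l2Row hP hab hbt hD hr

theorem l2Estimate_mem_of_majority (hat : a ≤ t)
    (h : 2 * Nat.card {r // ¬ InnerAccurate (P.ε / 32) (hashSign P.hashBits ∘ ω.2 r)
      (freqVec x a t) (freqVec x a t)} < P.rows) :
    l2Estimate P (bucketAt ω x a t).l2 ∈
      Set.Icc ((1 - P.ε) * √(segF2 x a t)) ((1 + P.ε) * √(segF2 x a t)) := by
  have hε := hP.ε_pos
  have hε1 := hP.ε_lt
  have hF := segF2_nonneg x a t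
  have hmono : Monotone fun z : ℤ => (z : ℝ) / P.cols := fun _ _ h => by dsimp only; gcongr
  have hmed := median_mem_of_ordConnected (fun r => ∑ c, (bucketAt ω x a t).l2 r c ^ 2)
    ((Set.ordConnected_Icc (a := (1 - P.ε) ^ 2 * segF2 x a t)
      (b := (1 + P.ε) ^ 2 * segF2 x a t)).preimage_mono hmono)
    (two_mul_card_lt_of_imp h fun r hr hacc => hr ?_)
  · have hsqrt {c : ℝ} (hc : 0 ≤ c) : √(c ^ 2 * segF2 x a t) = c * √(segF2 x a t) := by
      rw [Real.sqrt_mul (sq_nonneg c), Real.sqrt_sq hc]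
    rw [← hsqrt (by linarith), ← hsqrt (by linarith)]
    exact ⟨Real.sqrt_le_sqrt hmed.1, Real.sqrt_le_sqrt hmed.2⟩
  · rw [Set.mem_preimage, cast_sum_sq_l2_div_cols ω x hat]
    have hacc := abs_le.1 hacc.abs_innerEstimate_self_sub_le
    rw [← segF2] at hacc
    constructor <;> nlinarith [mul_nonneg hε.le hF]

end Rows

section CountSketchRows

variable {P : Params} (x : ℕ → Fin P.u)

/-- Random choices of a row of CountSketch. -/
abbrev CSSeed (P : Params) : Type := (Fin 2 → P.Word) × (Fin 2 → P.Word)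

/-- A row of CountSketch estimates the frequency of `q` in the segment `[a, t)` up to an error
`γ ε / 8` times the norm of the segment. -/
def CSAccurate (ρ : CSSeed P) (a t : ℕ) (q : Fin P.u) : Prop :=
  |rowEstimate (fun i : Fin P.u => cellHash P.hashBits P.cellBits ρ.1 i)
    (hashSign P.hashBits ρ.2) (freqVec x a t) q - freqVec x a t q| ≤
      P.γ * P.ε / 8 * √(segF2 x a t)

theorem pr_not_csAccurate_le (hP : P.Valid) {a t : ℕ} (hat : a < t) (q : Fin P.u) :
    pr (fun ρ : CSSeed P => ¬ CSAccurate x ρ a t q) ≤ 1 / 15 := by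
  have hε := hP.ε_pos
  have hγ := hP.γ_pos
  have hF := segF2_pos x hat
  have hcollision (j : Fin P.u) (hj : j ≠ q) :
      pr (fun ρ : Fin 2 → P.Word => cellHash P.hashBits P.cellBits ρ j =
        cellHash P.hashBits P.cellBits ρ q) ≤ 1 / 2 ^ P.cellBits :=
    (pr_cellHash_eq_cellHash (cellBits_le P) le_rfl (Fin.val_ne_of_ne hj)
      (j.2.trans_le (u_le_two_pow P)) (q.2.trans_le (u_le_two_pow P))).le
  have hvariance := expect_sq_rowEstimate_sub_le
    (uncorrelatedSigns_hashSign (d := 2) (u_le_two_pow P)) le_rfl (by positivity) hcollision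
    (freqVec x a t)
  have hmarkov := (mul_pr_le_expect (fun _ => sq_nonneg _)
    (p := fun ρ => ¬ CSAccurate x ρ a t q) (t := (P.γ * P.ε / 8 * √(segF2 x a t)) ^ 2)
    fun ρ hρ => by
      rw [← sq_abs (_ - _)]
      exact pow_le_pow_left₀ (by positivity) (not_le.1 hρ).le 2).trans hvariance
  have hcells := le_two_pow_cellBits P
  rw [Params.csEps, div_le_iff₀ (by positivity)] at hcells
  rw [mul_pow, Real.sq_sqrt hF.le, ← segF2, one_div_mul_eq_div, le_div_iff₀ (by positivity)]
    at hmarkov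
  refine le_of_mul_le_mul_left ?_ hF
  have := mul_le_mul_of_nonneg_left hcells
    (mul_nonneg hF.le (pr_nonneg fun ρ : CSSeed P => ¬ CSAccurate x ρ a t q))
  linarith

variable {x} in
theorem csEstimate_of_majority {ω : P.Seed} {a t : ℕ} (hat : a ≤ t) {q : Fin P.u}
    (h : 2 * Nat.card {r // ¬ CSAccurate x (ω.1 r) a t q} < P.rows) :
    |(csEstimate P ω (bucketAt ω x a t).cs q : ℝ) - freqVec x a t q| ≤
      P.γ * P.ε / 8 * √(segF2 x a t) := by
  have hmed := median_mem_of_ordConnected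
    (fun r => csSign P ω r q * (bucketAt ω x a t).cs r (csCell P ω r q))
    ((Set.ordConnected_Icc (a := freqVec x a t q - P.γ * P.ε / 8 * √(segF2 x a t))
      (b := freqVec x a t q + P.γ * P.ε / 8 * √(segF2 x a t))).preimage_mono Int.cast_mono)
    (two_mul_card_lt_of_imp h fun r hr hacc => hr ?_)
  · rw [abs_le, csEstimate]
    constructor <;> linarith [hmed.1, hmed.2]
  · rw [Set.mem_preimage, csSign_mul_bucketAt_cs ω x hat]
    have := abs_le.1 (show |_| ≤ _ from hacc)
    constructor <;> linarith! [this.1, this.2]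

end CountSketchRows

section UnionBound

open Finset

theorem pr_exists_mem_le_card_mul {Ω ι : Type*} [Fintype Ω] (s : Finset ι) {p : ι → Ω → Prop}
    {B : ℝ} (h : ∀ i ∈ s, pr (p i) ≤ B) : pr (fun ω => ∃ i ∈ s, p i ω) ≤ #s * B := by
  refine (pr_exists_le s p).trans ?_
  rw [← nsmul_eq_mul]
  exact Finset.sum_le_card_nsmul _ _ _ h

variable {P : Params}

theorem half_pow_rows_le (hP : P.Valid) :
    (1 / 2 : ℝ) ^ P.rows ≤ P.δ / (2 * (P.N : ℝ)) ^ 14 := by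
  have hN : (2 : ℝ) ≤ P.N := by exact_mod_cast hP.two_le_N
  have hδ := hP.δ_pos
  have hδ1 := hP.δ_lt
  set y : ℝ := P.N / (P.δ / 2) with hy
  have hyN : y = 2 * P.N / P.δ := by rw [hy]; field_simp
  have hy1 : 1 ≤ y := by
    rw [hyN, le_div_iff₀ hδ]
    linarith
  have hlogy : 0 ≤ Real.log y := Real.log_nonneg hy1
  have hrows : 14 * Real.log y ≤ P.rows * Real.log 2 := by
    have hceil : P.κ * Real.log y ≤ P.rows := Nat.le_ceil _
    have hκ := mul_le_mul_of_nonneg_right hP.le_κ hlogy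
    nlinarith [Real.log_two_gt_d9]
  have hpow : y ^ 14 ≤ 2 ^ P.rows := by
    rw [← Real.log_le_log_iff (by positivity) (by positivity), Real.log_pow, Real.log_pow]
    exact_mod_cast hrows
  calc (1 / 2 : ℝ) ^ P.rows = 1 / 2 ^ P.rows := one_div_pow _ _
    _ ≤ 1 / y ^ 14 := by gcongr
    _ = P.δ ^ 14 / (2 * (P.N : ℝ)) ^ 14 := by rw [hyN, div_pow, one_div_div]
    _ ≤ P.δ / (2 * (P.N : ℝ)) ^ 14 := by
      gcongr
      exact pow_le_of_le_one hδ.le hδ1.le (by norm_num)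

theorem pow_three_add_pow_two_add_le {N : ℝ} (hN : 2 ≤ N) :
    (8 * N ^ 2 + 1) ^ 3 + (8 * N ^ 2 + 1) ^ 2 + (8 * N ^ 2 + 1) ≤ (2 * N) ^ 14 := by
  have hN2 : 4 ≤ N ^ 2 := by nlinarith
  have hM : 8 * N ^ 2 + 1 ≤ (2 * N) ^ 4 := by nlinarith
  have hM1 : 1 ≤ 8 * N ^ 2 + 1 := by linarith
  generalize 8 * N ^ 2 + 1 = M at hM hM1
  have h1 : M ≤ M ^ 3 := le_self_pow₀ hM1 (by norm_num)
  have h2 : M ^ 2 ≤ M ^ 3 := pow_le_pow_right₀ hM1 (by norm_num)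
  calc M ^ 3 + M ^ 2 + M ≤ M ^ 3 + M ^ 3 + M ^ 3 := by linarith
    _ = 3 * M ^ 3 := by ring
    _ ≤ (2 * N) ^ 2 * ((2 * N) ^ 4) ^ 3 := by
      gcongr
      linarith
    _ = (2 * N) ^ 14 := by ring

theorem pr_snd_majority_le {Ω Ω' : Type*} [Fintype Ω] [Fintype Ω'] [Nonempty Ω] [Nonempty Ω']
    {r : ℕ} {bad : Ω → Prop} (h : pr bad ≤ 1 / 15) :
    pr (fun ω : Ω' × (Fin r → Ω) => r ≤ 2 * Nat.card {i // bad (ω.2 i)}) ≤ (1 / 2) ^ r := by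
  rw [pr_comp_snd fun ω : Fin r → Ω => r ≤ 2 * Nat.card {i // bad (ω i)}]
  simpa using pr_majority_le (ι := Fin r) h

theorem pr_fst_majority_le {Ω Ω' : Type*} [Fintype Ω] [Fintype Ω'] [Nonempty Ω] [Nonempty Ω']
    {r : ℕ} {bad : Ω → Prop} (h : pr bad ≤ 1 / 15) :
    pr (fun ω : (Fin r → Ω) × Ω' => r ≤ 2 * Nat.card {i // bad (ω.1 i)}) ≤ (1 / 2) ^ r := by
  rw [pr_comp_fst fun ω : Fin r → Ω => r ≤ 2 * Nat.card {i // bad (ω i)}]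
  simpa using pr_majority_le (ι := Fin r) h

/-- The times that matter for the accuracy of the sketches at time `n`: the buckets of the histogram
are at most twice as long as the maximal size. -/
def recentTimes (P : Params) (n : ℕ) : Finset ℕ := Finset.Icc (n - 8 * P.N ^ 2) n

variable {n : ℕ}

theorem mem_recentTimes {a : ℕ} : a ∈ recentTimes P n ↔ n ≤ a + 8 * P.N ^ 2 ∧ a ≤ n := by
  rw [recentTimes, Finset.mem_Icc]
  omega

theorem card_recentTimes_le (P : Params) (n : ℕ) :
    (#(recentTimes P n) : ℝ) ≤ 8 * (P.N : ℝ) ^ 2 + 1 := by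
  have : #(recentTimes P n) ≤ 8 * P.N ^ 2 + 1 := by rw [recentTimes, Nat.card_Icc]; omega
  exact_mod_cast this

/-- The sketches are inaccurate in at least half of the rows for some comparison of two segments. -/
def TestMajorityFails (x : ℕ → Fin P.u) (n : ℕ) (ω : P.Seed) : Prop :=
  ∃ p ∈ recentTimes P n ×ˢ recentTimes P n ×ˢ recentTimes P n,
    P.rows ≤ 2 * Nat.card {r // ¬ TestAccurate x (ω.2 r) p.1 p.2.1 p.2.2}

/-- At least half of the rows of CountSketch fail on a recently arrived element. -/
def CSMajorityFails (x : ℕ → Fin P.u) (n : ℕ) (ω : P.Seed) : Prop :=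
  ∃ p ∈ (recentTimes P n ×ˢ recentTimes P n).filter fun p => p.1 ≤ p.2,
    P.rows ≤ 2 * Nat.card {r // ¬ CSAccurate x (ω.1 r) p.1 (p.2 + 1) (x p.2)}

/-- At least half of the rows of the `L₂` sketch fail on a segment that ends at time `n`. -/
def L2MajorityFails (x : ℕ → Fin P.u) (n : ℕ) (ω : P.Seed) : Prop :=
  ∃ a ∈ recentTimes P n, P.rows ≤ 2 * Nat.card {r // ¬ InnerAccurate (P.ε / 32)
    (hashSign P.hashBits ∘ ω.2 r) (freqVec x a n) (freqVec x a n)}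

variable (x : ℕ → Fin P.u)

theorem pr_test_majority_le (hP : P.Valid) (a b t : ℕ) :
    pr (fun ω : P.Seed => P.rows ≤ 2 * Nat.card {r // ¬ TestAccurate x (ω.2 r) a b t}) ≤
      (1 / 2) ^ P.rows :=
  pr_snd_majority_le (Ω := L2Seed P) (Ω' := Fin P.rows → CSSeed P)
    (bad := fun ρ => ¬ TestAccurate x ρ a b t) (pr_not_testAccurate_le x hP a b t)

theorem pr_cs_majority_le (hP : P.Valid) {a t : ℕ} (hat : a < t) (q : Fin P.u) :
    pr (fun ω : P.Seed => P.rows ≤ 2 * Nat.card {r // ¬ CSAccurate x (ω.1 r) a t q}) ≤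
      (1 / 2) ^ P.rows :=
  pr_fst_majority_le (Ω := CSSeed P) (Ω' := Fin P.rows → L2Seed P)
    (bad := fun ρ => ¬ CSAccurate x ρ a t q) (pr_not_csAccurate_le x hP hat q)

theorem pr_l2_majority_le (hP : P.Valid) (f : Fin P.u → ℝ) :
    pr (fun ω : P.Seed => P.rows ≤ 2 * Nat.card {r // ¬ InnerAccurate (P.ε / 32)
      (hashSign P.hashBits ∘ ω.2 r) f f}) ≤ (1 / 2) ^ P.rows :=
  pr_snd_majority_le (Ω := L2Seed P) (Ω' := Fin P.rows → CSSeed P)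
    (bad := fun ρ => ¬ InnerAccurate (P.ε / 32) (hashSign P.hashBits ∘ ρ) f f)
    ((pr_l2Row_not_innerAccurate_le hP f f).trans (by norm_num))

theorem pr_testMajorityFails_le (hP : P.Valid) (n : ℕ) :
    pr (TestMajorityFails x n) ≤ (8 * (P.N : ℝ) ^ 2 + 1) ^ 3 * (1 / 2) ^ P.rows := by
  refine (pr_exists_mem_le_card_mul (recentTimes P n ×ˢ recentTimes P n ×ˢ recentTimes P n)
    fun p _ => pr_test_majority_le x hP p.1 p.2.1 p.2.2).trans ?_
  have := card_recentTimes_le P n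
  rw [Finset.card_product, Finset.card_product, Nat.cast_mul, Nat.cast_mul, ← mul_assoc,
    ← pow_three']
  gcongr

theorem pr_csMajorityFails_le (hP : P.Valid) (n : ℕ) :
    pr (CSMajorityFails x n) ≤ (8 * (P.N : ℝ) ^ 2 + 1) ^ 2 * (1 / 2) ^ P.rows := by
  refine (pr_exists_mem_le_card_mul
    ((recentTimes P n ×ˢ recentTimes P n).filter fun p => p.1 ≤ p.2)
    fun p hp => pr_cs_majority_le (a := p.1) (t := p.2 + 1) x hP
      (Nat.lt_add_one_of_le (Finset.mem_filter.1 hp).2) (x p.2)).trans ?_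
  have := card_recentTimes_le P n
  gcongr
  calc _ ≤ (#(recentTimes P n ×ˢ recentTimes P n) : ℝ) := by
        exact_mod_cast Finset.card_filter_le _ _
    _ = (#(recentTimes P n) : ℝ) ^ 2 := by rw [Finset.card_product, Nat.cast_mul, sq]
    _ ≤ _ := by gcongr

theorem pr_l2MajorityFails_le (hP : P.Valid) (n : ℕ) :
    pr (L2MajorityFails x n) ≤ (8 * (P.N : ℝ) ^ 2 + 1) * (1 / 2) ^ P.rows := by
  refine (pr_exists_mem_le_card_mul (recentTimes P n)
    fun a _ => pr_l2_majority_le hP (freqVec x a n)).trans ?_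
  gcongr
  exact card_recentTimes_le P n

variable {x} in
theorem accurate_of_majorities (hP : P.Valid) {ω : P.Seed} (htest : ¬ TestMajorityFails x n ω)
    (hcs : ¬ CSMajorityFails x n ω) (hl2 : ¬ L2MajorityFails x n ω) : Accurate ω x n := by
  simp only [TestMajorityFails, CSMajorityFails, L2MajorityFails, Finset.mem_filter,
    Finset.mem_product, mem_recentTimes, not_exists, not_and, not_le, Prod.forall]
    at htest hcs hl2
  have htest' (a b t : ℕ) (hab : a < b) (hbt : b < t) (htn : t ≤ n) (hna : n ≤ a + 8 * P.N ^ 2) :=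
    htest a b t (by omega)
  exact {
    close_of := fun a b t hab hbt htn hna =>
      close_of_majority hP hab.le hbt.le (htest' a b t hab hbt htn hna)
    of_close := fun a b t hab hbt htn hna =>
      difference_le_of_majority hP hab.le hbt.le (htest' a b t hab hbt htn hna)
    l2 := fun a han hna => l2Estimate_mem_of_majority hP han.le (hl2 a ⟨hna, han.le⟩)
    cs := fun a s has hsn hna => csEstimate_of_majority (by omega) (hcs a s (by omega)) }

theorem pr_not_accurate_le (hP : P.Valid) (n : ℕ) :
    pr (fun ω : P.Seed => ¬ Accurate ω x n) ≤ P.δ := by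
  have hN : (2 : ℝ) ≤ P.N := by exact_mod_cast hP.two_le_N
  calc pr (fun ω : P.Seed => ¬ Accurate ω x n)
      ≤ pr (fun ω => TestMajorityFails x n ω ∨ CSMajorityFails x n ω ∨ L2MajorityFails x n ω) :=
        pr_mono fun ω hω => by
          contrapose! hω
          exact accurate_of_majorities hP hω.1 hω.2.1 hω.2.2
    _ ≤ pr (TestMajorityFails x n) + (pr (CSMajorityFails x n) + pr (L2MajorityFails x n)) :=
        (pr_or_le _ _).trans (add_le_add_right (pr_or_le _ _) _)
    _ ≤ _ := add_le_add (pr_testMajorityFails_le x hP n)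
        (add_le_add (pr_csMajorityFails_le x hP n) (pr_l2MajorityFails_le x hP n))
    _ = ((8 * (P.N : ℝ) ^ 2 + 1) ^ 3 + (8 * (P.N : ℝ) ^ 2 + 1) ^ 2 + (8 * (P.N : ℝ) ^ 2 + 1)) *
        (1 / 2) ^ P.rows := by ring
    _ ≤ (2 * (P.N : ℝ)) ^ 14 * (P.δ / (2 * (P.N : ℝ)) ^ 14) := by
        gcongr
        exacts [pow_three_add_pow_two_add_le hN, half_pow_rows_le hP]
    _ = P.δ := mul_div_cancel₀ _ (by positivity)

theorem freqAlgorithm_separates (hP : P.Valid) :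
    (freqAlgorithm P).Separates P.N ((1 + 4 * P.ε) * P.γ) ((1 - 4 / P.γ * P.ε) * P.γ) P.δ := by
  intro x n hn
  calc 1 - P.δ ≤ 1 - pr (fun ω : P.Seed => ¬ Accurate ω x n) :=
        sub_le_sub_left (pr_not_accurate_le x hP n) 1
    _ = pr (fun ω : P.Seed => Accurate ω x n) := by rw [pr_not, sub_sub_cancel]
    _ ≤ pr (fun ω : P.Seed => Correct ω x n) := pr_mono fun ω hω => hω.correct hP hn
    _ = _ := pr_eq_card_div_card _

end UnionBound

section Words

variable {α : Type*} {c : α → List ℤ} {m n L : ℕ}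

theorem length_arrayWords (h : ∀ a, (c a).length = L) (f : Fin n → α) :
    (arrayWords c f).length = n * L := by
  simp [arrayWords, List.length_flatten, List.map_ofFn, List.sum_ofFn, h]

theorem length_arrayWords_arrayWords (h : ∀ a, (c a).length = 1) (f : Fin m → Fin n → α) :
    (arrayWords (arrayWords c) f).length = m * n :=
  length_arrayWords (fun g => (length_arrayWords h g).trans (mul_one n)) f

theorem mem_arrayWords {f : Fin n → α} {w : ℤ} : w ∈ arrayWords c f ↔ ∃ i, w ∈ c (f i) := by
  simp [arrayWords, List.mem_flatten]

theorem length_listWords_le {l : List α} (h : ∀ a ∈ l, (c a).length ≤ L) :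
    (listWords c l).length ≤ 1 + l.length * L := by
  have := List.sum_le_card_nsmul (l.map fun a => (c a).length) L (by simpa using h)
  rw [listWords, List.length_cons, List.length_flatMap, add_comm]
  simpa using this

theorem mem_listWords {l : List α} {w : ℤ} :
    w ∈ listWords c l ↔ w = l.length ∨ ∃ a ∈ l, w ∈ c a := by
  simp [listWords]

end Words

section SmallBuckets

variable {P : Params}

/-- The numbers stored for a bucket are at most its size in absolute value, and there are at most
`P.listLen` candidates. Bounds the memory taken by the bucket. -/
structure Bucket.Small (A : Bucket P) : Prop where
  cs : ∀ r c, |A.cs r c| ≤ A.size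
  l2 : ∀ r c, |A.l2 r c| ≤ A.size
  cand : ∀ p ∈ A.cand, |p.2| ≤ A.size
  length_le : A.cand.length ≤ P.listLen

theorem abs_signHash (m : ℕ) {d : ℕ} (a : Fin d → Fin (2 ^ (m + 1))) (y : ℕ) :
    |signHash m a y| = 1 := by
  rw [signHash]
  split_ifs <;> rfl

theorem abs_snd_le_of_mem_candUpdate {H : Candidates P} {q : Fin P.u} {e B : ℤ}
    (hH : ∀ p ∈ H, |p.2| ≤ B) (he : |e| ≤ B + 1) : ∀ p ∈ candUpdate P H q e, |p.2| ≤ B + 1 := by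
  have hH' : ∀ p ∈ H, |p.2| ≤ B + 1 := fun p hp => (hH p hp).trans (by omega)
  rw [candUpdate]
  split_ifs
  · intro p hp
    obtain ⟨p', hp', rfl⟩ := List.mem_map.1 hp
    split_ifs
    · exact (abs_add_le _ _).trans (add_le_add_left (hH p' hp') 1)
    · exact hH' p' hp'
  · exact List.forall_mem_cons.2 ⟨he, hH'⟩
  · split
    · exact hH'
    · split_ifs
      · exact List.forall_mem_cons.2 ⟨he, fun p hp => hH' p (List.mem_of_mem_erase hp)⟩
      · exact hH'

theorem abs_csAdd_le {T : CSTable P} {B : ℤ} (hT : ∀ r c, |T r c| ≤ B) (ω : P.Seed) (q : Fin P.u)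
    (r : Fin P.rows) (c : Fin (2 ^ P.cellBits)) : |csAdd P ω T q r c| ≤ B + 1 := by
  rw [csAdd]
  split_ifs
  · refine (abs_add_le _ _).trans (add_le_add (hT r c) ?_)
    rw [csSign, abs_signHash]
  · exact (hT r c).trans (by omega)

theorem abs_l2Add_le {Z : L2Table P} {B : ℤ} (hZ : ∀ r c, |Z r c| ≤ B) (ω : P.Seed) (q : Fin P.u)
    (r : Fin P.rows) (c : Fin P.cols) : |l2Add P ω Z q r c| ≤ B + 1 :=
  (abs_add_le _ _).trans (add_le_add (hZ r c) (abs_signHash _ _ _).le)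

theorem abs_csEstimate_le {T : CSTable P} {B : ℤ} (hB : 0 ≤ B) (hT : ∀ r c, |T r c| ≤ B)
    (ω : P.Seed) (q : Fin P.u) : |csEstimate P ω T q| ≤ B :=
  abs_median_le _ hB fun r => by
    rw [abs_mul, csSign, abs_signHash, one_mul]
    exact hT r _

theorem Bucket.Small.add {A : Bucket P} (h : A.Small) (ω : P.Seed) (q : Fin P.u) :
    (Bucket.add ω q A).Small where
  cs := abs_csAdd_le h.cs ω q
  l2 := abs_l2Add_le h.l2 ω q
  cand := abs_snd_le_of_mem_candUpdate h.cand
    (abs_csEstimate_le (by positivity) (abs_csAdd_le h.cs ω q) ω q)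
  length_le := length_candUpdate_le h.length_le _ _

theorem bucketAt_small (ω : P.Seed) (x : ℕ → Fin P.u) (a t : ℕ) : (bucketAt ω x a t).Small := by
  have small_empty : (Bucket.empty P).Small := by constructor <;> simp [Bucket.empty]
  rcases le_total t a with h | h
  · rwa [bucketAt_of_le ω x h]
  · exact bucketAt_induction ω x a (fun _ A => A.Small) small_empty (fun t _ ih => ih.add ω (x t)) h

end SmallBuckets

section Memory

variable {P : Params}

/-- An upper bound for the number of words of a bucket. -/
noncomputable def Params.bucketLength (P : Params) : ℕ :=
  2 + P.rows * 2 ^ P.cellBits + 2 * P.listLen + P.rows * P.cols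

theorem Bucket.Small.length_bucketWords_le {A : Bucket P} (h : A.Small) :
    (bucketWords P A).length ≤ P.bucketLength := by
  have hcs : (arrayWords (arrayWords fun z => [z]) A.cs).length = P.rows * 2 ^ P.cellBits :=
    length_arrayWords_arrayWords (fun _ => rfl) _
  have hl2 : (arrayWords (arrayWords fun z => [z]) A.l2).length = P.rows * P.cols :=
    length_arrayWords_arrayWords (fun _ => rfl) _
  have hcand := length_listWords_le (c := fun p : Fin P.u × ℤ => [((p.1 : ℕ) : ℤ)] ++ [p.2])
    (L := 2) (l := A.cand) (fun _ _ => le_rfl)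
  have hlist := h.length_le
  rw [bucketWords, List.length_append, List.length_append, List.length_append, hcs, hl2,
    List.length_singleton, Params.bucketLength]
  omega

theorem length_seedWords (ω : P.Seed) :
    (seedWords P ω).length = 4 * P.rows + 4 * (P.rows * P.cols) := by
  rw [seedWords, List.length_append, length_arrayWords (L := 4),
    length_arrayWords (L := P.cols * 4)]
  · ring
  · exact length_arrayWords fun g => length_arrayWords (L := 1) (fun _ => rfl) g
  · intro p
    rw [List.length_append, length_arrayWords (L := 1) (fun _ => rfl),
      length_arrayWords (L := 1) (fun _ => rfl)]

theorem length_bucketStarts_le (ω : P.Seed) (x : ℕ → Fin P.u) (t : ℕ) :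
    (bucketStarts ω x t).length ≤ P.maxBuckets := by
  cases t with
  | zero => exact Nat.zero_le _
  | succ t =>
    rw [bucketStarts, trimStarts, List.length_drop]
    omega

theorem memory_eq (hP : P.Valid) (ω : P.Seed) (x : ℕ → Fin P.u) (t : ℕ) :
    (freqAlgorithm P).memory ω x t = seedWords P ω ++
      listWords (bucketWords P) ((bucketStarts ω x t).map (bucketAt ω x · t)) := by
  rw [← run_freqAlgorithm (two_pos.trans_le hP.two_le_N) (one_le_maxBuckets hP)]
  rfl

theorem length_memory_le (hP : P.Valid) (ω : P.Seed) (x : ℕ → Fin P.u) (t : ℕ) :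
    ((freqAlgorithm P).memory ω x t).length ≤ 5 * (P.maxBuckets * P.bucketLength) := by
  have hseed : 4 * P.rows + 4 * (P.rows * P.cols) + 1 ≤ 4 * P.bucketLength := by
    have : P.rows ≤ P.rows * 2 ^ P.cellBits := Nat.le_mul_of_pos_right _ (by positivity)
    rw [Params.bucketLength]
    omega
  have hstate : (listWords (bucketWords P) ((bucketStarts ω x t).map (bucketAt ω x · t))).length ≤
      1 + (bucketStarts ω x t).length * P.bucketLength := by
    rw [← List.length_map (bucketAt ω x · t)]
    exact length_listWords_le (List.forall_mem_map.2
      fun a _ => (bucketAt_small ω x a t).length_bucketWords_le)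
  calc _ ≤ 4 * P.rows + 4 * (P.rows * P.cols) + (1 + P.maxBuckets * P.bucketLength) := by
        rw [memory_eq hP, List.length_append, length_seedWords]
        have := Nat.mul_le_mul_right P.bucketLength (length_bucketStarts_le ω x t)
        omega
    _ ≤ 4 * P.bucketLength + P.maxBuckets * P.bucketLength := by omega
    _ ≤ 5 * (P.maxBuckets * P.bucketLength) := by
        have := Nat.le_mul_of_pos_left P.bucketLength (one_le_maxBuckets hP)
        omega

end Memory

section Sizes

variable {P : Params}

theorem two_pow_clog_le {k : ℕ} (hk : 1 ≤ k) : 2 ^ Nat.clog 2 k ≤ 2 * k := by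
  rcases hk.eq_or_lt with rfl | h
  · simp
  · have hlt := Nat.pow_pred_clog_lt_self Nat.one_lt_two h
    obtain ⟨j, hj⟩ := Nat.exists_eq_succ_of_ne_zero (Nat.clog_pos Nat.one_lt_two h).ne'
    rw [hj, Nat.pred_succ] at hlt
    rw [hj, pow_succ']
    omega

theorem one_le_one_div_sq {y : ℝ} (hy : 0 < y) (hy1 : y ≤ 1) : 1 ≤ 1 / y ^ 2 := by
  rw [one_le_div (by positivity)]
  exact pow_le_one₀ hy.le hy1

theorem log_N_le_log_div (hP : P.Valid) : Real.log P.N ≤ Real.log (P.N / P.δ) := by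
  have hN : (0 : ℝ) < P.N := by exact_mod_cast two_pos.trans_le hP.two_le_N
  exact Real.log_le_log hN (le_div_self hN.le hP.δ_pos hP.δ_lt.le)

theorem rows_le (hP : P.Valid) : (P.rows : ℝ) ≤ 3 * P.κ * Real.log (P.N / P.δ) := by
  have hN : (2 : ℝ) ≤ P.N := by exact_mod_cast hP.two_le_N
  have hδ := hP.δ_pos
  have hκ := hP.le_κ
  have hhalf := half_lt_log hP.two_le_N
  have hlog := log_N_le_log_div hP
  have hlog2 : Real.log 2 ≤ Real.log P.N := Real.log_le_log (by norm_num) hN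
  have hsplit : Real.log (P.N / (P.δ / 2)) = Real.log 2 + Real.log (P.N / P.δ) := by
    rw [← Real.log_mul (by norm_num) (by positivity)]
    congr 1
    field_simp
  have hpos : 0 ≤ Real.log (P.N / (P.δ / 2)) := by
    rw [hsplit]
    linarith [Real.log_pos one_lt_two]
  calc (P.rows : ℝ) ≤ P.κ * Real.log (P.N / (P.δ / 2)) + 1 :=
        (Nat.ceil_lt_add_one (by positivity)).le
    _ ≤ P.κ * (2 * Real.log (P.N / P.δ)) + P.κ * Real.log (P.N / P.δ) := by
        gcongr
        · linarith
        · nlinarith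
    _ = _ := by ring

theorem cols_le (hP : P.Valid) : (P.cols : ℝ) ≤ 2 * P.κ * (1 / P.ε ^ 2) := by
  have hε := one_le_one_div_sq hP.ε_pos (by linarith [hP.ε_lt])
  have hκ := hP.le_κ
  calc (P.cols : ℝ) ≤ P.κ / P.ε ^ 2 + 1 :=
        (Nat.ceil_lt_add_one (div_nonneg (by linarith) (sq_nonneg _))).le
    _ ≤ P.κ * (1 / P.ε ^ 2) + P.κ * (1 / P.ε ^ 2) := by
        rw [div_eq_mul_one_div]
        gcongr
        nlinarith
    _ = _ := by ring

theorem maxBuckets_le (hP : P.Valid) :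
    (P.maxBuckets : ℝ) ≤ 2 * P.κ * (1 / P.ε ^ 2 * Real.log P.N) := by
  have hε := one_le_one_div_sq hP.ε_pos (by linarith [hP.ε_lt])
  have hlog := half_lt_log hP.two_le_N
  have hκ := hP.le_κ
  have hhalf : 1 / 2 ≤ 1 / P.ε ^ 2 * Real.log P.N := by nlinarith
  have heq : P.κ / P.ε ^ 2 * Real.log P.N = P.κ * (1 / P.ε ^ 2 * Real.log P.N) := by ring
  calc (P.maxBuckets : ℝ) ≤ P.κ / P.ε ^ 2 * Real.log P.N + 1 :=
        (Nat.ceil_lt_add_one (by rw [heq]; positivity)).le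
    _ ≤ P.κ * (1 / P.ε ^ 2 * Real.log P.N) + P.κ * (1 / P.ε ^ 2 * Real.log P.N) := by
        rw [heq]
        gcongr
        nlinarith
    _ = _ := by ring

theorem one_div_γ_sq_le (hP : P.Valid) : 1 / P.γ ^ 2 ≤ 1 / (P.γ ^ 2 * P.ε ^ 2) := by
  have hγ := hP.γ_pos
  have hε := hP.ε_pos
  gcongr
  exact mul_le_of_le_one_right (by positivity) (pow_le_one₀ hε.le (by linarith [hP.ε_lt]))

theorem one_div_ε_sq_le (hP : P.Valid) : 1 / P.ε ^ 2 ≤ 1 / (P.γ ^ 2 * P.ε ^ 2) := by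
  have hγ := hP.γ_pos
  have hε := hP.ε_pos
  gcongr
  exact mul_le_of_le_one_left (by positivity) (pow_le_one₀ hγ.le hP.γ_lt.le)

theorem two_pow_cellBits_le (hP : P.Valid) :
    (2 : ℝ) ^ P.cellBits ≤ 10 ^ 4 * (1 / (P.γ ^ 2 * P.ε ^ 2)) := by
  have hz := (one_le_one_div_sq hP.γ_pos hP.γ_lt.le).trans (one_div_γ_sq_le hP)
  have heq : 256 / (P.γ ^ 2 * P.csEps ^ 2) = 4096 * (1 / (P.γ ^ 2 * P.ε ^ 2)) := by
    rw [Params.csEps]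
    field_simp
    norm_num
  rw [Params.cellBits, heq]
  generalize 1 / (P.γ ^ 2 * P.ε ^ 2) = z at hz
  have hceil := Nat.ceil_lt_add_one (show 0 ≤ 4096 * z by linarith)
  have hclog : (2 : ℝ) ^ Nat.clog 2 ⌈4096 * z⌉₊ ≤ 2 * ⌈4096 * z⌉₊ := by
    exact_mod_cast two_pow_clog_le (Nat.succ_le_of_lt (Nat.ceil_pos.2 (by linarith)))
  linarith

theorem listLen_le (hP : P.Valid) : (P.listLen : ℝ) ≤ 2 * (1 / P.γ ^ 2) := by
  have hγ := one_le_one_div_sq hP.γ_pos hP.γ_lt.le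
  have := Nat.floor_le (show 0 ≤ 1 / P.γ ^ 2 by linarith)
  rw [Params.listLen]
  push_cast
  linarith

theorem bucketLength_le (hP : P.Valid) : (P.bucketLength : ℝ) ≤
    7 * P.κ ^ 2 * (1 / (P.γ ^ 2 * P.ε ^ 2) * Real.log (P.N / P.δ)) := by
  have hz := (one_le_one_div_sq hP.γ_pos hP.γ_lt.le).trans (one_div_γ_sq_le hP)
  have hw : 1 / 2 ≤ Real.log (P.N / P.δ) :=
    (half_lt_log hP.two_le_N).le.trans (log_N_le_log_div hP)
  have hκ := hP.le_κ
  have hrows := rows_le hP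
  have hcells := two_pow_cellBits_le hP
  have hlist := (listLen_le hP).trans (mul_le_mul_of_nonneg_left (one_div_γ_sq_le hP) zero_le_two)
  have hcols := (cols_le hP).trans
    (mul_le_mul_of_nonneg_left (one_div_ε_sq_le hP) (by linarith : 0 ≤ 2 * P.κ))
  rw [Params.bucketLength]
  push_cast
  generalize 1 / (P.γ ^ 2 * P.ε ^ 2) = z at *
  generalize Real.log (P.N / P.δ) = w at *
  have hzw : z ≤ 2 * (z * w) := by nlinarith
  have hκ2 : 12 + 3 * 10 ^ 4 * P.κ ≤ P.κ ^ 2 := by nlinarith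
  calc 2 + (P.rows : ℝ) * 2 ^ P.cellBits + 2 * P.listLen + P.rows * P.cols
      ≤ 2 * z + 3 * P.κ * w * (10 ^ 4 * z) + 2 * (2 * z) + 3 * P.κ * w * (2 * P.κ * z) := by
        gcongr
        linarith
    _ ≤ (12 + 3 * 10 ^ 4 * P.κ + 6 * P.κ ^ 2) * (z * w) := by linarith
    _ ≤ 7 * P.κ ^ 2 * (z * w) := by
        gcongr
        linarith

theorem freqAlgorithm_usesWords (hP : P.Valid) :
    (freqAlgorithm P).UsesWords (70 * P.κ ^ 3 * (1 / (P.γ ^ 2 * P.ε ^ 4) * Real.log P.N *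
      Real.log (P.N / P.δ) + 1 / P.ε ^ 4 * Real.log P.N * Real.log (1 / P.ε))) := by
  intro ω x t
  have hlogN := half_lt_log hP.two_le_N
  have hκ := hP.le_κ
  have hlogε : 0 ≤ 1 / P.ε ^ 4 * Real.log P.N * Real.log (1 / P.ε) := by
    have : 0 ≤ Real.log (1 / P.ε) :=
      Real.log_nonneg ((one_le_div hP.ε_pos).2 (by linarith [hP.ε_lt]))
    positivity
  calc (((freqAlgorithm P).memory ω x t).length : ℝ)
      ≤ 5 * (P.maxBuckets * P.bucketLength) := by exact_mod_cast length_memory_le hP ω x t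
    _ ≤ 5 * (2 * P.κ * (1 / P.ε ^ 2 * Real.log P.N) *
        (7 * P.κ ^ 2 * (1 / (P.γ ^ 2 * P.ε ^ 2) * Real.log (P.N / P.δ)))) := by
        gcongr
        exacts [maxBuckets_le hP, bucketLength_le hP]
    _ = 70 * P.κ ^ 3 * (1 / (P.γ ^ 2 * P.ε ^ 4) * Real.log P.N * Real.log (P.N / P.δ)) := by
        ring
    _ ≤ _ := by
        gcongr
        exact le_add_of_nonneg_right hlogε

end Sizes

section WordSize

variable {P : Params}

theorem abs_le_of_mem_seedWords {ω : P.Seed} : ∀ w ∈ seedWords P ω, |w| ≤ 2 ^ (P.hashBits + 1) := by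
  have word_le (z : P.Word) : |((z : ℕ) : ℤ)| ≤ 2 ^ (P.hashBits + 1) := by
    rw [Nat.abs_cast]
    exact_mod_cast z.2.le
  intro w hw
  simp only [seedWords, List.mem_append, mem_arrayWords, List.mem_singleton] at hw
  rcases hw with ⟨r, ⟨i, rfl⟩ | ⟨i, rfl⟩⟩ | ⟨r, c, i, rfl⟩ <;> exact word_le _

theorem Bucket.Small.abs_le_of_mem_bucketWords {A : Bucket P} (h : A.Small) {B : ℕ}
    (hu : P.u ≤ B) (hlist : P.listLen ≤ B) (hsize : A.size ≤ B) :
    ∀ w ∈ bucketWords P A, |w| ≤ B := by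
  have hsize' : (A.size : ℤ) ≤ B := by exact_mod_cast hsize
  intro w hw
  simp only [bucketWords, List.mem_append, mem_arrayWords, mem_listWords, List.mem_singleton] at hw
  rcases hw with rfl | ⟨r, c, rfl⟩ | (rfl | ⟨p, hp, rfl | rfl⟩) | ⟨r, c, rfl⟩
  · rwa [Nat.abs_cast]
  · exact (h.cs r c).trans hsize'
  · rw [Nat.abs_cast]
    exact_mod_cast h.length_le.trans hlist
  · rw [Nat.abs_cast]
    exact_mod_cast p.1.2.le.trans hu
  · exact (h.cand p hp).trans hsize'
  · exact (h.l2 r c).trans hsize'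

theorem abs_le_of_mem_memory (hP : P.Valid) {B : ℕ} (hhash : 2 ^ (P.hashBits + 1) ≤ B)
    (hbuckets : P.maxBuckets ≤ B) (hu : P.u ≤ B) (hlist : P.listLen ≤ B) (hsize : P.maxSize ≤ B)
    (ω : P.Seed) (x : ℕ → Fin P.u) (t : ℕ) : ∀ w ∈ (freqAlgorithm P).memory ω x t, |w| ≤ B := by
  intro w hw
  rw [memory_eq hP, List.mem_append, mem_listWords, List.length_map] at hw
  rcases hw with hw | rfl | ⟨A, hA, hw⟩
  · exact (abs_le_of_mem_seedWords w hw).trans (by exact_mod_cast hhash)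
  · rw [Nat.abs_cast]
    exact_mod_cast (length_bucketStarts_le ω x t).trans hbuckets
  · obtain ⟨a, ha, rfl⟩ := List.mem_map.1 hA
    have inv := histInv_bucketStarts (ω := ω) (x := x) (two_pos.trans_le hP.two_le_N)
      (one_le_maxBuckets hP) t
    refine (bucketAt_small ω x a t).abs_le_of_mem_bucketWords hu hlist ?_ w hw
    exact (bucketAt_size ω x a t).trans_le ((inv.size_le a ha).trans hsize)

theorem two_pow_hashBits_le (hP : P.Valid) (hu : 1 ≤ P.u) :
    (2 : ℝ) ^ P.hashBits ≤ 2 * P.u + 10 ^ 4 * (1 / (P.γ ^ 2 * P.ε ^ 2)) := by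
  have hcells := two_pow_cellBits_le hP
  have hclog : (2 : ℝ) ^ Nat.clog 2 P.u ≤ 2 * P.u := by exact_mod_cast two_pow_clog_le hu
  have : (0 : ℝ) < 2 ^ P.cellBits := by positivity
  rw [Params.hashBits]
  rcases max_choice (Nat.clog 2 P.u) P.cellBits with h | h <;> rw [h] <;> linarith

/-- The number whose powers bound the words of the algorithm. -/
noncomputable def wordBase (u N : ℕ) (γ ε : ℝ) : ℝ := 2 * N * u / (γ * ε)

section WordBase

variable {u N : ℕ} {γ ε : ℝ}

theorem two_mul_mul_le_wordBase (hγ : 0 < γ) (hγ1 : γ ≤ 1) (hε : 0 < ε) (hε1 : ε ≤ 1) :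
    2 * (N : ℝ) * u ≤ wordBase u N γ ε :=
  le_div_self (by positivity) (mul_pos hγ hε) (mul_le_one₀ hγ1 hε.le hε1)

theorem one_div_le_wordBase (hN : 1 ≤ N) (hu : 1 ≤ u) (hγ : 0 < γ) (hε : 0 < ε) :
    1 / (γ * ε) ≤ wordBase u N γ ε := by
  have hN' : (1 : ℝ) ≤ N := by exact_mod_cast hN
  have hu' : (1 : ℝ) ≤ u := by exact_mod_cast hu
  rw [wordBase]
  gcongr
  nlinarith

theorem one_div_sq_mul_sq_le_wordBase_sq (hN : 1 ≤ N) (hu : 1 ≤ u) (hγ : 0 < γ) (hε : 0 < ε) :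
    1 / (γ ^ 2 * ε ^ 2) ≤ wordBase u N γ ε ^ 2 := by
  rw [← mul_pow, ← one_div_pow]
  gcongr
  exact one_div_le_wordBase hN hu hγ hε

theorem two_mul_le_wordBase (hu : 1 ≤ u) (hγ : 0 < γ) (hγ1 : γ ≤ 1) (hε : 0 < ε) (hε1 : ε ≤ 1) :
    2 * (N : ℝ) ≤ wordBase u N γ ε :=
  (le_mul_of_one_le_right (by positivity) (by exact_mod_cast hu)).trans
    (two_mul_mul_le_wordBase hγ hγ1 hε hε1)

theorem natCast_le_wordBase (hN : 1 ≤ N) (hγ : 0 < γ) (hγ1 : γ ≤ 1) (hε : 0 < ε) (hε1 : ε ≤ 1) :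
    (u : ℝ) ≤ wordBase u N γ ε := by
  have hN' : (1 : ℝ) ≤ N := by exact_mod_cast hN
  exact (le_mul_of_one_le_left (by positivity) (by linarith)).trans
    (two_mul_mul_le_wordBase hγ hγ1 hε hε1)

end WordBase

theorem freqAlgorithm_wordsBoundedBy (hP : P.Valid) :
    (freqAlgorithm P).WordsBoundedBy (2 * P.κ * wordBase P.u P.N P.γ P.ε ^ 3) := by
  intro ω x t w hw
  have hu : 1 ≤ P.u := Fin.pos (x 0)
  have hN : 1 ≤ P.N := one_le_two.trans hP.two_le_N
  have hε1 : P.ε ≤ 1 := by linarith [hP.ε_lt]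
  have hlogN := half_lt_log hP.two_le_N
  have hub := natCast_le_wordBase (u := P.u) hN hP.γ_pos hP.γ_lt.le hP.ε_pos hε1
  have hNb := two_mul_le_wordBase (N := P.N) hu hP.γ_pos hP.γ_lt.le hP.ε_pos hε1
  have hzb := one_div_sq_mul_sq_le_wordBase_sq hN hu hP.γ_pos hP.ε_pos
  generalize wordBase P.u P.N P.γ P.ε = b at *
  have hb1 : 1 ≤ b := by
    have : (1 : ℝ) ≤ P.N := by exact_mod_cast hN
    linarith
  have hb2 : b ≤ b ^ 2 := le_self_pow₀ hb1 (by norm_num)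
  have hb3 : b ^ 2 ≤ b ^ 3 := pow_le_pow_right₀ hb1 (by norm_num)
  have hκ : 10 ^ 5 * b ^ 3 ≤ P.κ * b ^ 3 := mul_le_mul_of_nonneg_right hP.le_κ (by positivity)
  have hhash := two_pow_hashBits_le hP hu
  have hlist := (listLen_le hP).trans (mul_le_mul_of_nonneg_left (one_div_γ_sq_le hP) zero_le_two)
  have hbuckets : (P.maxBuckets : ℝ) ≤ 2 * P.κ * (b ^ 2 * b) := by
    have hκ0 : 0 ≤ P.κ := by linarith [hP.le_κ]
    refine (maxBuckets_le hP).trans ?_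
    gcongr
    · exact (one_div_ε_sq_le hP).trans hzb
    · exact (Real.log_le_self (by positivity)).trans (by linarith)
  have hsize : (P.maxSize : ℝ) ≤ b ^ 2 := by
    calc (P.maxSize : ℝ) = (2 * (P.N : ℝ)) ^ 2 := by rw [Params.maxSize]; push_cast; ring
      _ ≤ b ^ 2 := by gcongr
  have key := abs_le_of_mem_memory hP (B := ⌊2 * P.κ * b ^ 3⌋₊)
    (Nat.le_floor (by push_cast; rw [pow_succ]; linarith)) (Nat.le_floor (by linarith))
    (Nat.le_floor (by linarith)) (Nat.le_floor (by linarith)) (Nat.le_floor (by linarith))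
    ω x t w hw
  calc |(w : ℝ)| ≤ ⌊2 * P.κ * b ^ 3⌋₊ := by exact_mod_cast key
    _ ≤ 2 * P.κ * b ^ 3 := Nat.floor_le (by linarith)

end WordSize

section Approximation

namespace StreamAlgorithm

variable {u : ℕ} {A : StreamAlgorithm u}

theorem UsesWords.mono {M M' : ℝ} (h : A.UsesWords M) (hM : M ≤ M') : A.UsesWords M' :=
  fun ω x n => (h ω x n).trans hM

theorem WordsBoundedBy.mono {B B' : ℝ} (h : A.WordsBoundedBy B) (hB : 1 ≤ u → B ≤ B') :
    A.WordsBoundedBy B' :=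
  fun ω x n w hw => (h ω x n w hw).trans (hB (Fin.pos (x 0)))

theorem Separates.approximatesFrequent {N : ℕ} {γ ε δ hi lo : ℝ} (h : A.Separates N hi lo δ)
    (hhi : hi ≤ γ) (hlo : (1 - ε) * γ ≤ lo) : A.ApproximatesFrequent N γ ε δ := by
  intro x n hn
  refine (h x n hn).trans ?_
  have := A.seedFintype
  rw [prob, prob, ← pr_eq_card_div_card, ← pr_eq_card_div_card]
  have hW : 0 ≤ winL2 N x n := Real.sqrt_nonneg _
  refine pr_mono fun ω ⟨hfrequent, hrare⟩ =>
    ⟨fun i hi => hfrequent i ?_, fun i hi => hrare i ?_⟩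
  · exact (mul_le_mul_of_nonneg_right hhi hW).trans hi.le
  · exact hi.trans_le (mul_le_mul_of_nonneg_right hlo hW)

end StreamAlgorithm

variable {u N : ℕ} {γ ε δ : ℝ}

theorem four_le_wordBase (hN : 2 ≤ N) (hu : 1 ≤ u) (hγ : 0 < γ) (hγ1 : γ ≤ 1) (hε : 0 < ε)
    (hε1 : ε ≤ 1) : 4 ≤ wordBase u N γ ε := by
  have hN' : (2 : ℝ) ≤ N := by exact_mod_cast hN
  linarith [two_mul_le_wordBase (N := N) hu hγ hγ1 hε hε1]

theorem freqAlgorithm_wordsBoundedBy_pow {P : Params} (hP : P.Valid) (hκ : P.κ = 10 ^ 5) :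
    (freqAlgorithm P).WordsBoundedBy (wordBase P.u P.N P.γ P.ε ^ 12) := by
  refine (freqAlgorithm_wordsBoundedBy hP).mono fun hu => ?_
  have hε1 : P.ε ≤ 1 := by linarith [hP.ε_lt]
  have four_le := four_le_wordBase hP.two_le_N hu hP.γ_pos hP.γ_lt.le hP.ε_pos hε1
  generalize wordBase P.u P.N P.γ P.ε = b at *
  calc 2 * P.κ * b ^ 3 ≤ 4 ^ 9 * b ^ 3 := by
        rw [hκ]
        gcongr
        norm_num
    _ ≤ b ^ 9 * b ^ 3 := by gcongr
    _ = b ^ 12 := by rw [← pow_add]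

/-- Parameters for which the two thresholds of the algorithm lie between `(1 - ε) γ` and `γ`. The
gap `4 ε' / γ` between the thresholds is relative to `1 / γ`, so `ε'` has to be a multiple of
`ε γ`; and `γ` is lowered so that the upper threshold `(1 + 4 ε') γ'` is exactly `γ`. -/
noncomputable def sharpParams (u N : ℕ) (γ ε δ : ℝ) : Params :=
  ⟨u, N, γ / (1 + 4 * (ε * γ / 16)), ε * γ / 16, δ, 10 ^ 5⟩

theorem sharpParams_valid (hN : 2 ≤ N) (hγ : 0 < γ) (hγ1 : γ < 1) (hε : 0 < ε) (hε1 : ε < 1)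
    (hδ : 0 < δ) (hδ1 : δ < 1) : (sharpParams u N γ ε δ).Valid := by
  have hεγ : 0 < ε * γ := mul_pos hε hγ
  have hεγ1 : ε * γ < 1 := mul_lt_one_of_nonneg_of_lt_one_left hε.le hε1 hγ1.le
  refine ⟨hN, ?_, ?_, ?_, ?_, hδ, hδ1, le_rfl⟩ <;> simp only [sharpParams]
  · positivity
  · rw [div_lt_one (by positivity)]
    linarith
  · positivity
  · linarith

theorem one_div_sharpParams_γ_le (hγ : 0 < γ) (hγ1 : γ ≤ 1) (hε1 : ε ≤ 1) :
    1 / (sharpParams u N γ ε δ).γ ≤ 2 * (1 / γ) := by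
  have hεγ1 : ε * γ ≤ 1 := mul_le_one₀ hε1 hγ.le hγ1
  rw [sharpParams, one_div_div, div_eq_mul_one_div]
  gcongr
  linarith

theorem one_div_sharpParams_ε : 1 / (sharpParams u N γ ε δ).ε = 16 * (1 / ε * (1 / γ)) := by
  rw [sharpParams, one_div_div, div_eq_mul_one_div, one_div_mul_one_div]

theorem one_sub_mul_le_sharpParams_γ_sub (hγ : 0 < γ) (hγ1 : γ ≤ 1) (hε : 0 < ε) :
    (1 - ε) * γ ≤ (sharpParams u N γ ε δ).γ - 4 * (sharpParams u N γ ε δ).ε := by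
  have hεγ : 0 < ε * γ := mul_pos hε hγ
  have hγ' : γ * (1 - 4 * (ε * γ / 16)) ≤ γ / (1 + 4 * (ε * γ / 16)) := by
    rw [le_div_iff₀ (by positivity), mul_assoc]
    exact mul_le_of_le_one_right hγ.le (by nlinarith)
  have : ε * γ * γ ≤ ε * γ := mul_le_of_le_one_right hεγ.le hγ1
  simp only [sharpParams]
  linarith

theorem sharpParams_approximatesFrequent (hP : (sharpParams u N γ ε δ).Valid) (hγ : 0 < γ)
    (hγ1 : γ ≤ 1) (hε : 0 < ε) :
    (freqAlgorithm (sharpParams u N γ ε δ)).ApproximatesFrequent N γ ε δ := by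
  refine (freqAlgorithm_separates hP).approximatesFrequent ?_ ?_
  · rw [sharpParams, mul_div_cancel₀ _ (by positivity)]
  · have := hP.γ_pos
    have thresholds := one_sub_mul_le_sharpParams_γ_sub (u := u) (N := N) (δ := δ) hγ hγ1 hε
    refine thresholds.trans_eq ?_
    field_simp

open MvPolynomial in
/-- The bound on the memory in part (b), as a polynomial in `1 / ε`, `1 / γ`, `log N` and
`log (1 / δ)`: the bound for `sharpParams`, with `1 / γ' ≤ 2 / γ`, `1 / ε' = 16 / (ε γ)` and
`log (1 / ε') ≤ 1 / ε'`. -/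
noncomputable def memoryPoly : MvPolynomial (Fin 4) ℝ :=
  C (70 * (10 ^ 5) ^ 3) * ((C 2 * X 1) ^ 2 * (C 16 * (X 0 * X 1)) ^ 4 * X 2 * (X 2 + X 3) +
    (C 16 * (X 0 * X 1)) ^ 4 * X 2 * (C 16 * (X 0 * X 1)))

theorem sharpParams_usesWords (hP : (sharpParams u N γ ε δ).Valid) (hγ : 0 < γ) (hγ1 : γ ≤ 1)
    (hε : 0 < ε) (hε1 : ε ≤ 1) :
    (freqAlgorithm (sharpParams u N γ ε δ)).UsesWords
      (MvPolynomial.eval ![1 / ε, 1 / γ, Real.log N, Real.log (1 / δ)] memoryPoly) := by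
  refine (freqAlgorithm_usesWords hP).mono ?_
  have hγ' := one_div_sharpParams_γ_le (u := u) (N := N) (δ := δ) hγ hγ1 hε1
  have hε' := one_div_sharpParams_ε (u := u) (N := N) (γ := γ) (ε := ε) (δ := δ)
  have : 0 ≤ Real.log N := Real.log_natCast_nonneg N
  have hδ : 0 < δ := hP.δ_pos
  have hlogδ : 0 ≤ Real.log (1 / δ) := Real.log_nonneg ((one_le_div hδ).2 hP.δ_lt.le)
  have hlogε : Real.log (16 * (1 / ε * (1 / γ))) ≤ 16 * (1 / ε * (1 / γ)) :=
    Real.log_le_self (by positivity)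
  have hlogNδ : Real.log ((sharpParams u N γ ε δ).N / (sharpParams u N γ ε δ).δ) =
      Real.log N + Real.log (1 / δ) := by
    have : (N : ℝ) ≠ 0 := by exact_mod_cast (two_pos.trans_le hP.two_le_N).ne'
    change Real.log (N / δ) = _
    rw [div_eq_mul_one_div, Real.log_mul this (one_div_pos.2 hδ).ne']
  have heval : MvPolynomial.eval ![1 / ε, 1 / γ, Real.log N, Real.log (1 / δ)] memoryPoly =
      70 * (10 ^ 5) ^ 3 * ((2 * (1 / γ)) ^ 2 * (16 * (1 / ε * (1 / γ))) ^ 4 * Real.log N *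
        (Real.log N + Real.log (1 / δ)) +
        (16 * (1 / ε * (1 / γ))) ^ 4 * Real.log N * (16 * (1 / ε * (1 / γ)))) := by
    simp [memoryPoly]
  have := one_div_pos.2 hP.γ_pos
  rw [heval, hlogNδ, ← one_div_mul_one_div, ← one_div_pow, ← one_div_pow, hε']
  change 70 * (10 ^ 5) ^ 3 * (_ * Real.log N * _ + _ * Real.log N * _) ≤ _
  gcongr

theorem wordBase_sharpParams_le (hN : 1 ≤ N) (hu : 1 ≤ u) (hγ : 0 < γ) (hγ1 : γ ≤ 1)
    (hε : 0 < ε) (hε1 : ε ≤ 1) :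
    wordBase u N (sharpParams u N γ ε δ).γ (sharpParams u N γ ε δ).ε ≤
      32 * wordBase u N γ ε ^ 2 := by
  have one_div_le : 1 / γ ≤ wordBase u N γ ε :=
    (one_div_le_one_div_of_le (by positivity) (mul_le_of_le_one_right hγ.le hε1)).trans
      (one_div_le_wordBase hN hu hγ hε)
  have hbase : 0 ≤ wordBase u N γ ε := by rw [wordBase]; positivity
  calc wordBase u N (sharpParams u N γ ε δ).γ (sharpParams u N γ ε δ).ε
      = 2 * N * u * (1 / (sharpParams u N γ ε δ).γ * (16 * (1 / ε * (1 / γ)))) := by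
        rw [wordBase, div_eq_mul_one_div, ← one_div_mul_one_div, one_div_sharpParams_ε]
    _ ≤ 2 * N * u * (2 * (1 / γ) * (16 * (1 / ε * (1 / γ)))) := by
        gcongr
        exact one_div_sharpParams_γ_le hγ hγ1 hε1
    _ = 32 * (1 / γ) * wordBase u N γ ε := by
        rw [wordBase]
        field
    _ ≤ 32 * wordBase u N γ ε * wordBase u N γ ε := by gcongr
    _ = 32 * wordBase u N γ ε ^ 2 := by ring

theorem sharpParams_wordsBoundedBy (hP : (sharpParams u N γ ε δ).Valid) (hγ : 0 < γ)
    (hγ1 : γ ≤ 1) (hε : 0 < ε) (hε1 : ε ≤ 1) :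
    (freqAlgorithm (sharpParams u N γ ε δ)).WordsBoundedBy (wordBase u N γ ε ^ 60) := by
  refine (freqAlgorithm_wordsBoundedBy_pow hP rfl).mono fun (hu : 1 ≤ u) => ?_
  have hN : 2 ≤ N := hP.two_le_N
  have four_le := four_le_wordBase hN hu hγ hγ1 hε hε1
  have base_le := wordBase_sharpParams_le (δ := δ) (one_le_two.trans hN) hu hγ hγ1 hε hε1
  calc wordBase u N (sharpParams u N γ ε δ).γ (sharpParams u N γ ε δ).ε ^ 12
      ≤ (4 ^ 3 * wordBase u N γ ε ^ 2) ^ 12 := by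
        have := hP.γ_pos
        have := hP.ε_pos
        gcongr
        · rw [wordBase]; positivity
        · exact base_le.trans (by gcongr; norm_num)
    _ ≤ (wordBase u N γ ε ^ 3 * wordBase u N γ ε ^ 2) ^ 12 := by gcongr
    _ = wordBase u N γ ε ^ 60 := by rw [← pow_add, ← pow_mul]

end Approximation

end SlidingWindow

open SlidingWindow in
theorem mainTheorem1 :
    (∃ κ c₀ ε₀ C : ℝ, ∃ d : ℕ, 0 < κ ∧ 0 < c₀ ∧ 0 < ε₀ ∧ 0 < C ∧
      ∀ (u N : ℕ) (γ ε δ : ℝ), 2 ≤ N → 0 < γ → γ < 1 → 0 < ε → ε < ε₀ →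
        0 < δ → δ < 1 →
        (freqAlgorithm ⟨u, N, γ, ε, δ, κ⟩).Separates N
          ((1 + c₀ * ε) * γ) ((1 - c₀ / γ * ε) * γ) δ ∧
        (freqAlgorithm ⟨u, N, γ, ε, δ, κ⟩).UsesWords
          (C * (1 / (γ ^ 2 * ε ^ 4) * Real.log N * Real.log (N / δ)
            + 1 / ε ^ 4 * Real.log N * Real.log (1 / ε))) ∧
        (freqAlgorithm ⟨u, N, γ, ε, δ, κ⟩).WordsBoundedBy ((2 * N * u / (γ * ε)) ^ d)) ∧
    (∃ (p : MvPolynomial (Fin 4) ℝ) (d : ℕ),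
      ∀ (u N : ℕ) (γ ε δ : ℝ), 2 ≤ N → 0 < γ → γ < 1 → 0 < ε → ε < 1 →
        0 < δ → δ < 1 →
        ∃ A : StreamAlgorithm u,
          A.ApproximatesFrequent N γ ε δ ∧
          A.UsesWords (MvPolynomial.eval ![1 / ε, 1 / γ, Real.log N, Real.log (1 / δ)] p) ∧
          A.WordsBoundedBy ((2 * N * u / (γ * ε)) ^ d)) := by
  refine ⟨⟨10 ^ 5, 4, 1 / 8, 70 * (10 ^ 5) ^ 3, 12, by norm_num, by norm_num, by norm_num,
    by norm_num, fun u N γ ε δ hN hγ hγ1 hε hε1 hδ hδ1 => ?_⟩,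
    memoryPoly, 60, fun u N γ ε δ hN hγ hγ1 hε hε1 hδ hδ1 => ?_⟩
  · have hP : Params.Valid ⟨u, N, γ, ε, δ, 10 ^ 5⟩ := ⟨hN, hγ, hγ1, hε, hε1, hδ, hδ1, le_rfl⟩
    exact ⟨freqAlgorithm_separates hP, freqAlgorithm_usesWords hP,
      freqAlgorithm_wordsBoundedBy_pow hP rfl⟩
  · have hP := sharpParams_valid (u := u) hN hγ hγ1 hε hε1 hδ hδ1
    exact ⟨freqAlgorithm (sharpParams u N γ ε δ),
      sharpParams_approximatesFrequent hP hγ hγ1.le hε,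
      sharpParams_usesWords hP hγ hγ1.le hε hε1.le,
      sharpParams_wordsBoundedBy hP hγ hγ1.le hε hε1.le⟩
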